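/- Let $k$ be an algebraically closed field, $q\in k^\times$, $m\ge 2$, and let $F_0,F_1\in GL_m(k)$ satisfy $\operatorname{Tr}(F_i^{-1}F_i^t)=-q-q^{-1}$ for $i=0,1$. Assume that $F_0^{-1}F_0^t$ and $F_1^{-1}F_1^t$ have the same characteristic polynomial. Notation. For a commutative ring $R$, $E\in GL_n(R)$ and $F\in GL_m(R)$, let $\mathcal B_R(E,F)$ be the $R$-algebra generated by the entries of an $n\times m$ matrix $z$ subject to $F^{-1}z^tEz=I_m$ and $zF^{-1}z^tE=I_n$. Let $\mathcal B_R(E)=\mathcal B_R(E,E)$, with generators $a_{ij}$; it is a Hopf algebra with $\Delta(a_{ij})=\sum_p a_{ip}\otimes a_{pj}$, $\varepsilon(a_{ij})=\delta_{ij}$, $S(a)=E^{-1}a^tE$, and it coacts on $\mathcal B_R(E,F)$ by $z_{ij}\mapsto\sum_p a_{ip}\otimes z_{pj}$. Let $E_q=\begin{pmatrix}0&1\\-q^{-1}&0\end{pmatrix}$, so that $\mathcal O_q(SL(2))=\mathcal B_k(E_q)$. A (left) $H$-Galois object over $R$ is a faithfully flat $R$-algebra $Z$ with a left $H$-comodule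 algebra structure $\delta$ whose coinvariants are $R$ and for which $Z\otimes_R Z\to H\otimes_R Z$, $x\otimes y\mapsto\delta(x)(1\otimes y)$, is bijective. Two $H$-Galois objects $Z_0,Z_1$ over $k$ are homotopy equivalent if there is an $H[t]$-Galois object $Z$ over $k[t]$, where $H[t]=k[t]\otimes_k H$, whose specializations at $t=0$ and $t=1$ are isomorphic, as $H$-comodule algebras, to $Z_0$ and $Z_1$; such a $Z$ is called a homotopy. A matrix $F\in GL_m(R)$ is manageable if the last entry of the last row of $F^{-1}$ is $0$ and the rightmost nonzero entry of that row is invertible. Conclusion. $\mathcal B_k(E_q,F_0)$ and $\mathcal B_k(E_q,F_1)$ are $\mathcal O_q(SL(2))$-Galois objects, and they are homotopy equivalent. Moreover, there is a manageable matrix $F(t)\in GL_m(k[t])$ with $\operatorname{Tr}(F(t)^{-1}F(t)^t)=-q-q^{-1}$, with $F(0)=P_0F_0P_0^t$ and $F(1)=P_1F_1P_1^t$ for some $P_0,P_1\in GL_m(k)$, and such that $\mathcal B_{k[t]}(E_q,F(t))$ is a homotopy between $\mathcal B_k(E_q,F_0)$ and $\mathcal B_k(E_q,F_1)$. -/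

import Mathlib

open scoped TensorProduct Polynomial Matrix

universe u v w

noncomputable section

/-- A left `H`-comodule algebra structure on the `R`-algebra `Z`: a coassociative and counital
coaction `Z → H ⊗ Z` which is a morphism of algebras. -/
structure LeftComoduleAlgebra (R : Type u) (H : Type v) (Z : Type w) [CommRing R] [Ring H]
    [HopfAlgebra R H] [Ring Z] [Algebra R Z] where
  coact : Z →ₐ[R] H ⊗[R] Z
  coassoc : ((Algebra.TensorProduct.assoc R R R H H Z).toAlgHom.comp
      (Algebra.TensorProduct.map (Bialgebra.comulAlgHom R H) (AlgHom.id R Z))).comp coact =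
    (Algebra.TensorProduct.map (AlgHom.id R H) coact).comp coact
  counit_coact : ((Algebra.TensorProduct.lid R Z).toAlgHom.comp
      (Algebra.TensorProduct.map (Bialgebra.counitAlgHom R H) (AlgHom.id R Z))).comp coact =
    AlgHom.id R Z

namespace LeftComoduleAlgebra

section
variable {R : Type u} {H : Type v} {Z Z' : Type*} [CommRing R] [Ring H] [HopfAlgebra R H]
  [Ring Z] [Algebra R Z] [Ring Z'] [Algebra R Z']

/-- The subalgebra of coinvariant elements, `{z | δ z = 1 ⊗ z}`. -/
def coinvariants (δ : LeftComoduleAlgebra R H Z) : Subalgebra R Z :=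
  AlgHom.equalizer δ.coact Algebra.TensorProduct.includeRight

/-- The canonical map `Z ⊗ Z → H ⊗ Z`, `z ⊗ z' ↦ δ(z)(1 ⊗ z')`. -/
def can (δ : LeftComoduleAlgebra R H Z) : Z ⊗[R] Z →ₗ[R] H ⊗[R] Z :=
  TensorProduct.lift
    ((LinearMap.mul R (H ⊗[R] Z)).compl₁₂ δ.coact.toLinearMap
      (Algebra.TensorProduct.includeRight : Z →ₐ[R] H ⊗[R] Z).toLinearMap)

/-- A Galois object: the coinvariants are the base ring, the canonical map is bijective, and `Z` is
faithfully flat over the base ring. -/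
structure IsGaloisObject (δ : LeftComoduleAlgebra R H Z) : Prop where
  coinvariants_eq : δ.coinvariants = ⊥
  can_bijective : Function.Bijective δ.can
  faithfullyFlat : Module.FaithfullyFlat R Z

/-- Isomorphism of `H`-comodule algebras. -/
def IsIsomorphic (δ : LeftComoduleAlgebra R H Z) (δ' : LeftComoduleAlgebra R H Z') : Prop :=
  ∃ e : Z ≃ₐ[R] Z', (Algebra.TensorProduct.map (AlgHom.id R H) e.toAlgHom).comp δ.coact =
    δ'.coact.comp e.toAlgHom
end

section baseChange
variable {K K' : Type u} [CommRing K] [CommRing K'] [Algebra K K']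
  {H' : Type*} {H : Type v} [Ring H'] [HopfAlgebra K H'] [Ring H] [HopfAlgebra K' H] [Algebra K H]
  [IsScalarTower K K' H]

section tensorMap
variable {A B C : Type*} [Ring A] [Algebra K A] [Ring B] [Algebra K B]
    [Ring C] [Algebra K' C] [Algebra K C] [IsScalarTower K K' C]

lemma tensorMap_commute (p : A →ₐ[K] H) (g : B →ₐ[K] C) (x : A) (y : B) :
    Commute
      (((Algebra.TensorProduct.includeLeft : H →ₐ[K'] H ⊗[K'] C).restrictScalars K).comp p x)
      (((Algebra.TensorProduct.includeRight : C →ₐ[K'] H ⊗[K'] C).restrictScalars K).comp g y) :=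
  (Commute.one_right _).tmul (Commute.one_left _)

/-- For a `K`-algebra map `p` into `H` and `g` into `C`, the map `a ⊗ b ↦ p a ⊗ g b`, where the
target is a tensor product over the `K`-algebra `K'`. -/
def tensorMap (p : A →ₐ[K] H) (g : B →ₐ[K] C) : A ⊗[K] B →ₐ[K] H ⊗[K'] C :=
  Algebra.TensorProduct.lift
    (((Algebra.TensorProduct.includeLeft : H →ₐ[K'] H ⊗[K'] C).restrictScalars K).comp p)
    (((Algebra.TensorProduct.includeRight : C →ₐ[K'] H ⊗[K'] C).restrictScalars K).comp g)
    (tensorMap_commute p g)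

@[simp]
lemma tensorMap_tmul (p : A →ₐ[K] H) (g : B →ₐ[K] C) (a : A) (b : B) :
    (tensorMap p g : A ⊗[K] B →ₐ[K] H ⊗[K'] C) (a ⊗ₜ b) = p a ⊗ₜ g b := by
  rw [tensorMap, Algebra.TensorProduct.lift_tmul]
  simp
end tensorMap

variable {Z : Type w} [Ring Z] [Algebra K Z]

lemma baseChangeCoact_commute (p : H' →ₐ[K] H) (c : Z →ₐ[K] H' ⊗[K] Z) (x : K') (z : Z) :
    Commute (Algebra.ofId K' (H ⊗[K'] (K' ⊗[K] Z)) x)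
      ((tensorMap p (Algebra.TensorProduct.includeRight : Z →ₐ[K] K' ⊗[K] Z)).comp c z) :=
  Algebra.commute_algebraMap_left x _

/-- The `K'`-algebra map `K' ⊗ Z → H ⊗ (K' ⊗ Z)` determined by
`1 ⊗ z ↦ ∑ p(z₋₁) ⊗ (1 ⊗ z₀)`. -/
def baseChangeCoact (p : H' →ₐ[K] H) (c : Z →ₐ[K] H' ⊗[K] Z) :
    K' ⊗[K] Z →ₐ[K'] H ⊗[K'] (K' ⊗[K] Z) :=
  Algebra.TensorProduct.lift (Algebra.ofId K' (H ⊗[K'] (K' ⊗[K] Z)))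
    ((tensorMap p (Algebra.TensorProduct.includeRight : Z →ₐ[K] K' ⊗[K] Z)).comp c)
    (baseChangeCoact_commute p c)

lemma baseChangeCoact_tmul (p : H' →ₐ[K] H) (c : Z →ₐ[K] H' ⊗[K] Z) (z : Z) :
    (baseChangeCoact p c : K' ⊗[K] Z →ₐ[K'] H ⊗[K'] (K' ⊗[K] Z)) ((1 : K') ⊗ₜ[K] z) =
      (tensorMap p (Algebra.TensorProduct.includeRight : Z →ₐ[K] K' ⊗[K] Z) :
        H' ⊗[K] Z →ₐ[K] H ⊗[K'] (K' ⊗[K] Z)) (c z) := by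
  rw [baseChangeCoact, Algebra.TensorProduct.lift_tmul, map_one, one_mul]
  rfl

/-- Base change of a left `H'`-comodule algebra `Z` over `K` to the left `H`-comodule algebra
`K' ⊗ Z` over `K'`, along a map `p : H' → H` compatible with comultiplications and counits. -/
def baseChange (p : H' →ₐ[K] H)
    (hΔ : ∀ h : H', Coalgebra.comul (R := K') (p h) =
      (tensorMap p p : H' ⊗[K] H' →ₐ[K] H ⊗[K'] H) (Coalgebra.comul (R := K) h))
    (hε : ∀ h : H', Coalgebra.counit (R := K') (p h) =
      algebraMap K K' (Coalgebra.counit (R := K) h))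
    (δ : LeftComoduleAlgebra K H' Z) : LeftComoduleAlgebra K' H (K' ⊗[K] Z) where
  coact := baseChangeCoact p δ.coact
  coassoc := by
    have key : ∀ y : H' ⊗[K] Z,
        Algebra.TensorProduct.assoc K' K' K' H H (K' ⊗[K] Z)
          (Algebra.TensorProduct.map (Bialgebra.comulAlgHom K' H) (AlgHom.id K' (K' ⊗[K] Z))
            ((tensorMap p (Algebra.TensorProduct.includeRight : Z →ₐ[K] K' ⊗[K] Z) :
              H' ⊗[K] Z →ₐ[K] H ⊗[K'] (K' ⊗[K] Z)) y)) =
        (tensorMap p (tensorMap p (Algebra.TensorProduct.includeRight : Z →ₐ[K] K' ⊗[K] Z)) :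
            H' ⊗[K] (H' ⊗[K] Z) →ₐ[K] H ⊗[K'] (H ⊗[K'] (K' ⊗[K] Z)))
          (Algebra.TensorProduct.assoc K K K H' H' Z
            (Algebra.TensorProduct.map (Bialgebra.comulAlgHom K H') (AlgHom.id K Z) y)) := by
      intro y
      induction y with
      | zero => simp
      | add a b ha hb => simp only [map_add, ha, hb]
      | tmul h z =>
        simp only [tensorMap_tmul, Algebra.TensorProduct.map_tmul, Bialgebra.comulAlgHom_apply, hΔ,
          AlgHom.id_apply]
        generalize Coalgebra.comul (R := K) h = c
        induction c with
        | zero => simp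
        | add a b ha hb => simp only [map_add, TensorProduct.add_tmul, ha, hb]
        | tmul a b => simp
    have key2 : ∀ y : H' ⊗[K] Z,
        Algebra.TensorProduct.map (AlgHom.id K' H) (baseChangeCoact p δ.coact)
            ((tensorMap p (Algebra.TensorProduct.includeRight : Z →ₐ[K] K' ⊗[K] Z) :
              H' ⊗[K] Z →ₐ[K] H ⊗[K'] (K' ⊗[K] Z)) y) =
        (tensorMap p (tensorMap p (Algebra.TensorProduct.includeRight : Z →ₐ[K] K' ⊗[K] Z)) :
            H' ⊗[K] (H' ⊗[K] Z) →ₐ[K] H ⊗[K'] (H ⊗[K'] (K' ⊗[K] Z)))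
          (Algebra.TensorProduct.map (AlgHom.id K H') δ.coact y) := by
      intro y
      induction y with
      | zero => simp
      | add a b ha hb => simp only [map_add, ha, hb]
      | tmul h z => simp [baseChangeCoact_tmul]
    apply Algebra.TensorProduct.ext
    · ext
    · apply AlgHom.ext
      intro z
      have h := DFunLike.congr_fun δ.coassoc z
      simp only [AlgHom.comp_apply] at h
      simp only [AlgHom.comp_apply, AlgHom.restrictScalars_apply,
        Algebra.TensorProduct.includeRight_apply, baseChangeCoact_tmul, key2, ← h]
      exact key _
  counit_coact := by
    have key : ∀ y : H' ⊗[K] Z,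
        Algebra.TensorProduct.lid K' (K' ⊗[K] Z)
          (Algebra.TensorProduct.map (Bialgebra.counitAlgHom K' H) (AlgHom.id K' (K' ⊗[K] Z))
            ((tensorMap p (Algebra.TensorProduct.includeRight : Z →ₐ[K] K' ⊗[K] Z) :
              H' ⊗[K] Z →ₐ[K] H ⊗[K'] (K' ⊗[K] Z)) y)) =
        1 ⊗ₜ (Algebra.TensorProduct.lid K Z
            (Algebra.TensorProduct.map (Bialgebra.counitAlgHom K H') (AlgHom.id K Z) y)) := by
      intro y
      induction y with
      | zero => simp
      | add a b ha hb => simp only [map_add, ha, hb, TensorProduct.tmul_add]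
      | tmul h z => simp [hε]
    apply Algebra.TensorProduct.ext
    · ext
    · apply AlgHom.ext
      intro z
      have h := DFunLike.congr_fun δ.counit_coact z
      simp only [AlgHom.comp_apply] at h
      simp only [AlgHom.comp_apply, AlgHom.restrictScalars_apply,
        Algebra.TensorProduct.includeRight_apply, baseChangeCoact_tmul, AlgHom.id_apply]
      exact (key _).trans (congrArg _ h)
end baseChange

section augmentation
variable {k A : Type u} [CommRing k] [CommRing A] [Algebra k A] [Algebra A k] [IsScalarTower k A k]
  {H : Type v} [Ring H] [HopfAlgebra k H] [Algebra A H] [IsScalarTower A k H] [IsScalarTower k A H]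

lemma augment_commute (a : A) (h : H) : Commute (Algebra.ofId A H a) (AlgHom.id k H h) :=
  Algebra.commute_algebraMap_left a h

/-- For a `k`-algebra `A` with an augmentation `A → k`, the map `A ⊗ H → H`, `a ⊗ h ↦ a h`. -/
def augment : A ⊗[k] H →ₐ[A] H :=
  Algebra.TensorProduct.lift (Algebra.ofId A H) (AlgHom.id k H) augment_commute

lemma augment_tmul (a : A) (h : H) : augment (a ⊗ₜ[k] h) = a • h := by
  rw [augment, Algebra.TensorProduct.lift_tmul, Algebra.smul_def]
  simp

lemma augment_comul (x : A ⊗[k] H) :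
    Coalgebra.comul (R := k) (augment x) =
      (tensorMap augment augment : (A ⊗[k] H) ⊗[A] (A ⊗[k] H) →ₐ[A] H ⊗[k] H)
        (Coalgebra.comul (R := A) x) := by
  induction x with
  | zero => simp
  | add a b ha hb => simp only [map_add, ha, hb]
  | tmul f h =>
    rw [TensorProduct.comul_tmul, augment_tmul, ← IsScalarTower.algebraMap_smul k f h, map_smul]
    generalize Coalgebra.comul (R := k) h = c
    induction c with
    | zero => simp
    | add a b ha hb => simp only [map_add, smul_add, TensorProduct.tmul_add, ha, hb]
    | tmul a b =>
      have h1 : (f • b : H) = algebraMap A k f • b := (IsScalarTower.algebraMap_smul k f b).symm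
      rw [CommSemiring.comul_apply, TensorProduct.AlgebraTensorModule.tensorTensorTensorComm_tmul,
        tensorMap_tmul, augment_tmul, augment_tmul, one_smul, h1, TensorProduct.tmul_smul]

lemma augment_counit (x : A ⊗[k] H) :
    Coalgebra.counit (R := k) (augment x) = algebraMap A k (Coalgebra.counit (R := A) x) := by
  induction x with
  | zero => simp
  | add a b ha hb => simp only [map_add, ha, hb]
  | tmul f h =>
    rw [augment_tmul, ← IsScalarTower.algebraMap_smul k f h, map_smul]
    simp [Algebra.smul_def, mul_comm, ← IsScalarTower.algebraMap_apply]

end augmentation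

section homotopy
variable {k : Type u} [Field k] {H : Type v} [Ring H] [HopfAlgebra k H]

variable (k) in
/-- The fibre `k ⊗_{k[t]} Z` at `t = i` of a `k[t]`-algebra `Z`, that is, `k` is a `k[t]`-algebra
through evaluation at `i`. -/
def EvalFiber (i : k) (Z : Type w) [Ring Z] [Algebra k[X] Z] : Type (max u w) :=
  letI : Algebra k[X] k := (Polynomial.evalRingHom i).toAlgebra
  k ⊗[k[X]] Z

instance (i : k) (Z : Type w) [Ring Z] [Algebra k[X] Z] : Ring (EvalFiber k i Z) :=
  letI : Algebra k[X] k := (Polynomial.evalRingHom i).toAlgebra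
  (Algebra.TensorProduct.instRing : Ring (k ⊗[k[X]] Z))

instance (i : k) (Z : Type w) [Ring Z] [Algebra k[X] Z] : Algebra k (EvalFiber k i Z) :=
  letI : Algebra k[X] k := (Polynomial.evalRingHom i).toAlgebra
  (Algebra.TensorProduct.leftAlgebra : Algebra k (k ⊗[k[X]] Z))

/-- The map `[i]_*`: the specialization at `t = i` of an `H[t]`-comodule algebra `Z` over `k[t]`,
where `H[t] = k[t] ⊗ H`. It is the fibre of `Z` at `i`, with the coaction induced by that of `Z` and
the evaluation `H[t] → H`, `f ⊗ h ↦ f(i) h`. -/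
def evalAt (i : k) {Z : Type w} [Ring Z] [Algebra k[X] Z]
    (δ : LeftComoduleAlgebra k[X] (k[X] ⊗[k] H) Z) : LeftComoduleAlgebra k H (EvalFiber k i Z) :=
  letI : Algebra k[X] k := (Polynomial.evalRingHom i).toAlgebra
  letI : Algebra k[X] H := Algebra.compHom H (Polynomial.evalRingHom i)
  haveI : IsScalarTower k[X] k H := IsScalarTower.of_algebraMap_eq (fun _ => rfl)
  haveI : IsScalarTower k k[X] k := IsScalarTower.of_algebraMap_eq (fun x => by
    simp [RingHom.algebraMap_toAlgebra])
  haveI : IsScalarTower k k[X] H := IsScalarTower.of_algebraMap_eq (fun x => by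
    rw [IsScalarTower.algebraMap_apply k[X] k H, ← IsScalarTower.algebraMap_apply k k[X] k]
    rfl)
  baseChange augment augment_comul augment_counit δ

/-- `Z` is an `H[t]`-Galois object over `k[t]` whose specializations at `0` and `1` are isomorphic
to `Z₀` and `Z₁`. -/
def IsHomotopy {Z : Type*} [Ring Z] [Algebra k[X] Z] {Z₀ Z₁ : Type w}
    [Ring Z₀] [Algebra k Z₀] [Ring Z₁] [Algebra k Z₁]
    (δ : LeftComoduleAlgebra k[X] (k[X] ⊗[k] H) Z)
    (δ₀ : LeftComoduleAlgebra k H Z₀) (δ₁ : LeftComoduleAlgebra k H Z₁) : Prop :=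
  δ.IsGaloisObject ∧ (δ.evalAt 0).IsIsomorphic δ₀ ∧ (δ.evalAt 1).IsIsomorphic δ₁

/-- Two left `H`-Galois objects are homotopy equivalent if there is an `H[t]`-Galois object over
`k[t]` which specializes to them at `t = 0` and `t = 1`. -/
def HomotopyEquivalent {k H Z₀ Z₁ : Type u} [Field k] [Ring H] [HopfAlgebra k H]
    [Ring Z₀] [Algebra k Z₀] [Ring Z₁] [Algebra k Z₁]
    (δ₀ : LeftComoduleAlgebra k H Z₀) (δ₁ : LeftComoduleAlgebra k H Z₁) : Prop :=
  ∃ (Z : Type u) (_ : Ring Z) (_ : Algebra k[X] Z)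
    (δ : LeftComoduleAlgebra k[X] (k[X] ⊗[k] H) Z), IsHomotopy δ δ₀ δ₁

end homotopy

end LeftComoduleAlgebra

namespace BilinearQuantum

section relations
variable {R : Type u} [CommRing R] {n m l : ℕ}

/-- A scalar matrix, seen as a matrix over an algebra. -/
abbrev scalarMat (A : Type v) [Ring A] [Algebra R A] (M : Matrix (Fin n) (Fin m) R) :
    Matrix (Fin n) (Fin m) A := M.map (algebraMap R A)

variable (E : GL (Fin n) R) (F : GL (Fin m) R) {A : Type v} [Ring A] [Algebra R A]

/-- `F⁻¹ zᵗ E z`. -/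
def leftSide (z : Matrix (Fin n) (Fin m) A) : Matrix (Fin m) (Fin m) A :=
  scalarMat A (F⁻¹).val * z.transpose * scalarMat A E.val * z

/-- `z F⁻¹ zᵗ E`. -/
def rightSide (z : Matrix (Fin n) (Fin m) A) : Matrix (Fin n) (Fin n) A :=
  z * scalarMat A (F⁻¹).val * z.transpose * scalarMat A E.val

/-- The matrix relations `F⁻¹ zᵗ E z = 1` and `z F⁻¹ zᵗ E = 1`. -/
structure Rel (z : Matrix (Fin n) (Fin m) A) : Prop where
  left : leftSide E F z = 1
  right : rightSide E F z = 1

/-- The matrix of free generators. -/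
def freeGen (R : Type u) [CommRing R] (n m : ℕ) :
    Matrix (Fin n) (Fin m) (FreeAlgebra R (Fin n × Fin m)) :=
  Matrix.of fun i j => FreeAlgebra.ι R (i, j)

/-- The defining relations of `B(E,F)`, entry by entry. -/
inductive DefRel : FreeAlgebra R (Fin n × Fin m) → FreeAlgebra R (Fin n × Fin m) → Prop
  | left (i j : Fin m) : DefRel (leftSide E F (freeGen R n m) i j)
      ((1 : Matrix (Fin m) (Fin m) (FreeAlgebra R (Fin n × Fin m))) i j)
  | right (i j : Fin n) : DefRel (rightSide E F (freeGen R n m) i j)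
      ((1 : Matrix (Fin n) (Fin n) (FreeAlgebra R (Fin n × Fin m))) i j)

lemma scalarMat_map {A B : Type*} [Ring A] [Algebra R A] [Ring B] [Algebra R B] (f : A →ₐ[R] B)
    (M : Matrix (Fin n) (Fin m) R) : (scalarMat A M).map f = scalarMat B M := by
  ext i j; simp

lemma leftSide_map {B : Type*} [Ring B] [Algebra R B] (f : A →ₐ[R] B)
    (z : Matrix (Fin n) (Fin m) A) : (leftSide E F z).map f = leftSide E F (z.map f) := by
  simp only [leftSide, Matrix.map_mul, scalarMat_map, Matrix.transpose_map]

lemma rightSide_map {B : Type*} [Ring B] [Algebra R B] (f : A →ₐ[R] B)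
    (z : Matrix (Fin n) (Fin m) A) : (rightSide E F z).map f = rightSide E F (z.map f) := by
  simp only [rightSide, Matrix.map_mul, scalarMat_map, Matrix.transpose_map]

end relations

/-- The algebra `B(E,F)`, presented by the entries of an `n × m` matrix `z` and the relations
`F⁻¹ zᵗ E z = 1`, `z F⁻¹ zᵗ E = 1`. In particular `B(E) = B(E,E)`. -/
def BAlg {R : Type u} [CommRing R] {n m : ℕ} (E : GL (Fin n) R) (F : GL (Fin m) R) : Type u := RingQuot (DefRel E F)

namespace BAlg

variable {R : Type u} [CommRing R] {n m l : ℕ}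

instance (E : GL (Fin n) R) (F : GL (Fin m) R) : Ring (BAlg E F) :=
  inferInstanceAs (Ring (RingQuot (DefRel E F)))

instance (E : GL (Fin n) R) (F : GL (Fin m) R) : Algebra R (BAlg E F) :=
  inferInstanceAs (Algebra R (RingQuot (DefRel E F)))

variable (E : GL (Fin n) R) (F : GL (Fin m) R) (G : GL (Fin l) R)

/-- The quotient map from the free algebra. -/
def mk : FreeAlgebra R (Fin n × Fin m) →ₐ[R] BAlg E F := RingQuot.mkAlgHom R (DefRel E F)

/-- The matrix of generators -/
def gen : Matrix (Fin n) (Fin m) (BAlg E F) := Matrix.of fun i j => mk E F (FreeAlgebra.ι R (i, j))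

lemma gen_rel : Rel E F (gen E F) := by
  have hg : (freeGen R n m).map (mk E F) = gen E F := rfl
  constructor
  · rw [← hg, ← leftSide_map, ← Matrix.map_one (mk E F) (map_zero _) (map_one _)]
    ext i j
    exact RingQuot.mkAlgHom_rel R (DefRel.left i j)
  · rw [← hg, ← rightSide_map, ← Matrix.map_one (mk E F) (map_zero _) (map_one _)]
    ext i j
    exact RingQuot.mkAlgHom_rel R (DefRel.right i j)

variable {E F G}

section lift
variable {A : Type*} [Ring A] [Algebra R A]

lemma lift_aux (z : Matrix (Fin n) (Fin m) A) (hz : Rel E F z)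
    ⦃x y : FreeAlgebra R (Fin n × Fin m)⦄ (h : DefRel E F x y) :
    FreeAlgebra.lift R (fun p : Fin n × Fin m => z p.1 p.2) x =
      FreeAlgebra.lift R (fun p : Fin n × Fin m => z p.1 p.2) y := by
  set f := FreeAlgebra.lift R (fun p : Fin n × Fin m => z p.1 p.2) with hf
  have hg : (freeGen R n m).map f = z := by
    ext i j; simp [hf, freeGen]
  cases h with
  | left i j =>
    have h : (leftSide E F (freeGen R n m)).map f =
        (1 : Matrix (Fin m) (Fin m) (FreeAlgebra R (Fin n × Fin m))).map f := by
      rw [leftSide_map, hg, hz.left, Matrix.map_one f (map_zero f) (map_one f)]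
    exact congrFun (congrFun h i) j
  | right i j =>
    have h : (rightSide E F (freeGen R n m)).map f =
        (1 : Matrix (Fin n) (Fin n) (FreeAlgebra R (Fin n × Fin m))).map f := by
      rw [rightSide_map, hg, hz.right, Matrix.map_one f (map_zero f) (map_one f)]
    exact congrFun (congrFun h i) j

/-- The universal property of `B(E,F)`. -/
def lift (z : Matrix (Fin n) (Fin m) A) (hz : Rel E F z) : BAlg E F →ₐ[R] A :=
  RingQuot.liftAlgHom R ⟨FreeAlgebra.lift R (fun p : Fin n × Fin m => z p.1 p.2), lift_aux z hz⟩

@[simp]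
lemma lift_gen (z : Matrix (Fin n) (Fin m) A) (hz : Rel E F z) (i : Fin n) (j : Fin m) :
    lift z hz (gen E F i j) = z i j := by
  refine (RingQuot.liftAlgHom_mkAlgHom_apply R _ (lift_aux z hz) _).trans ?_
  simp

lemma algHom_ext {f g : BAlg E F →ₐ[R] A} (h : ∀ i j, f (gen E F i j) = g (gen E F i j)) :
    f = g := by
  apply RingQuot.ringQuot_ext' R
  apply FreeAlgebra.hom_ext
  funext p
  exact h p.1 p.2

end lift

section mul
variable {A : Type*} [Ring A] [Algebra R A]

lemma scalarMat_mul_inv (A : Type*) [Ring A] [Algebra R A] (F : GL (Fin m) R) :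
    scalarMat A F.val * scalarMat A (F⁻¹).val = 1 := by
  rw [← Matrix.map_mul, Units.mul_inv, Matrix.map_one _ (map_zero _) (map_one _)]

lemma scalarMat_inv_mul (A : Type*) [Ring A] [Algebra R A] (F : GL (Fin m) R) :
    scalarMat A (F⁻¹).val * scalarMat A F.val = 1 := by
  rw [← Matrix.map_mul, Units.inv_mul, Matrix.map_one _ (map_zero _) (map_one _)]

lemma rel_mul {x : Matrix (Fin n) (Fin m) A} {y : Matrix (Fin m) (Fin l) A} (hx : Rel E F x)
    (hy : Rel F G y) (hxy : ∀ i j p q, Commute (x i j) (y p q)) : Rel E G (x * y) := by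
  have ht : (x * y).transpose = y.transpose * x.transpose := by
    ext i j
    simp only [Matrix.transpose_apply, Matrix.mul_apply]
    exact Finset.sum_congr rfl fun p _ => hxy _ _ _ _
  have hx1 := hx.left
  have hx2 := hx.right
  have hy1 := hy.left
  have hy2 := hy.right
  simp only [leftSide, rightSide] at hx1 hx2 hy1 hy2
  have h1 : x.transpose * scalarMat A E.val * x = scalarMat A F.val := by
    have := congrArg (scalarMat A F.val * ·) hx1
    simpa only [← Matrix.mul_assoc, scalarMat_mul_inv, Matrix.one_mul, Matrix.mul_one] using this
  have h2 : y * scalarMat A (G⁻¹).val * y.transpose = scalarMat A (F⁻¹).val := by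
    have := congrArg (· * scalarMat A (F⁻¹).val) hy2
    simpa only [Matrix.mul_assoc, scalarMat_mul_inv, Matrix.one_mul, Matrix.mul_one] using this
  constructor
  · calc leftSide E G (x * y)
        = scalarMat A (G⁻¹).val * y.transpose * (x.transpose * scalarMat A E.val * x) * y := by
          rw [leftSide, ht]; simp only [Matrix.mul_assoc]
      _ = 1 := by rw [h1, hy1]
  · calc rightSide E G (x * y)
        = x * (y * scalarMat A (G⁻¹).val * y.transpose) * x.transpose * scalarMat A E.val := by
          rw [rightSide, ht]; simp only [Matrix.mul_assoc]
      _ = 1 := by rw [h2, hx2]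

lemma rel_map {B : Type*} [Ring B] [Algebra R B] (f : A →ₐ[R] B) {x : Matrix (Fin n) (Fin m) A}
    (hx : Rel E F x) : Rel E F (x.map f) :=
  ⟨by rw [← leftSide_map, hx.left, Matrix.map_one f (map_zero f) (map_one f)],
    by rw [← rightSide_map, hx.right, Matrix.map_one f (map_zero f) (map_one f)]⟩

/-- The matrix with entries `∑ₚ x_{ip} ⊗ y_{pj}`. -/
def tensorMul {B : Type*} [Ring B] [Algebra R B] (x : Matrix (Fin n) (Fin m) A)
    (y : Matrix (Fin m) (Fin l) B) : Matrix (Fin n) (Fin l) (A ⊗[R] B) :=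
  Matrix.of fun i j => ∑ p, x i p ⊗ₜ[R] y p j

lemma rel_tensorMul {B : Type*} [Ring B] [Algebra R B]
    {x : Matrix (Fin n) (Fin m) A} {y : Matrix (Fin m) (Fin l) B} (hx : Rel E F x)
    (hy : Rel F G y) : Rel E G (tensorMul (R := R) x y) := by
  have h := rel_mul (rel_map (Algebra.TensorProduct.includeLeft : A →ₐ[R] A ⊗[R] B) hx)
    (rel_map (Algebra.TensorProduct.includeRight : B →ₐ[R] A ⊗[R] B) hy)
    (fun i j p q => (Commute.one_right _).tmul (Commute.one_left _))
  have e : tensorMul (R := R) x y =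
      x.map (Algebra.TensorProduct.includeLeft : A →ₐ[R] A ⊗[R] B) *
        y.map (Algebra.TensorProduct.includeRight : B →ₐ[R] A ⊗[R] B) := by
    refine Matrix.ext fun i j => ?_
    simp [Matrix.mul_apply, tensorMul]
  rw [e]
  exact h

lemma rel_one : Rel E E (1 : Matrix (Fin n) (Fin n) R) := by
  have h1 := scalarMat_inv_mul R E
  constructor <;> simp [leftSide, rightSide]

lemma transpose_scalarMat_mul (M : Matrix (Fin n) (Fin m) R) (N : Matrix (Fin m) (Fin l) A) :
    (scalarMat A M * N).transpose = N.transpose * scalarMat A M.transpose := by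
  ext i j
  simp only [Matrix.transpose_apply, Matrix.mul_apply, Matrix.map_apply]
  exact Finset.sum_congr rfl fun p _ => Algebra.commutes _ _

lemma transpose_mul_scalarMat (M : Matrix (Fin n) (Fin m) A) (N : Matrix (Fin m) (Fin l) R) :
    (M * scalarMat A N).transpose = scalarMat A N.transpose * M.transpose := by
  ext i j
  simp only [Matrix.transpose_apply, Matrix.mul_apply, Matrix.map_apply]
  exact Finset.sum_congr rfl fun p _ => (Algebra.commutes _ _).symm

lemma map_op_mul (M : Matrix (Fin n) (Fin m) A) (N : Matrix (Fin m) (Fin l) A) :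
    M.map MulOpposite.op * N.map MulOpposite.op =
      ((N.transpose * M.transpose).transpose).map MulOpposite.op := by
  ext i j
  simp [Matrix.mul_apply]

lemma scalarMat_op (M : Matrix (Fin n) (Fin m) R) :
    scalarMat Aᵐᵒᵖ M = (scalarMat A M).map MulOpposite.op := rfl

/-- The matrix `S(a) = E⁻¹ aᵗ E`. -/
def antipodeMat (E : GL (Fin n) R) (a : Matrix (Fin n) (Fin n) A) : Matrix (Fin n) (Fin n) A :=
  scalarMat A (E⁻¹).val * a.transpose * scalarMat A E.val

lemma rel_antipodeMat {a : Matrix (Fin n) (Fin n) A} (h : Rel E E a) :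
    Rel E E ((antipodeMat E a).map MulOpposite.op) := by
  have h1 := h.left
  have h2 := h.right
  simp only [leftSide, rightSide] at h1 h2
  have e1 : scalarMat A (E.val.transpose) * scalarMat A ((E⁻¹).val.transpose) = 1 := by
    rw [← Matrix.map_mul, ← Matrix.transpose_mul, Units.inv_mul, Matrix.transpose_one,
      Matrix.map_one _ (map_zero _) (map_one _)]
  have e2 : scalarMat A ((E⁻¹).val.transpose) * scalarMat A (E.val.transpose) = 1 := by
    rw [← Matrix.map_mul, ← Matrix.transpose_mul, Units.mul_inv, Matrix.transpose_one,
      Matrix.map_one _ (map_zero _) (map_one _)]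
  have ht : (antipodeMat E a).transpose =
      scalarMat A E.val.transpose * a * scalarMat A (E⁻¹).val.transpose := by
    rw [antipodeMat, transpose_mul_scalarMat, transpose_scalarMat_mul, Matrix.transpose_transpose,
      Matrix.mul_assoc]
  constructor
  · rw [leftSide, scalarMat_op, scalarMat_op, ← Matrix.transpose_map, map_op_mul, map_op_mul,
      map_op_mul]
    simp only [Matrix.transpose_transpose]
    have : (antipodeMat E a).transpose * ((scalarMat A E.val).transpose * (antipodeMat E a *
        (scalarMat A (E⁻¹).val).transpose)) = 1 := by
      calc _ = scalarMat A E.val.transpose * a * (scalarMat A (E⁻¹).val.transpose *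
            scalarMat A E.val.transpose) * antipodeMat E a * scalarMat A (E⁻¹).val.transpose := by
            rw [ht]; simp only [Matrix.mul_assoc, scalarMat, Matrix.transpose_map]
        _ = scalarMat A E.val.transpose * (a * scalarMat A (E⁻¹).val * a.transpose *
            scalarMat A E.val) * scalarMat A (E⁻¹).val.transpose := by
            rw [e2, antipodeMat]; simp only [Matrix.mul_assoc, Matrix.one_mul]
        _ = 1 := by rw [h2, Matrix.mul_one, e1]
    rw [this, Matrix.transpose_one, Matrix.map_one _ MulOpposite.op_zero MulOpposite.op_one]
  · rw [rightSide, scalarMat_op, scalarMat_op, ← Matrix.transpose_map, map_op_mul, map_op_mul,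
      map_op_mul]
    simp only [Matrix.transpose_transpose]
    have : (scalarMat A E.val).transpose * (antipodeMat E a * ((scalarMat A (E⁻¹).val).transpose *
        (antipodeMat E a).transpose)) = 1 := by
      calc _ = scalarMat A E.val.transpose * antipodeMat E a * (scalarMat A (E⁻¹).val.transpose *
            scalarMat A E.val.transpose) * a * scalarMat A (E⁻¹).val.transpose := by
            rw [ht]; simp only [Matrix.mul_assoc, scalarMat, Matrix.transpose_map]
        _ = scalarMat A E.val.transpose * (scalarMat A (E⁻¹).val * a.transpose *
            scalarMat A E.val * a) * scalarMat A (E⁻¹).val.transpose := by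
            rw [e2, antipodeMat]; simp only [Matrix.mul_assoc, Matrix.one_mul]
        _ = 1 := by rw [h1, Matrix.mul_one, e1]
    rw [this, Matrix.transpose_one, Matrix.map_one _ MulOpposite.op_zero MulOpposite.op_one]

end mul

/-- `B(E,G) → B(E,F) ⊗ B(F,G)`, `z_{ij} ↦ ∑ₚ z_{ip} ⊗ z_{pj}`. -/
def cocomp (E : GL (Fin n) R) (F : GL (Fin m) R) (G : GL (Fin l) R) :
    BAlg E G →ₐ[R] BAlg E F ⊗[R] BAlg F G :=
  lift (tensorMul (gen E F) (gen F G)) (rel_tensorMul (gen_rel E F) (gen_rel F G))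

/-- `a_{ij} ↦ δ_{ij}`. -/
def counitHom (E : GL (Fin n) R) : BAlg E E →ₐ[R] R := lift 1 rel_one

lemma cocomp_gen (i : Fin n) (j : Fin l) :
    cocomp E F G (gen E G i j) = ∑ p, gen E F i p ⊗ₜ[R] gen F G p j := by
  rw [cocomp, lift_gen]; rfl

lemma cocomp_coassoc {p : ℕ} (D : GL (Fin p) R) :
    ((Algebra.TensorProduct.assoc R R R _ _ _).toAlgHom.comp
      (Algebra.TensorProduct.map (cocomp E F G) (AlgHom.id R (BAlg G D)))).comp (cocomp E G D) =
    (Algebra.TensorProduct.map (AlgHom.id R _) (cocomp F G D)).comp (cocomp E F D) := by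
  apply algHom_ext
  intro i j
  simp only [AlgHom.comp_apply, cocomp_gen, map_sum, Algebra.TensorProduct.map_tmul,
    TensorProduct.sum_tmul, TensorProduct.tmul_sum, AlgHom.id_apply]
  rw [Finset.sum_comm]
  rfl

/-- `B(E)` is a bialgebra with `Δ(a_{ij}) = ∑ₚ a_{ip} ⊗ a_{pj}` and `ε(a_{ij}) = δ_{ij}`. -/
instance (E : GL (Fin n) R) : Bialgebra R (BAlg E E) :=
  Bialgebra.ofAlgHom (cocomp E E E) (counitHom E) (cocomp_coassoc E)
    (by
      apply algHom_ext
      intro i j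
      simp [AlgHom.comp_apply, cocomp_gen, counitHom, Matrix.one_apply, TensorProduct.ite_tmul])
    (by
      apply algHom_ext
      intro i j
      simp [AlgHom.comp_apply, cocomp_gen, counitHom, Matrix.one_apply, TensorProduct.tmul_ite])

lemma comul_gen (i j : Fin n) : Coalgebra.comul (R := R) (gen E E i j) =
    ∑ p, gen E E i p ⊗ₜ[R] gen E E p j := cocomp_gen i j

lemma counit_gen (i j : Fin n) : Coalgebra.counit (R := R) (gen E E i j) =
    (1 : Matrix (Fin n) (Fin n) R) i j := lift_gen _ _ _ _

lemma induction_gen {P : BAlg E F → Prop} (halg : ∀ r, P (algebraMap R _ r))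
    (hgen : ∀ i j, P (gen E F i j)) (hadd : ∀ x y, P x → P y → P (x + y))
    (hmul : ∀ x y, P x → P y → P (x * y)) (x : BAlg E F) : P x := by
  obtain ⟨y, rfl⟩ := RingQuot.mkAlgHom_surjective R (DefRel E F) x
  change P (mk E F y)
  induction y with
  | grade0 r => rw [AlgHom.commutes]; exact halg r
  | grade1 p => exact hgen p.1 p.2
  | mul a b ha hb => rw [map_mul]; exact hmul _ _ ha hb
  | add a b ha hb => rw [map_add]; exact hadd _ _ ha hb

/-- The antipode `a ↦ E⁻¹ aᵗ E` as a morphism to the opposite algebra. -/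
def antipodeHom (E : GL (Fin n) R) : BAlg E E →ₐ[R] (BAlg E E)ᵐᵒᵖ :=
  lift ((antipodeMat E (gen E E)).map MulOpposite.op) (rel_antipodeMat (gen_rel E E))

/-- The antipode as a linear map. -/
def antipodeLin (E : GL (Fin n) R) : BAlg E E →ₗ[R] BAlg E E :=
  (MulOpposite.opLinearEquiv R).symm.toLinearMap ∘ₗ (antipodeHom E).toLinearMap

lemma antipodeLin_gen (i j : Fin n) :
    antipodeLin E (gen E E i j) = antipodeMat E (gen E E) i j := by
  simp [antipodeLin, antipodeHom]

lemma antipodeLin_mul (x y : BAlg E E) :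
    antipodeLin E (x * y) = antipodeLin E y * antipodeLin E x := by
  simp [antipodeLin]

lemma antipodeLin_algebraMap (r : R) :
    antipodeLin E (algebraMap R _ r) = algebraMap R _ r := by
  simp [antipodeLin]

lemma antipodeLin_one : antipodeLin E 1 = 1 := by
  simpa using antipodeLin_algebraMap (E := E) 1

lemma antipode_left (x : BAlg E E) :
    LinearMap.mul' R _ ((antipodeLin E).rTensor _ (Coalgebra.comul (R := R) x)) =
      algebraMap R _ (Coalgebra.counit (R := R) x) := by
  have key : ∀ (c : BAlg E E ⊗[R] BAlg E E) (y₁ y₂ : BAlg E E),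
      LinearMap.mul' R _ ((antipodeLin E).rTensor _ (c * y₁ ⊗ₜ[R] y₂)) =
        antipodeLin E y₁ * LinearMap.mul' R _ ((antipodeLin E).rTensor _ c) * y₂ := by
    intro c y₁ y₂
    induction c with
    | zero => simp
    | add a b ha hb => simp only [add_mul, mul_add, map_add, ha, hb]
    | tmul a b => simp [antipodeLin_mul, mul_assoc]
  have key2 : ∀ (r : R) (c d : BAlg E E ⊗[R] BAlg E E),
      LinearMap.mul' R _ ((antipodeLin E).rTensor _ c) = algebraMap R _ r →
      LinearMap.mul' R _ ((antipodeLin E).rTensor _ (c * d)) =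
        algebraMap R _ r * LinearMap.mul' R _ ((antipodeLin E).rTensor _ d) := by
    intro r c d h
    induction d with
    | zero => simp
    | add a b ha hb => simp only [mul_add, map_add, ha, hb]
    | tmul a b =>
      rw [key, h, ← Algebra.commutes]
      simp [mul_assoc]
  refine induction_gen (P := fun x => LinearMap.mul' R _ ((antipodeLin E).rTensor _
    (Coalgebra.comul (R := R) x)) = algebraMap R _ (Coalgebra.counit (R := R) x))
    (fun r => ?_) (fun i j => ?_) (fun x y hx hy => ?_) (fun x y hx hy => ?_) x
  · simp [Algebra.TensorProduct.algebraMap_apply, antipodeLin_algebraMap]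
  · have h := congrFun (congrFun (gen_rel E E).left i) j
    rw [comul_gen, counit_gen]
    simp only [map_sum, LinearMap.rTensor_tmul, LinearMap.mul'_apply, antipodeLin_gen]
    rw [show ∑ p, antipodeMat E (gen E E) i p * gen E E p j =
      leftSide E E (gen E E) i j from (Matrix.mul_apply).symm, h]
    simp [Matrix.one_apply, apply_ite (algebraMap R (BAlg E E))]
  · simp only [map_add, hx, hy]
  · rw [Bialgebra.comul_mul, Bialgebra.counit_mul, key2 _ _ _ hx, hy, map_mul]

lemma antipode_right (x : BAlg E E) :
    LinearMap.mul' R _ ((antipodeLin E).lTensor _ (Coalgebra.comul (R := R) x)) =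
      algebraMap R _ (Coalgebra.counit (R := R) x) := by
  have key : ∀ (c : BAlg E E ⊗[R] BAlg E E) (y₁ y₂ : BAlg E E),
      LinearMap.mul' R _ ((antipodeLin E).lTensor _ (y₁ ⊗ₜ[R] y₂ * c)) =
        y₁ * LinearMap.mul' R _ ((antipodeLin E).lTensor _ c) * antipodeLin E y₂ := by
    intro c y₁ y₂
    induction c with
    | zero => simp
    | add a b ha hb => simp only [add_mul, mul_add, map_add, ha, hb]
    | tmul a b => simp [antipodeLin_mul, mul_assoc]
  have key2 : ∀ (r : R) (c d : BAlg E E ⊗[R] BAlg E E),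
      LinearMap.mul' R _ ((antipodeLin E).lTensor _ c) = algebraMap R _ r →
      LinearMap.mul' R _ ((antipodeLin E).lTensor _ (d * c)) =
        algebraMap R _ r * LinearMap.mul' R _ ((antipodeLin E).lTensor _ d) := by
    intro r c d h
    induction d with
    | zero => simp
    | add a b ha hb => simp only [add_mul, mul_add, map_add, ha, hb]
    | tmul a b =>
      rw [key, h, ← Algebra.commutes]
      simp [mul_assoc]
  refine induction_gen (P := fun x => LinearMap.mul' R _ ((antipodeLin E).lTensor _
    (Coalgebra.comul (R := R) x)) = algebraMap R _ (Coalgebra.counit (R := R) x))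
    (fun r => ?_) (fun i j => ?_) (fun x y hx hy => ?_) (fun x y hx hy => ?_) x
  · simp [Algebra.TensorProduct.algebraMap_apply, antipodeLin_one]
  · have h := congrFun (congrFun (gen_rel E E).right i) j
    rw [comul_gen, counit_gen]
    simp only [map_sum, LinearMap.lTensor_tmul, LinearMap.mul'_apply, antipodeLin_gen]
    rw [show ∑ p, gen E E i p * antipodeMat E (gen E E) p j =
      (gen E E * antipodeMat E (gen E E)) i j from (Matrix.mul_apply).symm,
      show gen E E * antipodeMat E (gen E E) = rightSide E E (gen E E) by
        simp only [antipodeMat, rightSide, Matrix.mul_assoc], h]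
    simp [Matrix.one_apply, apply_ite (algebraMap R (BAlg E E))]
  · simp only [map_add, hx, hy]
  · rw [Bialgebra.comul_mul, Bialgebra.counit_mul, key2 _ _ _ hy, hx, map_mul, Algebra.commutes]

/-- `B(E)` is a Hopf algebra with `S(a) = E⁻¹ aᵗ E`. -/
instance (E : GL (Fin n) R) : HopfAlgebra R (BAlg E E) where
  antipode := antipodeLin E
  mul_antipode_rTensor_comul := LinearMap.ext antipode_left
  mul_antipode_lTensor_comul := LinearMap.ext antipode_right

section coaction
variable {H : Type v} [Ring H] [HopfAlgebra R H]

/-- For a multiplicative matrix `a` over a Hopf algebra `H` satisfying the relations of `B(E)`, the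
left `H`-comodule algebra structure `z_{ij} ↦ ∑ₚ a_{ip} ⊗ z_{pj}` on `B(E,F)`. -/
def coactionOf (F : GL (Fin m) R) (a : Matrix (Fin n) (Fin n) H) (ha : Rel E E a)
    (hΔ : ∀ i j, Coalgebra.comul (R := R) (a i j) = ∑ p, a i p ⊗ₜ[R] a p j)
    (hε : ∀ i j, Coalgebra.counit (R := R) (a i j) = (1 : Matrix (Fin n) (Fin n) R) i j) :
    LeftComoduleAlgebra R H (BAlg E F) where
  coact := lift (tensorMul a (gen E F)) (rel_tensorMul ha (gen_rel E F))
  coassoc := by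
    apply algHom_ext
    intro i j
    simp only [AlgHom.comp_apply, lift_gen, tensorMul, Matrix.of_apply, map_sum,
      Algebra.TensorProduct.map_tmul, Bialgebra.comulAlgHom_apply, hΔ, TensorProduct.sum_tmul,
      TensorProduct.tmul_sum, AlgHom.id_apply]
    rw [Finset.sum_comm]
    rfl
  counit_coact := by
    apply algHom_ext
    intro i j
    simp [tensorMul, hε, Matrix.one_apply]

/-- The coaction `z_{ij} ↦ ∑ₚ a_{ip} ⊗ z_{pj}` of `B(E)` on `B(E,F)`. -/
def coaction (E : GL (Fin n) R) (F : GL (Fin m) R) : LeftComoduleAlgebra R (BAlg E E) (BAlg E F) :=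
  coactionOf F (gen E E) (gen_rel E E) comul_gen counit_gen

end coaction

section poly
variable {k : Type u} [Field k]

/-- A matrix over `k`, as a matrix over `k[t]`. -/
abbrev constGL (E : GL (Fin n) k) : GL (Fin n) k[X] :=
  Matrix.GeneralLinearGroup.map (Polynomial.C : k →+* k[X]) E

/-- The specialization `F(i)` of a matrix `F(t)`. -/
abbrev evalGL (i : k) (F : GL (Fin m) k[X]) : GL (Fin m) k :=
  Matrix.GeneralLinearGroup.map (Polynomial.evalRingHom i) F

lemma rel_constGL (E : GL (Fin n) k) :
    Rel (constGL E) (constGL E)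
      ((gen E E).map (fun a => (1 : k[X]) ⊗ₜ[k] a) :
        Matrix (Fin n) (Fin n) (k[X] ⊗[k] BAlg E E)) := by
  have h := rel_map (Algebra.TensorProduct.includeRight : BAlg E E →ₐ[k] k[X] ⊗[k] BAlg E E)
    (gen_rel E E)
  have hs : ∀ M : Matrix (Fin n) (Fin n) k,
      scalarMat (k[X] ⊗[k] BAlg E E) (M.map (Polynomial.C : k →+* k[X])) =
        scalarMat (k[X] ⊗[k] BAlg E E) M := by
    intro M
    refine Matrix.ext fun i j => ?_
    simp [Algebra.TensorProduct.algebraMap_apply]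
  have h1 := h.left
  have h2 := h.right
  simp only [leftSide, rightSide] at h1 h2
  rw [← hs, ← hs] at h1 h2
  exact ⟨h1, h2⟩

/-- For `F(t)` invertible over `k[t]`, the coaction `z_{ij} ↦ ∑ₚ a_{ip} ⊗ z_{pj}` of
`B(E)[t] = k[t] ⊗ B(E)` on the `k[t]`-algebra `B(E, F(t))`. -/
def polyCoaction (E : GL (Fin n) k) (F : GL (Fin m) k[X]) :
    LeftComoduleAlgebra k[X] (k[X] ⊗[k] BAlg E E) (BAlg (constGL E) F) :=
  coactionOf F ((gen E E).map fun a => (1 : k[X]) ⊗ₜ[k] a) (rel_constGL E)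
    (by
      intro i j
      simp [comul_gen, TensorProduct.tmul_sum])
    (by
      intro i j
      simp [counit_gen, Matrix.one_apply, ite_smul])

end poly

end BAlg

/-- The matrix `E_q`, with rows `(0, 1)` and `(-q⁻¹, 0)`. The Hopf algebra `O_q(SL(2))` is
`B(E_q) = BAlg (qMatrix q) (qMatrix q)`. -/
def qMatrix {R : Type u} [CommRing R] (q : Rˣ) : GL (Fin 2) R where
  val := !![0, 1; -(q⁻¹ : Rˣ), 0]
  inv := !![0, -(q : R); 1, 0]
  val_inv := by simp [Matrix.one_fin_two]
  inv_val := by simp [Matrix.one_fin_two]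

/-- The asymmetry `F⁻¹ Fᵗ` of an invertible matrix. -/
def asymmetry {R : Type u} [CommRing R] {m : ℕ} (F : GL (Fin m) R) : Matrix (Fin m) (Fin m) R :=
  (F⁻¹).val * F.val.transpose

/-- `F` is manageable if the last row of `F⁻¹` has last entry `0` and its rightmost nonzero entry is
invertible. -/
def IsManageable {R : Type u} [CommRing R] {m : ℕ} (F : GL (Fin m) R) : Prop :=
  ∃ r v : Fin m, (r : ℕ) + 1 = m ∧ (F⁻¹).val r r = 0 ∧ IsUnit ((F⁻¹).val r v) ∧
    ∀ j, v < j → (F⁻¹).val r j = 0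

end BilinearQuantum

end

/-! Bijectivity of the canonical map is formal. The matrix `z` has the inverse F⁻¹zᵗE, and this
gives an explicit inverse of the canonical map for all E and F over any commutative ring
(`coaction_can_bijective`). To get a Galois object it is then enough that B(E_q,F) is free over the
base and has a linear functional φ with φ(1) = 1 (`isGaloisObject_of_free`).

For manageable F, freeness comes from an explicit basis. Let x_j and y_j be the two rows of `z`, and
put M = F⁻¹. The relations say that y_i x_j = q(x_i y_j − F_ij) and that each sum of M_ab z_sa z_tb
is a constant. Since the pivot entry M_rv is invertible, the second family can be solved for z_sr
z_tv. The irreducible words are the words in the x's followed by words in the y's in which index r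
is never followed by v. Instead of resolving the ambiguities of a rewriting system, the proof
defines operators of left multiplication on the free module over these words and checks that they
satisfy the relations. The trace condition closes the overlap y_i x_r x_v. Acting on the empty word
then identifies B(E_q,F) with that free module (`wordEquiv`). The argument works over k and over
k[t] alike.

Replacing F by PFPᵗ does not change the comodule algebra, so it suffices to join matrices congruent
to F₀ and F₁. The determinant of XF − Fᵗ is det F times the characteristic polynomial of F⁻¹Fᵗ.
Splitting off isotropic eigenvectors of the asymmetry one at a time shows that, over an
algebraically closed field, equal characteristic polynomials allow F₀ and F₁ to be made
antitriangular with the same antidiagonal (`exists_isAntiTriangular_congr`). On the straight line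
between two such matrices the antidiagonal is constant. Hence so are the determinant and the
characteristic polynomial of the asymmetry, in particular its trace. An antitriangular invertible
matrix of size at least 2 is manageable, so the line F(t) gives a Galois object over k[t], and its
fibres are computed by base change. -/

noncomputable section

/-! ### The canonical map of B(E,F) and its inverse. -/

namespace BilinearQuantum

namespace BAlg

section galois

variable {R : Type u} [CommRing R] {n m : ℕ} {E : GL (Fin n) R} {F : GL (Fin m) R}

section inverseMat
variable {A : Type v} [Ring A] [Algebra R A]

/-- The inverse `F⁻¹ zᵗ E` of a matrix `z` satisfying the relations of `B(E,F)`. -/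
def inverseMat (E : GL (Fin n) R) (F : GL (Fin m) R) (z : Matrix (Fin n) (Fin m) A) :
    Matrix (Fin m) (Fin n) A :=
  scalarMat A (F⁻¹).val * z.transpose * scalarMat A E.val

lemma inverseMat_mul {z : Matrix (Fin n) (Fin m) A} (h : Rel E F z) :
    inverseMat E F z * z = 1 := h.left

lemma mul_inverseMat {z : Matrix (Fin n) (Fin m) A} (h : Rel E F z) :
    z * inverseMat E F z = 1 := by
  rw [← h.right, rightSide, inverseMat]
  simp only [Matrix.mul_assoc]

/-- Transposition reverses products of matrices once the entries are moved to the opposite algebra.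
After this, the two relations are `z * inverseMat E F z = 1` and `inverseMat E F z * z = 1`,
conjugated by scalar matrices. -/
lemma rel_inverseMat_op {z : Matrix (Fin n) (Fin m) A} (h : Rel E F z) :
    Rel F E ((inverseMat E F z).map MulOpposite.op) := by
  have hl := inverseMat_mul h
  have hr := mul_inverseMat h
  have e1 : scalarMat A (F.val.transpose) * scalarMat A ((F⁻¹).val.transpose) = 1 := by
    rw [← Matrix.map_mul, ← Matrix.transpose_mul, Units.inv_mul, Matrix.transpose_one,
      Matrix.map_one _ (map_zero _) (map_one _)]
  have e2 : scalarMat A ((E⁻¹).val.transpose) * scalarMat A (E.val.transpose) = 1 := by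
    rw [← Matrix.map_mul, ← Matrix.transpose_mul, Units.mul_inv, Matrix.transpose_one,
      Matrix.map_one _ (map_zero _) (map_one _)]
  have e3 : scalarMat A (E.val.transpose) * scalarMat A ((E⁻¹).val.transpose) = 1 := by
    rw [← Matrix.map_mul, ← Matrix.transpose_mul, Units.inv_mul, Matrix.transpose_one,
      Matrix.map_one _ (map_zero _) (map_one _)]
  have ht : (inverseMat E F z).transpose =
      scalarMat A E.val.transpose * z * scalarMat A (F⁻¹).val.transpose := by
    rw [inverseMat, transpose_mul_scalarMat, transpose_scalarMat_mul, Matrix.transpose_transpose,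
      Matrix.mul_assoc]
  constructor
  · rw [leftSide, scalarMat_op, scalarMat_op, ← Matrix.transpose_map, map_op_mul, map_op_mul,
      map_op_mul]
    simp only [Matrix.transpose_transpose]
    have : (inverseMat E F z).transpose * ((scalarMat A F.val).transpose * (inverseMat E F z *
        (scalarMat A (E⁻¹).val).transpose)) = 1 := by
      have e1' : scalarMat A ((F⁻¹).val.transpose) * scalarMat A (F.val.transpose) = 1 := by
        rw [← Matrix.map_mul, ← Matrix.transpose_mul, Units.mul_inv, Matrix.transpose_one,
          Matrix.map_one _ (map_zero _) (map_one _)]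
      calc _ = scalarMat A E.val.transpose * z * (scalarMat A (F⁻¹).val.transpose *
            scalarMat A F.val.transpose) * inverseMat E F z * scalarMat A (E⁻¹).val.transpose := by
            rw [ht]; simp only [Matrix.mul_assoc, scalarMat, Matrix.transpose_map]
        _ = scalarMat A E.val.transpose * (z * inverseMat E F z) *
              scalarMat A (E⁻¹).val.transpose := by
            rw [e1']; simp only [Matrix.mul_assoc, Matrix.one_mul]
        _ = 1 := by rw [hr, Matrix.mul_one, e3]
    rw [this, Matrix.transpose_one, Matrix.map_one _ MulOpposite.op_zero MulOpposite.op_one]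
  · rw [rightSide, scalarMat_op, scalarMat_op, ← Matrix.transpose_map, map_op_mul, map_op_mul,
      map_op_mul]
    simp only [Matrix.transpose_transpose]
    have : (scalarMat A F.val).transpose * (inverseMat E F z * ((scalarMat A (E⁻¹).val).transpose *
        (inverseMat E F z).transpose)) = 1 := by
      calc _ = scalarMat A F.val.transpose * inverseMat E F z * (scalarMat A (E⁻¹).val.transpose *
            scalarMat A E.val.transpose) * z * scalarMat A (F⁻¹).val.transpose := by
            rw [ht]; simp only [Matrix.mul_assoc, scalarMat, Matrix.transpose_map]
        _ = scalarMat A F.val.transpose * (inverseMat E F z * z) *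
              scalarMat A (F⁻¹).val.transpose := by
            rw [e2]; simp only [Matrix.mul_assoc, Matrix.one_mul]
        _ = 1 := by rw [hl, Matrix.mul_one, e1]
    rw [this, Matrix.transpose_one, Matrix.map_one _ MulOpposite.op_zero MulOpposite.op_one]

end inverseMat

/-- The map `B(E) → B(E,F) ⊗ B(E,F)ᵒᵖ`, `a_{ij} ↦ ∑ₚ z_{ip} ⊗ (F⁻¹ zᵗ E)_{pj}`. -/
def translation (E : GL (Fin n) R) (F : GL (Fin m) R) :
    BAlg E E →ₐ[R] BAlg E F ⊗[R] (BAlg E F)ᵐᵒᵖ :=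
  lift (tensorMul (gen E F) ((inverseMat E F (gen E F)).map MulOpposite.op))
    (rel_tensorMul (gen_rel E F) (rel_inverseMat_op (gen_rel E F)))

lemma translation_gen (i j : Fin n) : translation E F (gen E E i j) =
    ∑ p, gen E F i p ⊗ₜ[R] MulOpposite.op (inverseMat E F (gen E F) p j) := by
  rw [translation, lift_gen]; rfl

/-- The map `(a ⊗ bᵒᵖ) ⊗ z ↦ a ⊗ b z`. -/
def opAct (A : Type v) [Ring A] [Algebra R A] :
    A ⊗[R] Aᵐᵒᵖ →ₗ[R] A →ₗ[R] A ⊗[R] A :=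
  TensorProduct.lift <| LinearMap.mk₂ R
    (fun a b => (TensorProduct.mk R A A a).comp (LinearMap.mulLeft R b.unop))
    (fun a a' b => by ext z; simp)
    (fun r a b => by ext z; simp [TensorProduct.smul_tmul'])
    (fun a b b' => by ext z; simp [add_mul, TensorProduct.tmul_add])
    (fun r a b => by ext z; simp)

@[simp]
lemma opAct_tmul {A : Type v} [Ring A] [Algebra R A] (a : A) (b : Aᵐᵒᵖ) (z : A) :
    opAct A (a ⊗ₜ[R] b) z = a ⊗ₜ[R] (b.unop * z) := rfl

/-- The inverse `h ⊗ z ↦ h₁ ⊗ S(h₂) z` of the canonical map of `B(E,F)`. -/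
def canInv (E : GL (Fin n) R) (F : GL (Fin m) R) :
    BAlg E E ⊗[R] BAlg E F →ₗ[R] BAlg E F ⊗[R] BAlg E F :=
  TensorProduct.lift ((opAct (BAlg E F)).comp (translation E F).toLinearMap)

lemma canInv_tmul (h : BAlg E E) (z : BAlg E F) :
    canInv E F (h ⊗ₜ z) = opAct (BAlg E F) (translation E F h) z := rfl

lemma can_tmul (δ : LeftComoduleAlgebra R (BAlg E E) (BAlg E F)) (x y : BAlg E F) :
    δ.can (x ⊗ₜ y) = δ.coact x * (1 ⊗ₜ y) := rfl

lemma coaction_coact_gen (i : Fin n) (j : Fin m) : (coaction E F).coact (gen E F i j) =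
    ∑ p, gen E E i p ⊗ₜ[R] gen E F p j := by
  simp [coaction, coactionOf, tensorMul]

lemma can_opAct_one (t : BAlg E F ⊗[R] (BAlg E F)ᵐᵒᵖ) (z : BAlg E F) :
    (coaction E F).can (opAct _ t z) = (coaction E F).can (opAct _ t 1) * (1 ⊗ₜ z) := by
  induction t with
  | zero => simp
  | add a b ha hb => simp only [map_add, LinearMap.add_apply, ha, hb, add_mul]
  | tmul a b => simp [can_tmul, mul_assoc]

/-- Since (a ⊗ b)(c ⊗ d) stands for ac ⊗ db, the canonical map sends it to δ(a) · can(c ⊗ d) · (1 ⊗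
b). If the middle factor is h ⊗ 1, it commutes with 1 ⊗ b. This is the multiplicative step of
`can_translation`. -/
lemma can_opAct_mul (s t : BAlg E F ⊗[R] (BAlg E F)ᵐᵒᵖ) (h : BAlg E E)
    (ht : (coaction E F).can (opAct _ t 1) = h ⊗ₜ 1) :
    (coaction E F).can (opAct _ (s * t) 1) =
      (coaction E F).can (opAct _ s 1) * (h ⊗ₜ 1) := by
  induction s with
  | zero => simp
  | add a b ha hb => simp only [add_mul, map_add, LinearMap.add_apply, ha, hb]
  | tmul a b =>
    have key : ∀ t : BAlg E F ⊗[R] (BAlg E F)ᵐᵒᵖ,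
        (coaction E F).can (opAct _ ((a ⊗ₜ[R] b) * t) 1) =
          (coaction E F).coact a * (coaction E F).can (opAct _ t 1) * (1 ⊗ₜ b.unop) := by
      intro t
      induction t with
      | zero => simp
      | add c d hc hd => simp only [mul_add, add_mul, map_add, LinearMap.add_apply, hc, hd]
      | tmul c d => simp [can_tmul, mul_assoc]
    rw [key, ht]
    simp [can_tmul, mul_assoc]

lemma can_translation (h : BAlg E E) :
    (coaction E F).can (opAct _ (translation E F h) 1) = h ⊗ₜ 1 := by
  refine induction_gen (P := fun h => (coaction E F).can (opAct _ (translation E F h) 1) = h ⊗ₜ 1)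
    (fun r => ?_) (fun i j => ?_) (fun x y hx hy => ?_) (fun x y hx hy => ?_) h
  · rw [AlgHom.commutes, Algebra.TensorProduct.algebraMap_apply]
    simp [can_tmul, Algebra.TensorProduct.algebraMap_apply]
  · have hr := mul_inverseMat (gen_rel E F)
    rw [translation_gen]
    simp only [map_sum, LinearMap.sum_apply, opAct_tmul, mul_one, can_tmul, coaction_coact_gen,
      MulOpposite.unop_op, Finset.sum_mul, Algebra.TensorProduct.tmul_mul_tmul]
    rw [Finset.sum_comm]
    simp only [← TensorProduct.tmul_sum, ← Matrix.mul_apply, hr]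
    simp [Matrix.one_apply, TensorProduct.tmul_ite]
  · simp only [map_add, LinearMap.add_apply, hx, hy, TensorProduct.add_tmul]
  · rw [map_mul, can_opAct_mul _ _ _ hy, hx]
    simp

lemma can_canInv (x : BAlg E E ⊗[R] BAlg E F) : (coaction E F).can (canInv E F x) = x := by
  induction x with
  | zero => simp
  | add a b ha hb => simp only [map_add, ha, hb]
  | tmul h z => rw [canInv_tmul, can_opAct_one, can_translation]; simp

lemma opAct_apply_mul {A : Type v} [Ring A] [Algebra R A] (t : A ⊗[R] Aᵐᵒᵖ) (x y : A) :
    opAct A t (x * y) = opAct A t x * (1 ⊗ₜ y) := by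
  induction t with
  | zero => simp
  | add a b ha hb => simp only [map_add, LinearMap.add_apply, ha, hb, add_mul]
  | tmul a b => simp [mul_assoc]

lemma canInv_mul_right (x : BAlg E E ⊗[R] BAlg E F) (z : BAlg E F) :
    canInv E F (x * (1 ⊗ₜ z)) = canInv E F x * (1 ⊗ₜ z) := by
  induction x with
  | zero => simp
  | add a b ha hb => simp only [map_add, add_mul, ha, hb]
  | tmul h y => simp [canInv_tmul, opAct_apply_mul]

/-- Multiplying `x` on the right by h ⊗ y affects `canInv E F x` through the map a ⊗ b ↦ (a ⊗ 1) ·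
(translation of h applied to b) · (1 ⊗ y). At z ⊗ 1 this is left multiplication by z ⊗ 1. It reduces
`canInv_coact` to generators. -/
lemma canInv_mul (x y : BAlg E E ⊗[R] BAlg E F) (z : BAlg E F) (hx : canInv E F x = z ⊗ₜ 1) :
    canInv E F (x * y) = (z ⊗ₜ 1) * canInv E F y := by
  induction y with
  | zero => simp
  | add a b ha hb => simp only [map_add, mul_add, ha, hb]
  | tmul h y =>
    -- The action of `s * t` on `w` depends on `s` and `w` only through `opAct _ s w`.
    have key : ∀ (t : BAlg E F ⊗[R] (BAlg E F)ᵐᵒᵖ) (s : BAlg E F ⊗[R] (BAlg E F)ᵐᵒᵖ)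
        (w : BAlg E F), opAct _ (s * t) w =
          TensorProduct.lift (LinearMap.mk₂ R (fun a b => (a ⊗ₜ[R] (1 : BAlg E F)) * opAct _ t b)
            (fun a a' b => by simp [TensorProduct.add_tmul, add_mul])
            (fun r a b => by simp [← TensorProduct.smul_tmul'])
            (fun a b b' => by simp [mul_add]) (fun r a b => by simp)) (opAct _ s w) := by
      intro t s w
      induction s with
      | zero => simp
      | add a b ha hb => simp only [add_mul, map_add, LinearMap.add_apply, ha, hb]
      | tmul a b =>
        induction t with
        | zero => simp
        | add c d hc hd =>
          simp only [opAct_tmul, TensorProduct.lift.tmul, LinearMap.mk₂_apply, mul_add, map_add,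
            LinearMap.add_apply] at hc hd ⊢
          rw [hc, hd]
        | tmul c d => simp [mul_assoc]
    have key2 : canInv E F (x * h ⊗ₜ y) = TensorProduct.lift (LinearMap.mk₂ R
            (fun a b => (a ⊗ₜ[R] (1 : BAlg E F)) * (opAct _ (translation E F h) b * (1 ⊗ₜ y)))
            (fun a a' b => by simp [TensorProduct.add_tmul, add_mul])
            (fun r a b => by simp [← TensorProduct.smul_tmul'])
            (fun a b b' => by simp [mul_add, add_mul]) (fun r a b => by simp))
            (canInv E F x) := by
      clear hx
      induction x with
      | zero => simp
      | add a b ha hb => simp only [map_add, add_mul, ha, hb]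
      | tmul h' y' =>
        rw [Algebra.TensorProduct.tmul_mul_tmul, canInv_tmul, canInv_tmul,
          map_mul (translation E F), opAct_apply_mul, key]
        generalize opAct _ (translation E F h') y' = s
        induction s with
        | zero => simp
        | add a b ha hb => simp only [map_add, add_mul, ha, hb]
        | tmul a b => simp [mul_assoc]
    rw [key2, hx, canInv_tmul]
    simp [← opAct_apply_mul]

lemma canInv_coact (z : BAlg E F) : canInv E F ((coaction E F).coact z) = z ⊗ₜ 1 := by
  refine induction_gen (P := fun z => canInv E F ((coaction E F).coact z) = z ⊗ₜ 1)
    (fun r => ?_) (fun i j => ?_) (fun x y hx hy => ?_) (fun x y hx hy => ?_) z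
  · rw [AlgHom.commutes, Algebra.TensorProduct.algebraMap_apply, canInv_tmul, AlgHom.commutes,
      Algebra.TensorProduct.algebraMap_apply]
    simp
  · have hl := inverseMat_mul (gen_rel E F)
    simp only [coaction_coact_gen, map_sum, canInv_tmul, translation_gen, LinearMap.sum_apply,
      opAct_tmul, MulOpposite.unop_op]
    rw [Finset.sum_comm]
    simp only [← TensorProduct.tmul_sum, ← Matrix.mul_apply, hl]
    simp [Matrix.one_apply, TensorProduct.tmul_ite]
  · simp only [map_add, hx, hy, TensorProduct.add_tmul]
  · rw [map_mul, canInv_mul _ _ _ hx, hy]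
    simp

lemma canInv_can (x : BAlg E F ⊗[R] BAlg E F) : canInv E F ((coaction E F).can x) = x := by
  induction x with
  | zero => simp
  | add a b ha hb => simp only [map_add, ha, hb]
  | tmul h z => rw [can_tmul, canInv_mul_right, canInv_coact]; simp

/-- The canonical map of `B(E,F)` is bijective, for all `E` and `F`. -/
lemma coaction_can_bijective (E : GL (Fin n) R) (F : GL (Fin m) R) :
    Function.Bijective (coaction E F).can :=
  Function.bijective_iff_has_inverse.2 ⟨canInv E F, canInv_can, can_canInv⟩

end galois

end BAlg

end BilinearQuantum

/-! ### A criterion for Galois objects. -/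

namespace LeftComoduleAlgebra

variable {R : Type u} {H : Type v} {Z : Type w} [CommRing R] [Nontrivial R] [Ring H]
  [HopfAlgebra R H] [Ring Z] [Algebra R Z]

/-- For a coinvariant z, the elements z ⊗ 1 and 1 ⊗ z have the same canonical image, so they are
equal. Applying φ to the left factor gives z = φ(z)1. The functional also shows Z ≠ 0, so freeness
gives faithful flatness. -/
lemma isGaloisObject_of_free (δ : LeftComoduleAlgebra R H Z) [Module.Free R Z]
    (hφ : ∃ φ : Z →ₗ[R] R, φ 1 = 1) (hcan : Function.Bijective δ.can) : δ.IsGaloisObject := by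
  obtain ⟨φ, hφ⟩ := hφ
  refine ⟨eq_bot_iff.2 fun z hz => ?_, hcan, ?_⟩
  · have h1 : δ.coact z = 1 ⊗ₜ z := hz
    have h2 : z ⊗ₜ[R] (1 : Z) = 1 ⊗ₜ z := by
      apply hcan.1
      change δ.coact z * (1 ⊗ₜ 1) = δ.coact 1 * (1 ⊗ₜ z)
      rw [h1]
      simp
    have h3 := congrArg (fun t => TensorProduct.lid R Z (φ.rTensor Z t)) h2
    simp only [LinearMap.rTensor_tmul, TensorProduct.lid_tmul, hφ, one_smul] at h3
    exact Algebra.mem_bot.2 ⟨φ z, by rw [Algebra.algebraMap_eq_smul_one, h3]⟩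
  · have : Nontrivial Z := by
      refine ⟨1, 0, fun h => one_ne_zero (α := R) ?_⟩
      rw [← hφ, h, map_zero]
    infer_instance

end LeftComoduleAlgebra

/-! ### Normal words and the operators of left multiplication. -/

namespace BilinearQuantum

namespace NormalWord

/-- The letter `l'` may follow `l` in a normal word: no `y` before an `x`, and no `v` after `r`. -/
def Ok {m : ℕ} (r v : Fin m) (l l' : Fin 2 × Fin m) : Prop :=
  l.1 ≤ l'.1 ∧ (l.2 = r → l'.2 ≠ v)

end NormalWord

/-- Normal words in the letters `x_j = (0, j)` and `y_j = (1, j)`: a word in the `x_j` followed by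
a word in the `y_j`, whose word of indices does not have `r` followed by `v`. -/
abbrev NormalWord {m : ℕ} (r v : Fin m) : Type :=
  {w : List (Fin 2 × Fin m) // w.IsChain (NormalWord.Ok r v)}

namespace NormalWord

variable {R : Type u} [CommRing R] {m : ℕ} {r v : Fin m}

/-- The empty word. -/
def nil : NormalWord r v := ⟨[], List.isChain_nil⟩

/-- All letters of the word are of kind at least `t`. -/
def HeadGE (t : Fin 2) (w : NormalWord r v) : Prop := ∀ l ∈ w.1.head?, t ≤ l.1

lemma headGE_zero (w : NormalWord r v) : HeadGE 0 w := fun _ _ => Fin.zero_le _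

lemma headGE_nil (t : Fin 2) : HeadGE t (nil : NormalWord r v) := by
  simp [HeadGE, nil]

lemma headGE_tail {l : Fin 2 × Fin m} {w : List (Fin 2 × Fin m)}
    (h : (l :: w).IsChain (Ok r v)) : HeadGE l.1 (⟨w, h.tail⟩ : NormalWord r v) :=
  fun l' hl' => ((List.isChain_cons.1 h).1 l' hl').1

lemma isChain_cons_of_ne {t : Fin 2} {j : Fin m} {w : NormalWord r v} (h : HeadGE t w)
    (hj : j ≠ r) : ((t, j) :: w.1).IsChain (Ok r v) :=
  List.isChain_cons.2 ⟨fun l hl => ⟨h l hl, fun e => absurd e hj⟩, w.2⟩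

open Classical in
/-- Left multiplication by a letter where the result is normal, and zero elsewhere. -/
def cons (R : Type u) [CommRing R] (r v : Fin m) (l : Fin 2 × Fin m) :
    (NormalWord r v →₀ R) →ₗ[R] (NormalWord r v →₀ R) :=
  Finsupp.linearCombination R fun w =>
    if h : (l :: w.1).IsChain (Ok r v) then Finsupp.single ⟨l :: w.1, h⟩ 1 else 0

lemma cons_single {l : Fin 2 × Fin m} {w : NormalWord r v} (h : (l :: w.1).IsChain (Ok r v)) :
    cons R r v l (Finsupp.single w 1) = Finsupp.single ⟨l :: w.1, h⟩ 1 := by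
  simp [cons, h]

variable (M : Matrix (Fin m) (Fin m) R) (c q : R) (r v)

/-- The value on a normal word of left multiplication by the letter `(s, i)`, if the word begins
with a letter of kind at least `s`. -/
def stepAux : Fin 2 → (w : List (Fin 2 × Fin m)) → w.IsChain (Ok r v) → Fin m →
    (NormalWord r v →₀ R)
  | s, [], _, i => cons R r v (s, i) (Finsupp.single nil 1)
  | s, l :: w, h, i =>
    if i = r ∧ l.2 = v then
      -- This is the relation solved for the pivot pair. Using `cons` for the outer letter keeps the
      -- recursion structural and loses nothing at a pivot: for a ≠ r no rewriting can occur, for a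
      -- = r and b < v the word is already normal, and for a = r and b > v the coefficient is zero.
      -c • ((∑ a, ∑ b, if a = r ∧ b = v then 0 else
        M a b • cons R r v (s, a) (stepAux l.1 w h.tail b)) +
          if s < l.1 then q • Finsupp.single ⟨w, h.tail⟩ 1 else 0)
    else cons R r v (s, i) (Finsupp.single ⟨l :: w, h⟩ 1)

/-- Left multiplication by the letter `(s, i)`, on words which begin with a letter of kind at
least `s`. -/
def step (s : Fin 2) (i : Fin m) : (NormalWord r v →₀ R) →ₗ[R] (NormalWord r v →₀ R) :=
  Finsupp.linearCombination R fun w => stepAux r v M c q s w.1 w.2 i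

/-- The value on a normal word of left multiplication by the letter `y_i`. -/
def yStepAux (F : Matrix (Fin m) (Fin m) R) : (w : List (Fin 2 × Fin m)) → w.IsChain (Ok r v) →
    Fin m → (NormalWord r v →₀ R)
  | [], h, i => stepAux r v M c q 1 [] h i
  | l :: w, h, i =>
    if l.1 = 0 then
      q • (step r v M c q 0 i (yStepAux F w h.tail l.2) - F i l.2 • Finsupp.single ⟨w, h.tail⟩ 1)
    else stepAux r v M c q 1 (l :: w) h i

/-- Left multiplication by the letter `y_i`. -/
def yStep (F : Matrix (Fin m) (Fin m) R) (i : Fin m) :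
    (NormalWord r v →₀ R) →ₗ[R] (NormalWord r v →₀ R) :=
  Finsupp.linearCombination R fun w => yStepAux r v M c q F w.1 w.2 i

variable {M c q r v}

lemma hom_ext {N : Type*} [AddCommGroup N] [Module R N] {f g : (NormalWord r v →₀ R) →ₗ[R] N}
    (h : ∀ w, f (Finsupp.single w 1) = g (Finsupp.single w 1)) : f = g :=
  Finsupp.lhom_ext' fun w => LinearMap.ext_ring (h w)

lemma step_single (s : Fin 2) (i : Fin m) (w : NormalWord r v) :
    step r v M c q s i (Finsupp.single w 1) = stepAux r v M c q s w.1 w.2 i := by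
  simp [step]

/-- No rewriting occurs unless `r` is put before `v`. -/
lemma step_single_eq_cons {s : Fin 2} {i : Fin m} {w : NormalWord r v}
    (h : i = r → ∀ l ∈ w.1.head?, l.2 ≠ v) :
    step r v M c q s i (Finsupp.single w 1) = cons R r v (s, i) (Finsupp.single w 1) := by
  rw [step_single]
  obtain ⟨w, hw⟩ := w
  cases w with
  | nil => rw [stepAux]; rfl
  | cons l w =>
    rw [stepAux, if_neg]
    rintro ⟨h1, h2⟩
    exact h h1 l (by simp) h2

lemma step_eq_cons {s : Fin 2} {i : Fin m} (h : i ≠ r) :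
    step r v M c q s i = cons R r v (s, i) :=
  hom_ext fun _ => step_single_eq_cons fun e => absurd e h

lemma step_single_of_isChain {s : Fin 2} {i : Fin m} {w : NormalWord r v}
    (h : ((s, i) :: w.1).IsChain (Ok r v)) :
    step r v M c q s i (Finsupp.single w 1) = Finsupp.single ⟨(s, i) :: w.1, h⟩ 1 := by
  rw [step_single_eq_cons, cons_single h]
  exact fun hi l hl => ((List.isChain_cons.1 h).1 l hl).2 hi

/-- The span of the normal words beginning with a letter of kind at least `t`. -/
def headSpan (R : Type u) [CommRing R] (r v : Fin m) (t : Fin 2) :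
    Submodule R (NormalWord r v →₀ R) :=
  Submodule.span R {x | ∃ w, HeadGE t w ∧ x = Finsupp.single w 1}

lemma single_mem_headSpan {t : Fin 2} {w : NormalWord r v} (h : HeadGE t w) :
    Finsupp.single w (1 : R) ∈ headSpan R r v t :=
  Submodule.subset_span ⟨w, h, rfl⟩

lemma eqOn_headSpan {N : Type*} [AddCommGroup N] [Module R N] {t : Fin 2}
    {f g : (NormalWord r v →₀ R) →ₗ[R] N}
    (h : ∀ w, HeadGE t w → f (Finsupp.single w 1) = g (Finsupp.single w 1))
    {x : NormalWord r v →₀ R} (hx : x ∈ headSpan R r v t) : f x = g x := by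
  refine LinearMap.eqOn_span (s := {x | ∃ w, HeadGE t w ∧ x = Finsupp.single w 1}) ?_ hx
  rintro _ ⟨w, hw, rfl⟩
  exact h w hw

lemma cons_mem_headSpan (t : Fin 2) (i : Fin m) (x : NormalWord r v →₀ R) :
    cons R r v (t, i) x ∈ headSpan R r v t := by
  classical
  induction x using Finsupp.induction_linear with
  | zero => simp
  | add x y hx hy => rw [map_add]; exact add_mem hx hy
  | single w a =>
    rw [cons, Finsupp.linearCombination_single]
    refine Submodule.smul_mem _ _ ?_
    split_ifs with h
    · refine single_mem_headSpan ?_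
      intro l hl
      simp only [List.head?_cons, Option.mem_def, Option.some.injEq] at hl
      rw [← hl]
    · exact zero_mem _

lemma stepAux_mem_headSpan (s : Fin 2) (w : NormalWord r v) (i : Fin m) :
    stepAux r v M c q s w.1 w.2 i ∈ headSpan R r v s := by
  obtain ⟨w, hw⟩ := w
  cases w with
  | nil => rw [stepAux]; exact cons_mem_headSpan _ _ _
  | cons l w =>
    rw [stepAux]
    split_ifs with h1 h2
    · refine Submodule.smul_mem _ _ (add_mem (Submodule.sum_mem _ fun a _ =>
        Submodule.sum_mem _ fun b _ => ?_) (Submodule.smul_mem _ _ (single_mem_headSpan ?_)))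
      · split_ifs
        · exact zero_mem _
        · exact Submodule.smul_mem _ _ (cons_mem_headSpan _ _ _)
      · exact fun l' hl' => h2.le.trans (headGE_tail hw l' hl')
    · refine Submodule.smul_mem _ _ (add_mem (Submodule.sum_mem _ fun a _ =>
        Submodule.sum_mem _ fun b _ => ?_) (zero_mem _))
      · split_ifs
        · exact zero_mem _
        · exact Submodule.smul_mem _ _ (cons_mem_headSpan _ _ _)
    · exact cons_mem_headSpan _ _ _

lemma step_mem_headSpan (s : Fin 2) (i : Fin m) (w : NormalWord r v) :
    step r v M c q s i (Finsupp.single w 1) ∈ headSpan R r v s := by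
  rw [step_single]; exact stepAux_mem_headSpan s w i

lemma sum_sum_eq_add_ite {N : Type*} [AddCommGroup N] (f : Fin m → Fin m → N) (r v : Fin m) :
    ∑ a, ∑ b, f a b = (∑ a, ∑ b, if a = r ∧ b = v then 0 else f a b) + f r v := by
  have h : ∀ a b, f a b = (if a = r ∧ b = v then 0 else f a b) +
      if a = r then if b = v then f a b else 0 else 0 := by
    intro a b
    split_ifs <;> simp_all
  conv_lhs => enter [2, a, 2, b]; rw [h a b]
  simp [Finset.sum_add_distrib]

/-- The entry `(r, v)` of `M` is the rightmost nonzero entry of its row `r`, it has inverse `c`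
and it is not on the diagonal. -/
structure IsPivot (M : Matrix (Fin m) (Fin m) R) (c : R) (r v : Fin m) : Prop where
  mul_eq_one : M r v * c = 1
  eq_zero : ∀ j, v < j → M r j = 0
  lt : v < r

/-- For `(a, b) ≠ (r, v)`, no rewriting occurs in `(s, a) (t, b) w`. -/
lemma IsPivot.step_step (hM : IsPivot M c r v) {s t : Fin 2} {a b : Fin m} {w : NormalWord r v}
    (hw : HeadGE t w) (hab : ¬(a = r ∧ b = v)) :
    M a b • step r v M c q s a (step r v M c q t b (Finsupp.single w 1)) =
      M a b • cons R r v (s, a) (step r v M c q t b (Finsupp.single w 1)) := by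
  by_cases ha : a = r
  · subst ha
    rcases lt_trichotomy b v with hb | hb | hb
    · have hbr : b ≠ a := (hb.trans hM.lt).ne
      rw [step_single_of_isChain (isChain_cons_of_ne hw hbr), step_single_eq_cons]
      intro _ l hl
      simp only [List.head?_cons, Option.mem_def, Option.some.injEq] at hl
      rw [← hl]
      exact hb.ne
    · exact absurd ⟨rfl, hb⟩ hab
    · rw [hM.eq_zero b hb, zero_smul, zero_smul]
  · rw [step_eq_cons ha]

/-- The rule for the pivot pair was chosen to make this true: multiplied by `M r v`, the inverse of
`c`, it cancels all other terms of the sum and leaves the constant. By `step_step` those other terms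
may be computed with `cons`. -/
lemma IsPivot.sum_step_step (hM : IsPivot M c r v) (s t : Fin 2) {w : NormalWord r v}
    (hw : HeadGE t w) :
    ∑ a, ∑ b, M a b • step r v M c q s a (step r v M c q t b (Finsupp.single w 1)) =
      -(if s < t then q • Finsupp.single w 1 else 0) := by
  rw [sum_sum_eq_add_ite _ r v]
  have h1 : step r v M c q s r (step r v M c q t v (Finsupp.single w 1)) =
      -c • ((∑ a, ∑ b, if a = r ∧ b = v then 0 else
        M a b • cons R r v (s, a) (step r v M c q t b (Finsupp.single w 1))) +
          if s < t then q • Finsupp.single w 1 else 0) := by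
    rw [step_single_of_isChain (isChain_cons_of_ne hw hM.lt.ne), step_single, stepAux,
      if_pos ⟨rfl, rfl⟩]
    simp only [step_single]
  have h2 : ∀ a b, (if a = r ∧ b = v then 0 else
      M a b • step r v M c q s a (step r v M c q t b (Finsupp.single w 1))) =
      if a = r ∧ b = v then 0 else
        M a b • cons R r v (s, a) (step r v M c q t b (Finsupp.single w 1)) := by
    intro a b
    split_ifs with h
    · rfl
    · exact hM.step_step hw h
  simp only [h2]
  rw [h1, smul_smul, mul_neg, hM.mul_eq_one, neg_smul, one_smul]
  abel

lemma IsPivot.sum_xStep_xStep (hM : IsPivot M c r v) (x : NormalWord r v →₀ R) :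
    ∑ a, ∑ b, M a b • step r v M c q 0 a (step r v M c q 0 b x) = 0 := by
  have h : ∑ a, ∑ b, M a b • (step r v M c q 0 a ∘ₗ step r v M c q 0 b) = 0 :=
    hom_ext fun w => by
      simpa [LinearMap.sum_apply] using hM.sum_step_step (q := q) 0 0 (headGE_zero w)
  simpa [LinearMap.sum_apply] using LinearMap.congr_fun h x

section yStep
variable {F : Matrix (Fin m) (Fin m) R}

lemma yStep_single (i : Fin m) (w : NormalWord r v) :
    yStep r v M c q F i (Finsupp.single w 1) = yStepAux r v M c q F w.1 w.2 i := by
  simp [yStep]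

lemma yStep_single_of_headGE {i : Fin m} {w : NormalWord r v} (h : HeadGE 1 w) :
    yStep r v M c q F i (Finsupp.single w 1) = step r v M c q 1 i (Finsupp.single w 1) := by
  rw [yStep_single, step_single]
  obtain ⟨w, hw⟩ := w
  cases w with
  | nil => rw [yStepAux]
  | cons l w =>
    rw [yStepAux, if_neg]
    intro h0
    have := h l (by simp)
    rw [h0] at this
    exact absurd this (by decide)

lemma yStep_eq_step {i : Fin m} {x : NormalWord r v →₀ R} (hx : x ∈ headSpan R r v 1) :
    yStep r v M c q F i x = step r v M c q 1 i x :=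
  eqOn_headSpan (fun _ hw => yStep_single_of_headGE hw) hx

lemma yStep_xStep_of_isChain {i j : Fin m} {w : NormalWord r v}
    (h : (((0 : Fin 2), j) :: w.1).IsChain (Ok r v)) :
    yStep r v M c q F i (step r v M c q 0 j (Finsupp.single w 1)) =
      q • (step r v M c q 0 i (yStep r v M c q F j (Finsupp.single w 1)) -
        F i j • Finsupp.single w 1) := by
  rw [step_single_of_isChain h, yStep_single, yStepAux, if_pos rfl, yStep_single]

lemma yStep_xStep_of_ne {i j : Fin m} (hj : j ≠ r) (x : NormalWord r v →₀ R) :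
    yStep r v M c q F i (step r v M c q 0 j x) =
      q • (step r v M c q 0 i (yStep r v M c q F j x) - F i j • x) := by
  have h : yStep r v M c q F i ∘ₗ step r v M c q 0 j =
      q • (step r v M c q 0 i ∘ₗ yStep r v M c q F j - F i j • LinearMap.id) :=
    hom_ext fun w => by
      simpa using yStep_xStep_of_isChain (M := M) (c := c) (q := q) (F := F) (i := i)
        (isChain_cons_of_ne (headGE_zero w) hj)
  simpa using LinearMap.congr_fun h x

lemma sum_smul_of_mul_eq_one {M F : Matrix (Fin m) (Fin m) R} (h : M * F = 1)
    {N : Type*} [AddCommGroup N] [Module R N] (f : Fin m → N) (j : Fin m) :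
    ∑ a, ∑ b, (M a b * F b j) • f a = f j := by
  simp only [← Finset.sum_smul, ← Matrix.mul_apply, h, Matrix.one_apply, ite_smul, one_smul,
    zero_smul]
  simp

lemma headGE_one_or_exists (w : NormalWord r v) : HeadGE 1 w ∨
    ∃ (j : Fin m) (w' : NormalWord r v) (h : (((0 : Fin 2), j) :: w'.1).IsChain (Ok r v)),
      w = ⟨(0, j) :: w'.1, h⟩ := by
  obtain ⟨w, hw⟩ := w
  cases w with
  | nil => exact Or.inl (headGE_nil 1)
  | cons l w =>
    obtain ⟨t, j⟩ := l
    rcases (Fin.exists_fin_two (p := fun s => t = s)).1 ⟨t, rfl⟩ with h | h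
    · subst h
      exact Or.inr ⟨j, ⟨w, hw.tail⟩, hw, rfl⟩
    · subst h
      refine Or.inl fun l hl => ?_
      simp only [List.head?_cons, Option.mem_def, Option.some.injEq] at hl
      rw [← hl]

/-- On words without x's this is `sum_step_step`. On x_j w, moving y_b past x_j gives q times the
vanishing sum of M_ab x_a x_b y_j w, minus q times the sum of M_ab F_bj x_a w, which is x_j w
because MF = 1. -/
lemma IsPivot.sum_xStep_yStep_single (hM : IsPivot M c r v) (hMF : M * F = 1)
    (w : NormalWord r v) :
    ∑ a, ∑ b, M a b • step r v M c q 0 a (yStep r v M c q F b (Finsupp.single w 1)) =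
      -q • Finsupp.single w 1 := by
  rcases headGE_one_or_exists w with hw | ⟨j, w, h, rfl⟩
  · simp only [yStep_single_of_headGE hw]
    rw [hM.sum_step_step 0 1 hw, if_pos Fin.zero_lt_one, neg_smul]
  · rw [← step_single_of_isChain (M := M) (c := c) (q := q) h]
    have e : ∀ a b, M a b • step r v M c q 0 a (yStep r v M c q F b
        (step r v M c q 0 j (Finsupp.single w 1))) =
        q • (M a b • step r v M c q 0 a (step r v M c q 0 b (yStep r v M c q F j
          (Finsupp.single w 1)))) -
        q • ((M a b * F b j) • step r v M c q 0 a (Finsupp.single w 1)) := by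
      intro a b
      rw [yStep_xStep_of_isChain h]
      simp only [map_smul, map_sub]
      module
    simp only [e, Finset.sum_sub_distrib, ← Finset.smul_sum, hM.sum_xStep_xStep,
      sum_smul_of_mul_eq_one hMF (fun a => step r v M c q 0 a (Finsupp.single w 1)) j]
    module

lemma IsPivot.sum_xStep_yStep (hM : IsPivot M c r v) (hMF : M * F = 1)
    (x : NormalWord r v →₀ R) :
    ∑ a, ∑ b, M a b • step r v M c q 0 a (yStep r v M c q F b x) = -q • x := by
  have h : ∑ a, ∑ b, M a b • (step r v M c q 0 a ∘ₗ yStep r v M c q F b) = -q • LinearMap.id :=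
    hom_ext fun w => by
      simpa [LinearMap.sum_apply] using hM.sum_xStep_yStep_single (q := q) hMF w
  simpa [LinearMap.sum_apply] using LinearMap.congr_fun h x

variable {q' : R}

/-- The expression which results from `y_i x_a (t, b) w` by the rule for `y_i x_a`. -/
lemma IsPivot.sum_yStep_xStep_rewrite (hM : IsPivot M c r v) (hMF : M * F = 1)
    (hq : q * q' = 1) (hτ : ∑ a, ∑ b, M a b * F a b = -q - q') (i : Fin m) (t : Fin 2)
    {w : NormalWord r v} (hw : HeadGE t w)
    (ih : ∀ a b, yStep r v M c q F a (step r v M c q 0 b (Finsupp.single w 1)) =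
      q • (step r v M c q 0 a (yStep r v M c q F b (Finsupp.single w 1)) -
        F a b • Finsupp.single w 1)) :
    ∑ a, ∑ b, M a b • yStep r v M c q F i (step r v M c q 0 a (step r v M c q t b
        (Finsupp.single w 1))) =
      ∑ a, ∑ b, M a b • q • (step r v M c q 0 i (yStep r v M c q F a (step r v M c q t b
        (Finsupp.single w 1))) - F i a • step r v M c q t b (Finsupp.single w 1)) := by
  have hFM : F * M = 1 := mul_eq_one_comm.1 hMF
  have hsum : ∀ f : Fin m → (NormalWord r v →₀ R),
      ∑ a, ∑ b, (F i a * M a b) • f b = f i := by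
    intro f
    rw [Finset.sum_comm]
    simp only [← Finset.sum_smul, ← Matrix.mul_apply, hFM, Matrix.one_apply, ite_smul, one_smul,
      zero_smul]
    simp
  have hl : ∑ a, ∑ b, M a b • yStep r v M c q F i (step r v M c q 0 a (step r v M c q t b
        (Finsupp.single w 1))) =
      yStep r v M c q F i (-(if 0 < t then q • Finsupp.single w 1 else 0)) := by
    rw [← hM.sum_step_step 0 t hw]
    simp only [map_sum, map_smul]
  rw [hl]
  rcases (Fin.exists_fin_two (p := fun s => t = s)).1 ⟨t, rfl⟩ with h | h
  · subst h
    have e : ∀ a b, M a b • q • (step r v M c q 0 i (yStep r v M c q F a (step r v M c q 0 b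
        (Finsupp.single w 1))) - F i a • step r v M c q 0 b (Finsupp.single w 1)) =
        (q * q) • step r v M c q 0 i (M a b • step r v M c q 0 a (yStep r v M c q F b
          (Finsupp.single w 1))) -
        (q * q) • ((M a b * F a b) • step r v M c q 0 i (Finsupp.single w 1)) -
        q • ((F i a * M a b) • step r v M c q 0 b (Finsupp.single w 1)) := by
      intro a b
      rw [ih]
      simp only [map_smul, map_sub]
      module
    simp only [e, Finset.sum_sub_distrib, ← Finset.smul_sum, ← map_sum, hsum, ← Finset.sum_smul,
      hM.sum_xStep_yStep hMF, hτ]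
    simp only [map_smul, lt_self_iff_false, if_false, neg_zero, map_zero]
    have : (q * q) * q' = q := by rw [mul_assoc, hq, mul_one]
    rw [smul_smul, smul_smul, ← sub_smul, ← sub_smul]
    -- The three terms come from the sum of the M_ab x_a y_b, from the trace and from FM = 1. They
    -- cancel because of the trace condition.
    rw [show q * q * -q - q * q * (-q - q') - q = 0 by rw [mul_sub, this]; ring, zero_smul]
  · subst h
    have e : ∀ a b, M a b • q • (step r v M c q 0 i (yStep r v M c q F a (step r v M c q 1 b
        (Finsupp.single w 1))) - F i a • step r v M c q 1 b (Finsupp.single w 1)) =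
        q • step r v M c q 0 i (M a b • step r v M c q 1 a (step r v M c q 1 b
          (Finsupp.single w 1))) -
        q • ((F i a * M a b) • step r v M c q 1 b (Finsupp.single w 1)) := by
      intro a b
      rw [yStep_eq_step (step_mem_headSpan 1 b w)]
      simp only [map_smul]
      module
    simp only [e, Finset.sum_sub_distrib, ← Finset.smul_sum, ← map_sum, hsum,
      hM.sum_step_step 1 1 hw]
    rw [if_pos Fin.zero_lt_one, if_neg (lt_irrefl _), map_neg, map_smul,
      yStep_single_of_headGE hw, neg_zero, map_zero, smul_zero, zero_sub]

/-- If x_j w is normal, this is the definition of `yStep`. The remaining case is the overlap y_i x_r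
z_tv. There the rule is known for every other pair (a, b) with M_ab ≠ 0, and it holds after summing
over all pairs with weights M_ab, so it holds for the pivot pair as well. -/
lemma IsPivot.yStep_xStep_single (hM : IsPivot M c r v) (hMF : M * F = 1)
    (hq : q * q' = 1) (hτ : ∑ a, ∑ b, M a b * F a b = -q - q') (w : List (Fin 2 × Fin m))
    (hw : w.IsChain (Ok r v)) (i j : Fin m) :
    yStep r v M c q F i (step r v M c q 0 j (Finsupp.single (⟨w, hw⟩ : NormalWord r v) 1)) =
      q • (step r v M c q 0 i (yStep r v M c q F j (Finsupp.single ⟨w, hw⟩ 1)) -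
        F i j • Finsupp.single ⟨w, hw⟩ 1) := by
  induction w generalizing i j with
  | nil => exact yStep_xStep_of_isChain (List.isChain_singleton _)
  | cons l w ih =>
    by_cases hc : (((0 : Fin 2), j) :: l :: w).IsChain (Ok r v)
    · exact yStep_xStep_of_isChain hc
    have hjl : j = r ∧ l.2 = v := by
      by_contra hne
      refine hc (List.isChain_cons_cons.2 ⟨⟨Fin.zero_le _, fun h1 h2 => hne ⟨h1, h2⟩⟩, hw⟩)
    -- From here on the pivot position (r, v) is called (j, k).
    obtain ⟨rfl, hl⟩ := hjl
    obtain ⟨t, k⟩ := l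
    obtain rfl : k = v := hl
    have hge := headGE_tail hw
    have hs := hM.sum_yStep_xStep_rewrite hMF hq hτ i t hge (fun a b => ih hw.tail a b)
    rw [sum_sum_eq_add_ite _ j k,
      sum_sum_eq_add_ite (fun a b => M a b • q • (_ - _)) j k] at hs
    have he : ∀ a b, (if a = j ∧ b = k then 0 else
        M a b • yStep j k M c q F i (step j k M c q 0 a (step j k M c q t b
          (Finsupp.single ⟨w, hw.tail⟩ 1)))) =
        if a = j ∧ b = k then 0 else M a b • q • (step j k M c q 0 i (yStep j k M c q F a
          (step j k M c q t b (Finsupp.single ⟨w, hw.tail⟩ 1))) -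
          F i a • step j k M c q t b (Finsupp.single ⟨w, hw.tail⟩ 1)) := by
      intro a b
      split_ifs with hab
      · rfl
      by_cases ha : a = j
      · subst ha
        rcases lt_trichotomy b k with hb | hb | hb
        · rw [step_single_of_isChain (isChain_cons_of_ne hge (hb.trans hM.lt).ne),
            yStep_xStep_of_isChain]
          exact List.isChain_cons_cons.2 ⟨⟨Fin.zero_le _, fun _ => hb.ne⟩,
            isChain_cons_of_ne hge (hb.trans hM.lt).ne⟩
        · exact absurd ⟨rfl, hb⟩ hab
        · rw [hM.eq_zero b hb, zero_smul, zero_smul]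
      · rw [yStep_xStep_of_ne ha]
    simp only [he] at hs
    have hs' := add_left_cancel hs
    rw [step_single_of_isChain (w := ⟨w, hw.tail⟩) hw] at hs'
    -- Only the pivot term is left, with coefficient `M j k`, and `c` removes it.
    have hs2 := congrArg (c • ·) hs'
    simpa only [smul_smul c, mul_comm c, hM.mul_eq_one, one_smul] using hs2

lemma IsPivot.yStep_xStep (hM : IsPivot M c r v) (hMF : M * F = 1)
    (hq : q * q' = 1) (hτ : ∑ a, ∑ b, M a b * F a b = -q - q') (i j : Fin m)
    (x : NormalWord r v →₀ R) :
    yStep r v M c q F i (step r v M c q 0 j x) =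
      q • (step r v M c q 0 i (yStep r v M c q F j x) - F i j • x) := by
  have h : yStep r v M c q F i ∘ₗ step r v M c q 0 j =
      q • (step r v M c q 0 i ∘ₗ yStep r v M c q F j - F i j • LinearMap.id) :=
    hom_ext fun w => by simpa using hM.yStep_xStep_single hMF hq hτ w.1 w.2 i j
  simpa using LinearMap.congr_fun h x

/-- The commutation rule reduces this to the sum of the M_ab x_a y_b. The trace condition then gives
−q² + q² + 1 as the coefficient. -/
lemma IsPivot.sum_yStep_xStep (hM : IsPivot M c r v) (hMF : M * F = 1)
    (hq : q * q' = 1) (hτ : ∑ a, ∑ b, M a b * F a b = -q - q') (x : NormalWord r v →₀ R) :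
    ∑ a, ∑ b, M a b • yStep r v M c q F a (step r v M c q 0 b x) = x := by
  have e : ∀ a b, M a b • yStep r v M c q F a (step r v M c q 0 b x) =
      q • (M a b • step r v M c q 0 a (yStep r v M c q F b x)) - q • (M a b * F a b) • x := by
    intro a b
    rw [hM.yStep_xStep hMF hq hτ]
    module
  simp only [e, Finset.sum_sub_distrib, ← Finset.smul_sum, ← Finset.sum_smul,
    hM.sum_xStep_yStep hMF, hτ]
  rw [smul_smul, smul_smul, ← sub_smul,
    show q * -q - q * (-q - q') = 1 by rw [← hq]; ring, one_smul]

/-- On words without x's this holds by the pivot rule. On x_j w, both y's are moved past x_j, and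
the three resulting multiples of y_j w cancel by the same identity as in the overlap y_i x_r x_v. -/
lemma IsPivot.sum_yStep_yStep (hM : IsPivot M c r v) (hMF : M * F = 1)
    (hq : q * q' = 1) (hτ : ∑ a, ∑ b, M a b * F a b = -q - q') (x : NormalWord r v →₀ R) :
    ∑ a, ∑ b, M a b • yStep r v M c q F a (yStep r v M c q F b x) = 0 := by
  have h : ∑ a, ∑ b, M a b • (yStep r v M c q F a ∘ₗ yStep r v M c q F b) = 0 := by
    refine hom_ext fun w => ?_
    simp only [LinearMap.sum_apply, LinearMap.smul_apply, LinearMap.comp_apply,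
      LinearMap.zero_apply]
    rcases headGE_one_or_exists w with hw | ⟨j, w, h, rfl⟩
    · simp only [yStep_single_of_headGE hw, yStep_eq_step (step_mem_headSpan 1 _ w),
        hM.sum_step_step 1 1 hw]
      simp
    · rw [← step_single_of_isChain (M := M) (c := c) (q := q) h]
      generalize (Finsupp.single w 1 : NormalWord r v →₀ R) = x
      have e : ∀ a b, M a b • yStep r v M c q F a (yStep r v M c q F b
          (step r v M c q 0 j x)) =
          (q * q) • (M a b • step r v M c q 0 a (yStep r v M c q F b (yStep r v M c q F j x))) -
          (q * q) • ((M a b * F a b) • yStep r v M c q F j x) -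
          q • ((M a b * F b j) • yStep r v M c q F a x) := by
        intro a b
        simp only [hM.yStep_xStep hMF hq hτ, map_smul, map_sub]
        module
      simp only [e, Finset.sum_sub_distrib, ← Finset.smul_sum, ← Finset.sum_smul,
        hM.sum_xStep_yStep hMF, hτ]
      simp only [Finset.sum_smul, sum_smul_of_mul_eq_one hMF (fun a => yStep r v M c q F a x) j]
      have : (q * q) * q' = q := by rw [mul_assoc, hq, mul_one]
      rw [smul_smul, smul_smul, ← sub_smul, ← sub_smul]
      rw [show q * q * -q - q * q * (-q - q') - q = 0 by rw [mul_sub, this]; ring, zero_smul]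
  simpa [LinearMap.sum_apply] using LinearMap.congr_fun h x

end yStep

end NormalWord

end BilinearQuantum

/-! ### The basis of normal words of B(E_q,F). -/

namespace BilinearQuantum

section relations
variable {R : Type u} [CommRing R] {n m : ℕ} {E : GL (Fin n) R} {F : GL (Fin m) R}
  {A : Type v} [Ring A] [Algebra R A]

/-- In this form each entry is a quadratic expression in `z` equal to a scalar, which suits
rewriting, congruence and base change. -/
lemma rel_iff {z : Matrix (Fin n) (Fin m) A} : Rel E F z ↔
    z.transpose * scalarMat A E.val * z = scalarMat A F.val ∧
      z * scalarMat A (F⁻¹).val * z.transpose = scalarMat A (E⁻¹).val := by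
  constructor
  · rintro ⟨h1, h2⟩
    simp only [leftSide, rightSide] at h1 h2
    constructor
    · have := congrArg (scalarMat A F.val * ·) h1
      simpa only [← Matrix.mul_assoc, BAlg.scalarMat_mul_inv, Matrix.one_mul,
        Matrix.mul_one] using this
    · have := congrArg (· * scalarMat A (E⁻¹).val) h2
      simpa only [Matrix.mul_assoc, BAlg.scalarMat_mul_inv, Matrix.one_mul,
        Matrix.mul_one] using this
  · rintro ⟨h1, h2⟩
    constructor
    · rw [leftSide, Matrix.mul_assoc, Matrix.mul_assoc, ← Matrix.mul_assoc z.transpose, h1,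
        BAlg.scalarMat_inv_mul]
    · rw [rightSide, h2, BAlg.scalarMat_inv_mul]

lemma transpose_mul_scalarMat_mul_apply {z : Matrix (Fin n) (Fin m) A}
    (M : Matrix (Fin n) (Fin n) R) (i j : Fin m) :
    (z.transpose * scalarMat A M * z) i j = ∑ a, ∑ b, M a b • (z a i * z b j) := by
  simp only [Matrix.mul_apply, Matrix.transpose_apply, Matrix.map_apply, Finset.sum_mul]
  rw [Finset.sum_comm]
  refine Finset.sum_congr rfl fun a _ => Finset.sum_congr rfl fun b _ => ?_
  rw [← Algebra.commutes, Algebra.smul_def, mul_assoc]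

lemma mul_scalarMat_mul_transpose_apply {z : Matrix (Fin n) (Fin m) A}
    (M : Matrix (Fin m) (Fin m) R) (i j : Fin n) :
    (z * scalarMat A M * z.transpose) i j = ∑ a, ∑ b, M a b • (z i a * z j b) := by
  simp only [Matrix.mul_apply, Matrix.transpose_apply, Matrix.map_apply, Finset.sum_mul]
  rw [Finset.sum_comm]
  refine Finset.sum_congr rfl fun a _ => Finset.sum_congr rfl fun b _ => ?_
  rw [← Algebra.commutes, Algebra.smul_def, mul_assoc]

lemma qMatrix_inv_val (q : Rˣ) : ((qMatrix q)⁻¹).val = !![0, -(q : R); 1, 0] := rfl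

/-- The relations of `B(E_q, F)`. -/
lemma rel_qMatrix_iff {q : Rˣ} {z : Matrix (Fin 2) (Fin m) A} : Rel (qMatrix q) F z ↔
    (∀ i j, z 1 i * z 0 j = (q : R) • (z 0 i * z 1 j - F.val i j • 1)) ∧
      ∀ s t, ∑ a, ∑ b, (F⁻¹).val a b • (z s a * z t b) =
        (!![0, -(q : R); 1, 0] : Matrix (Fin 2) (Fin 2) R) s t • (1 : A) := by
  rw [rel_iff, ← Matrix.ext_iff, ← Matrix.ext_iff]
  simp only [transpose_mul_scalarMat_mul_apply, mul_scalarMat_mul_transpose_apply,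
    Matrix.map_apply, qMatrix_inv_val, Algebra.algebraMap_eq_smul_one]
  refine and_congr_left fun _ => forall_congr' fun i => forall_congr' fun j => ?_
  simp only [qMatrix, Fin.sum_univ_two, Matrix.of_apply, Matrix.cons_val', Matrix.cons_val_zero,
    Matrix.cons_val_one, Matrix.cons_val_fin_one, zero_smul, one_smul, zero_add, add_zero]
  constructor
  · intro h
    rw [← h, neg_smul, sub_add_cancel_left, neg_neg, smul_smul, Units.mul_inv, one_smul]
  · intro h
    rw [h, neg_smul, smul_smul, Units.inv_mul, one_smul]
    abel

end relations

namespace BAlg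

open NormalWord

variable {R : Type u} [CommRing R] {m : ℕ} {q : Rˣ} {F : GL (Fin m) R} {r v : Fin m} {c : R}

/-- The matrix of left multiplications by the letters, on the span of the normal words. -/
def stepMat (q : Rˣ) (F : GL (Fin m) R) (r v : Fin m) (c : R) :
    Matrix (Fin 2) (Fin m) (Module.End R (NormalWord r v →₀ R)) :=
  Matrix.of ![step r v (F⁻¹).val c q 0, yStep r v (F⁻¹).val c q F.val]

lemma trace_asymmetry (F : GL (Fin m) R) :
    (asymmetry F).trace = ∑ a, ∑ b, (F⁻¹).val a b * F.val a b := by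
  simp [asymmetry, Matrix.trace, Matrix.mul_apply]

lemma rel_stepMat (hM : IsPivot (F⁻¹).val c r v)
    (hτ : (asymmetry F).trace = -(q : R) - (q⁻¹ : Rˣ)) :
    Rel (qMatrix q) F (stepMat q F r v c) := by
  have hMF : (F⁻¹).val * F.val = 1 := F.inv_val
  have hq : (q : R) * (q⁻¹ : Rˣ) = 1 := q.mul_inv
  rw [trace_asymmetry] at hτ
  refine rel_qMatrix_iff.2 ⟨fun i j => LinearMap.ext fun x => ?_, fun s t =>
    LinearMap.ext fun x => ?_⟩
  · exact hM.yStep_xStep hMF hq hτ i j x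
  · simp only [LinearMap.sum_apply, LinearMap.smul_apply, Module.End.mul_apply,
      Module.End.one_apply]
    fin_cases s <;> fin_cases t
    · simpa [stepMat] using hM.sum_xStep_xStep x
    · simpa [stepMat] using hM.sum_xStep_yStep hMF x
    · simpa [stepMat] using hM.sum_yStep_xStep hMF hq hτ x
    · simpa [stepMat] using hM.sum_yStep_yStep hMF hq hτ x

/-- The element of `B(E_q, F)` given by a normal word. -/
def evalWord (q : Rˣ) (F : GL (Fin m) R) (r v : Fin m) :
    (NormalWord r v →₀ R) →ₗ[R] BAlg (qMatrix q) F :=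
  Finsupp.linearCombination R fun w => (w.1.map fun l => gen (qMatrix q) F l.1 l.2).prod

lemma evalWord_single (w : NormalWord r v) : evalWord q F r v (Finsupp.single w 1) =
    (w.1.map fun l => gen (qMatrix q) F l.1 l.2).prod := by
  simp [evalWord]

lemma evalWord_cons {t : Fin 2} {i : Fin m} (hi : i ≠ r) {x : NormalWord r v →₀ R}
    (hx : x ∈ headSpan R r v t) : evalWord q F r v (cons R r v (t, i) x) =
      gen (qMatrix q) F t i * evalWord q F r v x := by
  refine eqOn_headSpan (f := evalWord q F r v ∘ₗ cons R r v (t, i))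
    (g := LinearMap.mulLeft R (gen (qMatrix q) F t i) ∘ₗ evalWord q F r v) (fun w hw => ?_) hx
  simp [cons_single (isChain_cons_of_ne hw hi), evalWord_single]

lemma headSpan_anti {s t : Fin 2} (h : s ≤ t) : headSpan R r v t ≤ headSpan R r v s :=
  Submodule.span_mono fun _ ⟨w, hw, hx⟩ => ⟨w, fun l hl => h.trans (hw l hl), hx⟩

/-- Rewriting does not change the value in the algebra, because the pivot rule is a consequence of
the defining relations. The assumption `HeadGE s` excludes words where `cons` returns its default
value zero because a y would come before an x. -/
lemma evalWord_step (hM : IsPivot (F⁻¹).val c r v) (w : List (Fin 2 × Fin m))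
    (hw : w.IsChain (Ok r v)) (s : Fin 2) (hs : HeadGE s (⟨w, hw⟩ : NormalWord r v)) (i : Fin m) :
    evalWord q F r v (step r v (F⁻¹).val c q s i (Finsupp.single ⟨w, hw⟩ 1)) =
      gen (qMatrix q) F s i * evalWord q F r v (Finsupp.single ⟨w, hw⟩ 1) := by
  induction w generalizing s i with
  | nil =>
    rw [step_single_of_isChain (List.isChain_singleton _), evalWord_single, evalWord_single]
    simp
  | cons l w ih =>
    by_cases hc : ((s, i) :: l :: w).IsChain (Ok r v)
    · rw [step_single_of_isChain hc, evalWord_single, evalWord_single]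
      simp
    have hsl : s ≤ l.1 := hs l (by simp)
    have hjl : i = r ∧ l.2 = v := by
      by_contra hne
      exact hc (List.isChain_cons_cons.2 ⟨⟨hsl, fun h1 h2 => hne ⟨h1, h2⟩⟩, hw⟩)
    obtain ⟨rfl, hl⟩ := hjl
    obtain ⟨t, k⟩ := l
    obtain rfl : k = v := hl
    have hge := headGE_tail hw
    have hrel := (rel_qMatrix_iff.1 (gen_rel (qMatrix q) F)).2
    have e : ∀ a b, ((if a = i ∧ b = k then 0 else (F⁻¹).val a b •
        evalWord q F i k (cons R i k (s, a)
          (step i k (F⁻¹).val c q t b (Finsupp.single ⟨w, hw.tail⟩ 1))))) =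
        (if a = i ∧ b = k then 0 else (F⁻¹).val a b •
          (gen (qMatrix q) F s a * gen (qMatrix q) F t b)) *
          evalWord q F i k (Finsupp.single ⟨w, hw.tail⟩ 1) := by
      intro a b
      split_ifs with hab
      · simp
      by_cases ha : a = i
      · subst ha
        rcases lt_trichotomy b k with hb | hb | hb
        · have hch : ((s, a) :: (t, b) :: w).IsChain (Ok a k) :=
            List.isChain_cons_cons.2 ⟨⟨hsl, fun _ => hb.ne⟩,
              isChain_cons_of_ne hge (hb.trans hM.lt).ne⟩
          rw [step_single_of_isChain (isChain_cons_of_ne hge (hb.trans hM.lt).ne),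
            cons_single hch, evalWord_single, evalWord_single]
          simp [mul_assoc]
        · exact absurd ⟨rfl, hb⟩ hab
        · rw [hM.eq_zero b hb, zero_smul, zero_smul, zero_mul]
      · rw [evalWord_cons ha (headSpan_anti hsl (step_mem_headSpan t b _)), ih _ t hge,
          smul_mul_assoc, mul_assoc]
    have hsum : ∑ a, ∑ b, (if a = i ∧ b = k then 0 else (F⁻¹).val a b •
        (gen (qMatrix q) F s a * gen (qMatrix q) F t b)) =
        -(if s < t then (q : R) • 1 else 0) -
          (F⁻¹).val i k • (gen (qMatrix q) F s i * gen (qMatrix q) F t k) := by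
      rw [eq_sub_iff_add_eq, ← sum_sum_eq_add_ite (fun a b => (F⁻¹).val a b •
        (gen (qMatrix q) F s a * gen (qMatrix q) F t b)), hrel]
      have : ∀ s t : Fin 2, s ≤ t → (!![0, -(q : R); 1, 0] : Matrix (Fin 2) (Fin 2) R) s t •
          (1 : BAlg (qMatrix q) F) = -(if s < t then (q : R) • 1 else 0) := by
        intro s t hst
        fin_cases s <;> fin_cases t <;> simp at hst ⊢
      exact this s t hsl
    rw [step_single, stepAux, if_pos ⟨rfl, rfl⟩]
    have e' : ∀ a b, evalWord q F i k (if a = i ∧ b = k then 0 else (F⁻¹).val a b •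
        cons R i k (s, a) (stepAux i k (F⁻¹).val c q t w hw.tail b)) =
        (if a = i ∧ b = k then 0 else (F⁻¹).val a b •
          (gen (qMatrix q) F s a * gen (qMatrix q) F t b)) *
          evalWord q F i k (Finsupp.single ⟨w, hw.tail⟩ 1) := by
      intro a b
      rw [← e, step_single]
      split_ifs
      · rw [map_zero]
      · rw [map_smul]
    have e2 : evalWord q F i k (if s < t then (q : R) • Finsupp.single ⟨w, hw.tail⟩ 1 else 0) =
        (if s < t then (q : R) • 1 else 0) *
          evalWord q F i k (Finsupp.single ⟨w, hw.tail⟩ 1) := by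
      split_ifs
      · rw [map_smul, smul_mul_assoc, one_mul]
      · rw [map_zero, zero_mul]
    have e3 : evalWord q F i k (Finsupp.single ⟨(t, k) :: w, hw⟩ 1) =
        gen (qMatrix q) F t k * evalWord q F i k (Finsupp.single ⟨w, hw.tail⟩ 1) := by
      rw [evalWord_single, evalWord_single]
      simp
    simp only [map_smul, map_add, map_sum, e', e2, ← Finset.sum_mul, hsum]
    rw [e3, ← add_mul, sub_add_eq_add_sub, neg_add_cancel, zero_sub, ← mul_assoc, neg_mul,
      smul_neg, neg_smul, neg_neg, smul_mul_assoc, smul_smul, mul_comm c, hM.mul_eq_one, one_smul]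

lemma evalWord_yStep (hM : IsPivot (F⁻¹).val c r v) (w : List (Fin 2 × Fin m))
    (hw : w.IsChain (Ok r v)) (i : Fin m) :
    evalWord q F r v (yStep r v (F⁻¹).val c q F.val i (Finsupp.single ⟨w, hw⟩ 1)) =
      gen (qMatrix q) F 1 i * evalWord q F r v (Finsupp.single ⟨w, hw⟩ 1) := by
  induction w generalizing i with
  | nil =>
    rw [yStep_single_of_headGE (w := ⟨[], hw⟩) (headGE_nil 1)]
    exact evalWord_step hM [] hw 1 (headGE_nil 1) i
  | cons l w ih =>
    obtain ⟨t, j⟩ := l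
    revert t
    rw [Fin.forall_fin_two]
    refine ⟨fun hw => ?_, fun hw => ?_⟩
    · have hxy := (rel_qMatrix_iff.1 (gen_rel (qMatrix q) F)).1 i j
      have hx : ∀ x, evalWord q F r v (step r v (F⁻¹).val c q 0 i x) =
          gen (qMatrix q) F 0 i * evalWord q F r v x := fun x =>
        LinearMap.congr_fun (f := evalWord q F r v ∘ₗ step r v (F⁻¹).val c q 0 i)
          (g := LinearMap.mulLeft R (gen (qMatrix q) F 0 i) ∘ₗ evalWord q F r v)
          (hom_ext fun w => evalWord_step hM w.1 w.2 0 (headGE_zero w) i) x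
      rw [yStep_single, yStepAux, if_pos rfl, ← yStep_single j ⟨w, hw.tail⟩, map_smul, map_sub,
        map_smul, hx, ih hw.tail j]
      have e : evalWord q F r v (Finsupp.single ⟨(0, j) :: w, hw⟩ 1) =
          gen (qMatrix q) F 0 j * evalWord q F r v (Finsupp.single ⟨w, hw.tail⟩ 1) := by
        rw [evalWord_single, evalWord_single]
        simp
      rw [e, ← mul_assoc, ← mul_assoc, hxy, smul_mul_assoc, sub_mul, smul_mul_assoc, one_mul]
    · have hge : HeadGE 1 (⟨(1, j) :: w, hw⟩ : NormalWord r v) := fun l hl => by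
        simp only [List.head?_cons, Option.mem_def, Option.some.injEq] at hl
        rw [← hl]
      rw [yStep_single_of_headGE hge]
      exact evalWord_step hM _ hw 1 hge i

/-- `B(E_q, F)` acts on the span of the normal words. -/
def wordAction (hM : IsPivot (F⁻¹).val c r v)
    (hτ : (asymmetry F).trace = -(q : R) - (q⁻¹ : Rˣ)) :
    BAlg (qMatrix q) F →ₐ[R] Module.End R (NormalWord r v →₀ R) :=
  lift (stepMat q F r v c) (rel_stepMat hM hτ)

/-- Evaluation intertwines the action on words with left multiplication. At the empty word this
recovers z from its action, so normal words span. -/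
lemma evalWord_wordAction (hM : IsPivot (F⁻¹).val c r v)
    (hτ : (asymmetry F).trace = -(q : R) - (q⁻¹ : Rˣ)) (z : BAlg (qMatrix q) F)
    (x : NormalWord r v →₀ R) :
    evalWord q F r v (wordAction hM hτ z x) = z * evalWord q F r v x := by
  induction z using induction_gen generalizing x with
  | halg a => simp [Algebra.smul_def]
  | hgen s i =>
    refine LinearMap.congr_fun (f := evalWord q F r v ∘ₗ wordAction hM hτ _)
      (g := LinearMap.mulLeft R _ ∘ₗ evalWord q F r v) (hom_ext fun w => ?_) x
    rw [LinearMap.comp_apply, LinearMap.comp_apply, wordAction, lift_gen]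
    revert s
    rw [Fin.forall_fin_two]
    exact ⟨evalWord_step hM w.1 w.2 0 (headGE_zero w) i, evalWord_yStep hM w.1 w.2 i⟩
  | hadd a b ha hb => rw [map_add, LinearMap.add_apply, map_add, ha, hb, add_mul]
  | hmul a b ha hb => rw [map_mul, Module.End.mul_apply, ha, hb, mul_assoc]

/-- Every tail of a normal word is normal, so building the word letter by letter from the empty word
never triggers a rewriting. This gives linear independence. -/
lemma wordAction_evalWord_single (hM : IsPivot (F⁻¹).val c r v)
    (hτ : (asymmetry F).trace = -(q : R) - (q⁻¹ : Rˣ)) (w : List (Fin 2 × Fin m))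
    (hw : w.IsChain (Ok r v)) :
    wordAction hM hτ (evalWord q F r v (Finsupp.single ⟨w, hw⟩ 1)) (Finsupp.single nil 1) =
      Finsupp.single ⟨w, hw⟩ 1 := by
  induction w with
  | nil => rw [evalWord_single]; simp; rfl
  | cons l w ih =>
    have h := ih hw.tail
    rw [evalWord_single] at h ⊢
    rw [List.map_cons, List.prod_cons, map_mul, Module.End.mul_apply, h, wordAction, lift_gen]
    have : ∀ s j (hw : ((s, j) :: w).IsChain (Ok r v)), stepMat q F r v c s j
        (Finsupp.single (⟨w, hw.tail⟩ : NormalWord r v) 1) = Finsupp.single ⟨(s, j) :: w, hw⟩ 1 := by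
      rw [Fin.forall_fin_two]
      refine ⟨fun j hw => step_single_of_isChain (w := ⟨w, hw.tail⟩) hw, fun j hw => ?_⟩
      exact (yStep_single_of_headGE (headGE_tail hw)).trans
        (step_single_of_isChain (w := ⟨w, hw.tail⟩) hw)
    exact this l.1 l.2 hw

/-- The normal words form a basis of `B(E_q, F)`. -/
def wordEquiv (hM : IsPivot (F⁻¹).val c r v)
    (hτ : (asymmetry F).trace = -(q : R) - (q⁻¹ : Rˣ)) :
    BAlg (qMatrix q) F ≃ₗ[R] (NormalWord r v →₀ R) where
  toFun z := wordAction hM hτ z (Finsupp.single nil 1)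
  map_add' x y := by rw [map_add, LinearMap.add_apply]
  map_smul' a x := by rw [map_smul, LinearMap.smul_apply, RingHom.id_apply]
  invFun := evalWord q F r v
  left_inv z := by
    change evalWord q F r v (wordAction hM hτ z (Finsupp.single nil 1)) = z
    rw [evalWord_wordAction, evalWord_single]
    simp [nil]
  right_inv x := by
    have h : LinearMap.applyₗ (Finsupp.single nil 1) ∘ₗ (wordAction hM hτ).toLinearMap ∘ₗ
        evalWord q F r v = LinearMap.id :=
      hom_ext fun w => wordAction_evalWord_single hM hτ w.1 w.2
    exact LinearMap.congr_fun h x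

/-- The diagonal entry of the last row is zero and the pivot is a unit, so v ≠ r. Since r is the
last index, v < r. -/
lemma isPivot_of_isManageable [Nontrivial R] (h : IsManageable F) :
    ∃ c r v, IsPivot (F⁻¹).val c r v := by
  obtain ⟨r, v, hr, hrr, hu, hz⟩ := h
  obtain ⟨c, hc⟩ := hu.exists_right_inv
  have hne : v ≠ r := by
    rintro rfl
    rw [hrr] at hu
    exact not_isUnit_zero hu
  exact ⟨c, r, v, hc, hz, lt_of_le_of_ne (Fin.le_def.2 (by omega)) hne⟩

lemma free_of_isManageable [Nontrivial R] (hF : IsManageable F)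
    (hτ : (asymmetry F).trace = -(q : R) - (q⁻¹ : Rˣ)) :
    Module.Free R (BAlg (qMatrix q) F) ∧ ∃ φ : BAlg (qMatrix q) F →ₗ[R] R, φ 1 = 1 := by
  obtain ⟨c, r, v, hM⟩ := isPivot_of_isManageable hF
  refine ⟨Module.Free.of_equiv (wordEquiv hM hτ).symm,
    Finsupp.lapply nil ∘ₗ (wordEquiv hM hτ).toLinearMap, ?_⟩
  simp [wordEquiv]

end BAlg

end BilinearQuantum

/-! ### Isomorphisms of comodule algebras: congruence, base change and specialization. -/

namespace LeftComoduleAlgebra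

variable {R : Type u} {H : Type v} {Z Z' Z'' : Type*} [CommRing R] [Ring H] [HopfAlgebra R H]
  [Ring Z] [Algebra R Z] [Ring Z'] [Algebra R Z'] [Ring Z''] [Algebra R Z'']

lemma IsIsomorphic.trans {δ : LeftComoduleAlgebra R H Z} {δ' : LeftComoduleAlgebra R H Z'}
    {δ'' : LeftComoduleAlgebra R H Z''} (h : δ.IsIsomorphic δ') (h' : δ'.IsIsomorphic δ'') :
    δ.IsIsomorphic δ'' := by
  obtain ⟨e, he⟩ := h
  obtain ⟨e', he'⟩ := h'
  refine ⟨e.trans e', AlgHom.ext fun z => ?_⟩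
  have h1 := DFunLike.congr_fun he z
  have h2 := DFunLike.congr_fun he' (e z)
  simp only [AlgHom.comp_apply] at h1 h2
  change _ = δ''.coact (e'.toAlgHom (e z))
  rw [← h2, show (e z) = e.toAlgHom z from rfl, ← h1, AlgHom.comp_apply]
  generalize δ.coact z = x
  induction x with
  | zero => simp
  | add a b ha hb => simp only [map_add, ha, hb]
  | tmul a b => simp

end LeftComoduleAlgebra

namespace BilinearQuantum

namespace BAlg

section can
variable {R : Type u} [CommRing R] {n m : ℕ} {E : GL (Fin n) R} {F : GL (Fin m) R}
  {H : Type v} [Ring H] [HopfAlgebra R H]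

/-- When `a` identifies B(E) with `H`, the canonical map is that of `coaction E F` followed by this
identification on the left factor. -/
lemma coactionOf_can_bijective {a : Matrix (Fin n) (Fin n) H} (ha : Rel E E a)
    (hΔ : ∀ i j, Coalgebra.comul (R := R) (a i j) = ∑ p, a i p ⊗ₜ[R] a p j)
    (hε : ∀ i j, Coalgebra.counit (R := R) (a i j) = (1 : Matrix (Fin n) (Fin n) R) i j)
    (h : Function.Bijective (lift a ha)) :
    Function.Bijective (coactionOf F a ha hΔ hε).can := by
  let e : BAlg E E ≃ₐ[R] H := AlgEquiv.ofBijective (lift a ha) h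
  let f : BAlg E E ⊗[R] BAlg E F →ₐ[R] H ⊗[R] BAlg E F :=
    Algebra.TensorProduct.map (lift a ha) (AlgHom.id R _)
  have hc : (coactionOf F a ha hΔ hε).coact = f.comp (coaction E F).coact := by
    apply algHom_ext
    intro i j
    rw [AlgHom.comp_apply, coaction_coact_gen]
    simp [coactionOf, tensorMul, f]
  have hcan : ∀ x, (coactionOf F a ha hΔ hε).can x =
      e.toLinearEquiv.rTensor (BAlg E F) ((coaction E F).can x) := by
    intro x
    change _ = f ((coaction E F).can x)
    induction x with
    | zero => simp
    | add x y hx hy => simp only [map_add, hx, hy]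
    | tmul x y =>
      change (coactionOf F a ha hΔ hε).coact x * (1 ⊗ₜ y) = f ((coaction E F).coact x * (1 ⊗ₜ y))
      rw [hc, map_mul]
      simp [f]
  rw [show ⇑(coactionOf F a ha hΔ hε).can = _ ∘ _ from funext hcan]
  exact (LinearEquiv.bijective _).comp (coaction_can_bijective E F)

end can

section congruence
variable {R : Type u} [CommRing R] {n m : ℕ} {E : GL (Fin n) R} {F G : GL (Fin m) R}
  {A : Type v} [Ring A] [Algebra R A]

/-- A change of basis in the form F only acts on the columns of `z`. It therefore commutes with the
coaction, which acts on the rows. -/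
lemma rel_mul_transpose (P : GL (Fin m) R) (h : G.val = P.val * F.val * P.val.transpose)
    {z : Matrix (Fin n) (Fin m) A} (hz : Rel E F z) :
    Rel E G (z * scalarMat A P.val.transpose) := by
  obtain ⟨h1, h2⟩ := rel_iff.1 hz
  have hG : (G⁻¹).val = (P⁻¹).val.transpose * (F⁻¹).val * (P⁻¹).val := by
    rw [Matrix.coe_units_inv]
    refine Matrix.inv_eq_right_inv ?_
    have e1 : P.val.transpose * (P⁻¹).val.transpose = 1 := by
      rw [← Matrix.transpose_mul, Units.inv_mul, Matrix.transpose_one]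
    calc G.val * ((P⁻¹).val.transpose * (F⁻¹).val * (P⁻¹).val)
        = P.val * (F.val * (P.val.transpose * (P⁻¹).val.transpose) * (F⁻¹).val) * (P⁻¹).val := by
          rw [h]; simp only [Matrix.mul_assoc]
      _ = 1 := by rw [e1, Matrix.mul_one, Units.mul_inv, Matrix.mul_one, Units.mul_inv]
  have e1 : scalarMat A P.val.transpose * scalarMat A (P⁻¹).val.transpose = 1 := by
    rw [← Matrix.map_mul, ← Matrix.transpose_mul, Units.inv_mul, Matrix.transpose_one,
      Matrix.map_one _ (map_zero _) (map_one _)]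
  have e2 := scalarMat_inv_mul A P
  rw [rel_iff, transpose_mul_scalarMat, Matrix.transpose_transpose]
  constructor
  · rw [h, scalarMat, scalarMat, scalarMat, scalarMat, Matrix.map_mul, Matrix.map_mul]
    simp only [scalarMat] at h1
    rw [← h1]
    simp only [Matrix.mul_assoc]
  · rw [hG, scalarMat, scalarMat, Matrix.map_mul, Matrix.map_mul]
    calc _ = z * (scalarMat A P.val.transpose * scalarMat A (P⁻¹).val.transpose) *
            scalarMat A (F⁻¹).val * (scalarMat A (P⁻¹).val * scalarMat A P.val) * z.transpose := by
          simp only [Matrix.mul_assoc, scalarMat]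
      _ = _ := by rw [e1, e2, Matrix.mul_one, Matrix.mul_one, h2]

/-- For `G = P F Pᵗ`, the morphism `B(E,G) → B(E,F)`, `z ↦ z Pᵗ`. -/
def congrHom (P : GL (Fin m) R) (h : G.val = P.val * F.val * P.val.transpose) :
    BAlg E G →ₐ[R] BAlg E F :=
  lift (gen E F * scalarMat _ P.val.transpose) (rel_mul_transpose P h (gen_rel E F))

lemma congrHom_gen (P : GL (Fin m) R) (h : G.val = P.val * F.val * P.val.transpose)
    (i : Fin n) (j : Fin m) : congrHom P h (gen E G i j) =
      ∑ p, P.val j p • gen E F i p := by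
  rw [congrHom, lift_gen, Matrix.mul_apply]
  refine Finset.sum_congr rfl fun p _ => ?_
  change _ * algebraMap R _ (P.val j p) = _
  rw [← Algebra.commutes, ← Algebra.smul_def]

lemma congrHom_congrHom (P Q : GL (Fin m) R) (hPQ : P.val * Q.val = 1)
    (h : G.val = P.val * F.val * P.val.transpose) (h' : F.val = Q.val * G.val * Q.val.transpose)
    (z : BAlg E G) : congrHom Q h' (congrHom P h z) = z := by
  suffices hs : (congrHom Q h').comp (congrHom P h) = AlgHom.id R (BAlg E G) from
    DFunLike.congr_fun hs z
  apply algHom_ext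
  intro i j
  simp only [AlgHom.comp_apply, congrHom_gen, map_sum, map_smul, Finset.smul_sum, smul_smul]
  rw [Finset.sum_comm]
  simp only [← Finset.sum_smul, ← Matrix.mul_apply, hPQ]
  simp [Matrix.one_apply]

lemma eq_inv_congr (P : GL (Fin m) R) (h : G.val = P.val * F.val * P.val.transpose) :
    F.val = (P⁻¹).val * G.val * (P⁻¹).val.transpose := by
  have e1 : P.val.transpose * (P⁻¹).val.transpose = 1 := by
    rw [← Matrix.transpose_mul, Units.inv_mul, Matrix.transpose_one]
  calc F.val = (P⁻¹).val * P.val * F.val * (P.val.transpose * (P⁻¹).val.transpose) := by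
        rw [e1, Units.inv_mul, Matrix.one_mul, Matrix.mul_one]
    _ = _ := by rw [h]; simp only [Matrix.mul_assoc]

/-- For `G = P F Pᵗ`, the isomorphism `B(E,G) ≃ B(E,F)`, `z ↦ z Pᵗ`. -/
def congrEquiv (P : GL (Fin m) R) (h : G.val = P.val * F.val * P.val.transpose) :
    BAlg E G ≃ₐ[R] BAlg E F :=
  AlgEquiv.ofAlgHom (congrHom P h) (congrHom P⁻¹ (eq_inv_congr P h))
    (AlgHom.ext fun z => congrHom_congrHom _ _ P.inv_mul _ _ z)
    (AlgHom.ext fun z => congrHom_congrHom _ _ P.mul_inv _ _ z)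

lemma coaction_isIsomorphic_of_congr (P : GL (Fin m) R)
    (h : G.val = P.val * F.val * P.val.transpose) :
    (coaction E G).IsIsomorphic (coaction E F) := by
  refine ⟨congrEquiv P h, ?_⟩
  apply algHom_ext
  intro i j
  change Algebra.TensorProduct.map (AlgHom.id R _) (congrHom P h) ((coaction E G).coact _) =
    (coaction E F).coact (congrHom P h _)
  simp only [coaction_coact_gen, congrHom_gen, map_sum, map_smul, Algebra.TensorProduct.map_tmul,
    AlgHom.id_apply, TensorProduct.tmul_sum, TensorProduct.tmul_smul, Finset.smul_sum]
  rw [Finset.sum_comm]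

end congruence

section baseChange
variable {K K' : Type u} [CommRing K] [CommRing K'] [Algebra K K'] {n m : ℕ}
  {E : GL (Fin n) K} {F : GL (Fin m) K} {E' : GL (Fin n) K'} {F' : GL (Fin m) K'}

lemma inv_val_eq_map (h : E'.val = E.val.map (algebraMap K K')) :
    (E'⁻¹).val = (E⁻¹).val.map (algebraMap K K') := by
  rw [Matrix.coe_units_inv]
  refine Matrix.inv_eq_right_inv ?_
  rw [h, ← Matrix.map_mul, Units.mul_inv, Matrix.map_one _ (map_zero _) (map_one _)]

lemma scalarMat_map_algebraMap (A : Type*) [Ring A] [Algebra K A] [Algebra K' A]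
    [IsScalarTower K K' A] {a b : ℕ} (M : Matrix (Fin a) (Fin b) K) :
    scalarMat A (M.map (algebraMap K K')) = scalarMat A M := by
  ext i j
  simp [← IsScalarTower.algebraMap_apply]

lemma rel_baseChange_iff {A : Type*} [Ring A] [Algebra K A] [Algebra K' A] [IsScalarTower K K' A]
    (hE : E'.val = E.val.map (algebraMap K K')) (hF : F'.val = F.val.map (algebraMap K K'))
    {z : Matrix (Fin n) (Fin m) A} : Rel E' F' z ↔ Rel E F z := by
  rw [rel_iff, rel_iff, hE, hF, inv_val_eq_map hE, inv_val_eq_map hF]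
  simp only [scalarMat_map_algebraMap]

/-- Base change of `B(E,F)`. -/
lemma exists_baseChangeEquiv (hE : E'.val = E.val.map (algebraMap K K'))
    (hF : F'.val = F.val.map (algebraMap K K')) :
    ∃ e : K' ⊗[K] BAlg E F ≃ₐ[K'] BAlg E' F', ∀ i j, e (1 ⊗ₜ gen E F i j) = gen E' F' i j := by
  -- Viewed over `K`, the generators of B(E',F') satisfy the relations of B(E,F). Both universal
  -- properties then give mutually inverse maps.
  let : Algebra K (BAlg E' F') := Algebra.compHom _ (algebraMap K K')
  have : IsScalarTower K K' (BAlg E' F') := IsScalarTower.of_algebraMap_eq fun _ => rfl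
  let f : K' ⊗[K] BAlg E F →ₐ[K'] BAlg E' F' :=
    Algebra.TensorProduct.lift (Algebra.ofId K' _)
      (lift (gen E' F') ((rel_baseChange_iff hE hF).1 (gen_rel E' F')))
      (fun x y => Algebra.commute_algebraMap_left x _)
  have hg : Rel E' F' ((gen E F).map (Algebra.TensorProduct.includeRight :
      BAlg E F →ₐ[K] K' ⊗[K] BAlg E F)) :=
    (rel_baseChange_iff hE hF).2 (rel_map _ (gen_rel E F))
  have hf : ∀ i j, f (1 ⊗ₜ gen E F i j) = gen E' F' i j := by
    intro i j
    refine (Algebra.TensorProduct.lift_tmul _ _ _ _ _).trans ?_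
    rw [map_one, one_mul, lift_gen]
  refine ⟨AlgEquiv.ofAlgHom f (lift _ hg) ?_ ?_, hf⟩
  · apply algHom_ext
    intro i j
    simp [hf]
  · apply Algebra.TensorProduct.ext
    · ext
    · apply algHom_ext
      intro i j
      simp [hf]

variable {H' : Type*} {H : Type v} [Ring H'] [HopfAlgebra K H'] [Ring H] [HopfAlgebra K' H]
  [Algebra K H] [IsScalarTower K K' H]

lemma baseChange_coactionOf_isIsomorphic (hE : E'.val = E.val.map (algebraMap K K'))
    (hF : F'.val = F.val.map (algebraMap K K')) (p : H' →ₐ[K] H)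
    (hΔ : ∀ h : H', Coalgebra.comul (R := K') (p h) =
      (LeftComoduleAlgebra.tensorMap p p : H' ⊗[K] H' →ₐ[K] H ⊗[K'] H)
        (Coalgebra.comul (R := K) h))
    (hε : ∀ h : H', Coalgebra.counit (R := K') (p h) =
      algebraMap K K' (Coalgebra.counit (R := K) h))
    {a : Matrix (Fin n) (Fin n) H'} (ha : Rel E E a)
    (haΔ : ∀ i j, Coalgebra.comul (R := K) (a i j) = ∑ p, a i p ⊗ₜ[K] a p j)
    (haε : ∀ i j, Coalgebra.counit (R := K) (a i j) = (1 : Matrix (Fin n) (Fin n) K) i j)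
    {a' : Matrix (Fin n) (Fin n) H} (ha' : Rel E' E' a')
    (haΔ' : ∀ i j, Coalgebra.comul (R := K') (a' i j) = ∑ p, a' i p ⊗ₜ[K'] a' p j)
    (haε' : ∀ i j, Coalgebra.counit (R := K') (a' i j) = (1 : Matrix (Fin n) (Fin n) K') i j)
    (hp : ∀ i j, p (a i j) = a' i j) :
    (LeftComoduleAlgebra.baseChange p hΔ hε (coactionOf F a ha haΔ haε)).IsIsomorphic
      (coactionOf F' a' ha' haΔ' haε') := by
  obtain ⟨e, he⟩ := exists_baseChangeEquiv hE hF
  refine ⟨e, Algebra.TensorProduct.ext (by ext) (algHom_ext fun i j => ?_)⟩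
  change Algebra.TensorProduct.map (AlgHom.id K' H) e.toAlgHom
    ((LeftComoduleAlgebra.baseChangeCoact p (coactionOf F a ha haΔ haε).coact :
      K' ⊗[K] BAlg E F →ₐ[K'] H ⊗[K'] (K' ⊗[K] BAlg E F)) (1 ⊗ₜ gen E F i j)) =
    (coactionOf F' a' ha' haΔ' haε').coact (e (1 ⊗ₜ gen E F i j))
  rw [LeftComoduleAlgebra.baseChangeCoact_tmul, he]
  simp [coactionOf, tensorMul, hp, he]

end baseChange

section poly
variable {k : Type u} [Field k] {n m : ℕ}

/-- Base change identifies k[t] ⊗ B(E) with B(E) formed over k[t], which reduces this to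
`coactionOf_can_bijective`. -/
lemma polyCoaction_can_bijective (E : GL (Fin n) k) (F : GL (Fin m) k[X]) :
    Function.Bijective (polyCoaction E F).can := by
  refine coactionOf_can_bijective _ _ _ ?_
  obtain ⟨e, he⟩ := exists_baseChangeEquiv (K := k) (K' := k[X]) (E := E) (F := E)
    (E' := constGL E) (F' := constGL E) rfl rfl
  have : lift _ (rel_constGL E) = e.symm.toAlgHom := by
    apply algHom_ext
    intro i j
    rw [lift_gen, ← he]
    simp
  rw [this]
  exact e.symm.bijective

lemma evalAt_polyCoaction_isIsomorphic (E : GL (Fin n) k) (F : GL (Fin m) k[X]) (i : k) :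
    ((polyCoaction E F).evalAt i).IsIsomorphic (coaction E (evalGL i F)) := by
  -- These are the instances chosen in `evalAt`. With them the specialization is by definition the
  -- base change along `augment`.
  let : Algebra k[X] k := (Polynomial.evalRingHom i).toAlgebra
  let : Algebra k[X] (BAlg E E) := Algebra.compHom (BAlg E E) (Polynomial.evalRingHom i)
  have : IsScalarTower k[X] k (BAlg E E) := IsScalarTower.of_algebraMap_eq (fun _ => rfl)
  have : IsScalarTower k k[X] k := IsScalarTower.of_algebraMap_eq (fun x => by
    simp [RingHom.algebraMap_toAlgebra])
  have : IsScalarTower k k[X] (BAlg E E) := IsScalarTower.of_algebraMap_eq (fun x => by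
    rw [IsScalarTower.algebraMap_apply k[X] k (BAlg E E),
      ← IsScalarTower.algebraMap_apply k k[X] k]
    rfl)
  have hE : E.val = (constGL E).val.map (algebraMap k[X] k) := by
    ext a b
    simp [RingHom.algebraMap_toAlgebra]
  have key := baseChange_coactionOf_isIsomorphic (K := k[X]) (K' := k) (E := constGL E) (F := F)
    (E' := E) (F' := evalGL i F) hE rfl LeftComoduleAlgebra.augment
    LeftComoduleAlgebra.augment_comul LeftComoduleAlgebra.augment_counit (rel_constGL E)
    (by intro i j; simp [comul_gen, TensorProduct.tmul_sum])
    (by intro i j; simp [counit_gen, Matrix.one_apply, ite_smul])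
    (gen_rel E E) comul_gen counit_gen (fun a b => by
      rw [Matrix.map_apply, LeftComoduleAlgebra.augment_tmul, one_smul])
  exact key

end poly

/-! ### The Galois property for manageable matrices. -/

section qMatrix

/-- `B(E_q, F)` is a Galois object for `F` manageable. -/
lemma coaction_isGaloisObject {k : Type u} [Field k] {m : ℕ} {q : kˣ} {F G : GL (Fin m) k}
    (P : GL (Fin m) k) (hP : G.val = P.val * F.val * P.val.transpose) (hG : IsManageable G)
    (hτ : (asymmetry G).trace = -(q : k) - (q : k)⁻¹) :
    (coaction (qMatrix q) F).IsGaloisObject := by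
  -- Over a field freeness is automatic. Only the functional is needed, and it is carried from `G`
  -- to `F` along the congruence.
  obtain ⟨-, φ, hφ⟩ := free_of_isManageable (q := q) hG (by rw [hτ, Units.val_inv_eq_inv_val])
  exact LeftComoduleAlgebra.isGaloisObject_of_free _
    ⟨φ ∘ₗ (congrEquiv P hP).symm.toLinearMap, by simp [hφ]⟩ (coaction_can_bijective _ _)

lemma polyCoaction_isGaloisObject {k : Type u} [Field k] {m : ℕ} {q : kˣ} {F : GL (Fin m) k[X]}
    (hF : IsManageable F)
    (hτ : (asymmetry F).trace = Polynomial.C (-(q : k) - (q : k)⁻¹)) :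
    (polyCoaction (qMatrix q) F).IsGaloisObject := by
  -- Viewed over k[t], E_q is again a matrix of this type, so the word basis is available there.
  have hq : constGL (qMatrix q) = qMatrix (Units.map (Polynomial.C : k →+* k[X]).toMonoidHom q) := by
    ext i j
    fin_cases i <;> fin_cases j <;> simp [qMatrix]
  have h : Module.Free k[X] (BAlg (constGL (qMatrix q)) F) ∧
      ∃ φ : BAlg (constGL (qMatrix q)) F →ₗ[k[X]] k[X], φ 1 = 1 := by
    rw [hq]
    refine free_of_isManageable hF ?_
    rw [hτ]
    simp
  have := h.1
  exact LeftComoduleAlgebra.isGaloisObject_of_free _ h.2 (polyCoaction_can_bijective _ _)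

end qMatrix

end BAlg

end BilinearQuantum

/-! ### Antitriangular matrices and congruence. -/

namespace BilinearQuantum

/-- `F i j = 0` above the antidiagonal. -/
def IsAntiTriangular {R : Type*} [Zero R] {m : ℕ} (F : Matrix (Fin m) (Fin m) R) : Prop :=
  ∀ i j : Fin m, (i : ℕ) + j + 1 < m → F i j = 0

/-- The pencil `X F - Fᵗ`. -/
def pencil {R : Type*} [CommRing R] {m : ℕ} (F : Matrix (Fin m) (Fin m) R) :
    Matrix (Fin m) (Fin m) R[X] :=
  (Polynomial.X : R[X]) • F.map (Polynomial.C : R →+* R[X]) -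
    F.transpose.map (Polynomial.C : R →+* R[X])

/-- The determinant of `X F - Fᵗ`. -/
def pencilDet {R : Type*} [CommRing R] {m : ℕ} (F : Matrix (Fin m) (Fin m) R) : R[X] :=
  (pencil F).det

section commRing
variable {R : Type*} [CommRing R] {m : ℕ}

/-- Reversing the order of the rows makes the matrix upper triangular, at the cost of a sign. Hence
the determinant depends only on the antidiagonal. -/
lemma IsAntiTriangular.det_eq {F : Matrix (Fin m) (Fin m) R} (hF : IsAntiTriangular F) :
    ((Equiv.Perm.sign (Fin.revPerm : Equiv.Perm (Fin m)) : ℤ) : R) * F.det =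
      ∏ i, F (Fin.rev i) i := by
  rw [← Matrix.det_permute, Matrix.det_of_isUpperTriangular]
  · rfl
  · intro i j hij
    refine hF _ _ ?_
    have hij' : j < i := hij
    rw [Fin.lt_def] at hij'
    simp only [Fin.revPerm_apply, Fin.val_rev]
    have := i.2
    simp only [id_eq]
    omega

lemma isUnit_sign {n : ℕ} (σ : Equiv.Perm (Fin n)) :
    IsUnit ((Equiv.Perm.sign σ : ℤ) : R) :=
  (Equiv.Perm.sign σ).isUnit.map (Int.castRingHom R)

lemma IsAntiTriangular.isUnit_det_iff {F : Matrix (Fin m) (Fin m) R} (hF : IsAntiTriangular F) :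
    IsUnit F.det ↔ ∀ i, IsUnit (F i (Fin.rev i)) := by
  have h := (isUnit_sign (R := R) (Fin.revPerm : Equiv.Perm (Fin m))).mul_left_iff (b := F.det)
  rw [← h, hF.det_eq, IsUnit.prod_univ_iff]
  exact ⟨fun h i => by simpa using h (Fin.rev i), fun h i => by simpa using h (Fin.rev i)⟩

lemma IsAntiTriangular.det_eq_det {F G : Matrix (Fin m) (Fin m) R} (hF : IsAntiTriangular F)
    (hG : IsAntiTriangular G) (h : ∀ i, F i (Fin.rev i) = G i (Fin.rev i)) : F.det = G.det := by
  have h' : ∀ i, F (Fin.rev i) i = G (Fin.rev i) i := fun i => by simpa using h (Fin.rev i)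
  refine (isUnit_sign (R := R) (Fin.revPerm : Equiv.Perm (Fin m))).mul_left_cancel ?_
  rw [hF.det_eq, hG.det_eq]
  simp only [h']

/-- Transposition preserves antitriangularity and the set of antidiagonal positions, so XF − Fᵗ is
antitriangular with antidiagonal determined by that of F. -/
lemma IsAntiTriangular.pencilDet_eq {F G : Matrix (Fin m) (Fin m) R} (hF : IsAntiTriangular F)
    (hG : IsAntiTriangular G) (h : ∀ i, F i (Fin.rev i) = G i (Fin.rev i)) :
    pencilDet F = pencilDet G := by
  have key : ∀ {F : Matrix (Fin m) (Fin m) R}, IsAntiTriangular F →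
      IsAntiTriangular (pencil F) := by
    intro F hF i j hij
    simp [pencil, hF i j hij, hF j i (by omega)]
  refine (key hF).det_eq_det (key hG) fun i => ?_
  have h' : ∀ i, F (Fin.rev i) i = G (Fin.rev i) i := fun i => by simpa using h (Fin.rev i)
  simp [pencil, h i, h' i]

lemma pencilDet_congr (P F : Matrix (Fin m) (Fin m) R) :
    pencilDet (P * F * P.transpose) = Polynomial.C (P.det ^ 2) * pencilDet F := by
  have h : pencil (P * F * P.transpose) =
      P.map (Polynomial.C : R →+* R[X]) * pencil F *
        (P.map (Polynomial.C : R →+* R[X])).transpose := by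
    simp only [pencil, Matrix.map_mul, Matrix.transpose_mul, Matrix.transpose_map,
      Matrix.transpose_transpose, mul_sub, sub_mul, mul_smul_comm, smul_mul_assoc,
      Matrix.mul_assoc]
  have hd : (P.map (Polynomial.C : R →+* R[X])).det = Polynomial.C P.det :=
    (RingHom.map_det Polynomial.C P).symm
  rw [pencilDet, h, Matrix.det_mul, Matrix.det_mul, Matrix.det_transpose, hd, pencilDet, map_pow]
  ring

/-- XF − Fᵗ = F(X − F⁻¹Fᵗ). The pencil behaves well under congruence and needs no inverse, which is
why it replaces the characteristic polynomial in the induction. -/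
lemma pencilDet_eq_charpoly (F : GL (Fin m) R) :
    pencilDet F.val = Polynomial.C F.val.det * (asymmetry F).charpoly := by
  have hd : Polynomial.C F.val.det = (F.val.map (Polynomial.C : R →+* R[X])).det :=
    RingHom.map_det Polynomial.C F.val
  have hF : F.val.map (Polynomial.C : R →+* R[X]) * (F⁻¹).val.map Polynomial.C = 1 := by
    rw [← Matrix.map_mul, Units.mul_inv, Matrix.map_one _ (map_zero _) (map_one _)]
  rw [hd, Matrix.charpoly, ← Matrix.det_mul, pencilDet, pencil, Matrix.charmatrix, asymmetry]
  congr 1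
  rw [mul_sub, RingHom.mapMatrix_apply, Matrix.map_mul, ← Matrix.mul_assoc, hF, Matrix.one_mul,
    Matrix.scalar_apply, ← Matrix.smul_one_eq_diagonal, mul_smul_comm, Matrix.mul_one]

lemma isUnit_det (F : GL (Fin m) R) : IsUnit F.val.det :=
  (Matrix.isUnit_iff_isUnit_det _).1 F.isUnit

/-- The cross-multiplied hypothesis says that the asymmetries have the same characteristic
polynomial, and the trace is a coefficient of it up to sign. -/
lemma trace_asymmetry_eq (F G : GL (Fin m) R)
    (h : Polynomial.C G.val.det * pencilDet F.val = Polynomial.C F.val.det * pencilDet G.val) :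
    (asymmetry F).trace = (asymmetry G).trace := by
  have hu : IsUnit (Polynomial.C (F.val.det * G.val.det)) :=
    ((isUnit_det F).mul (isUnit_det G)).map Polynomial.C
  have hc : (asymmetry F).charpoly = (asymmetry G).charpoly := by
    refine hu.mul_left_cancel ?_
    rw [pencilDet_eq_charpoly, pencilDet_eq_charpoly] at h
    rw [map_mul]
    linear_combination h
  rcases isEmpty_or_nonempty (Fin m) with _ | _
  · simp [Matrix.trace]
  · rw [Matrix.trace_eq_neg_charpoly_coeff, Matrix.trace_eq_neg_charpoly_coeff, hc]

lemma IsAntiTriangular.isManageable {F : GL (Fin m) R} (hm : 2 ≤ m)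
    (hF : IsAntiTriangular F.val) : IsManageable F := by
  obtain ⟨m, rfl⟩ := Nat.exists_eq_add_of_le' hm
  obtain ⟨a, ha⟩ := (hF.isUnit_det_iff.1 (isUnit_det F) 0).exists_left_inv
  rw [Fin.rev_zero] at ha
  -- The first row of `F` has only its last entry. Therefore the last row of F⁻¹ has only its first
  -- entry, and the pivot is in column 0. This is off the diagonal because the size is at least 2.
  have h1 : Matrix.vecMul (Pi.single 0 a) F.val = Pi.single (Fin.last (m + 1)) 1 := by
    ext j
    rw [Matrix.single_vecMul]
    by_cases hj : j = Fin.last (m + 1)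
    · subst hj; simp [ha]
    · rw [Pi.single_eq_of_ne hj]
      have : (j : ℕ) ≠ m + 1 := fun h => hj (Fin.ext h)
      simp [hF 0 j (by have := j.2; simp; omega)]
  have h2 : Pi.single 0 a = (F⁻¹).val (Fin.last (m + 1)) := by
    have := congrArg (fun x => Matrix.vecMul x (F⁻¹).val) h1
    simp only [Matrix.vecMul_vecMul, Units.mul_inv, Matrix.vecMul_one] at this
    rw [this]
    ext j
    simp
  refine ⟨Fin.last (m + 1), 0, rfl, ?_, ?_, fun j hj => ?_⟩
  · rw [← h2]; exact Pi.single_eq_of_ne (Fin.last_pos.ne') _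
  · rw [← h2, Pi.single_eq_same]; exact IsUnit.of_mul_eq_one _ ha
  · rw [← h2]; exact Pi.single_eq_of_ne hj.ne' _

/-- The index `i` of the middle block of a matrix of size `m + 2`. -/
abbrev mid (i : Fin m) : Fin (m + 2) := i.castSucc.succ

lemma rev_mid (i : Fin m) : Fin.rev (mid i) = mid (Fin.rev i) := by
  rw [mid, Fin.rev_succ, Fin.rev_castSucc, ← Fin.succ_castSucc]

lemma sum_eq_mid {M : Type*} [AddCommMonoid M] (f : Fin (m + 2) → M) :
    ∑ i, f i = f 0 + (∑ i : Fin m, f (mid i)) + f (Fin.last (m + 1)) := by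
  rw [Fin.sum_univ_succ, Fin.sum_univ_castSucc, ← add_assoc]
  rfl

lemma eq_zero_or_mid_or_last (i : Fin (m + 2)) :
    i = 0 ∨ (∃ j : Fin m, i = mid j) ∨ i = Fin.last (m + 1) := by
  rcases Fin.eq_zero_or_eq_succ i with h | ⟨i, rfl⟩
  · exact Or.inl h
  · rcases Fin.eq_castSucc_or_eq_last i with ⟨j, rfl⟩ | rfl
    · exact Or.inr (Or.inl ⟨j, rfl⟩)
    · exact Or.inr (Or.inr rfl)

/-- Expanding along the first row and then along the first column gives the signs (−1)^(m+1) and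
(−1)^m, whose product is −1. -/
lemma det_eq_neg_mul_det_mid {N : Matrix (Fin (m + 2)) (Fin (m + 2)) R}
    (h0 : ∀ j, j ≠ Fin.last (m + 1) → N 0 j = 0) (h1 : ∀ i, i ≠ Fin.last (m + 1) → N i 0 = 0) :
    N.det = -(N 0 (Fin.last (m + 1)) * N (Fin.last (m + 1)) 0 * (N.submatrix mid mid).det) := by
  rw [Matrix.det_succ_row_zero, Finset.sum_eq_single (Fin.last (m + 1)),
    Matrix.det_succ_column_zero, Finset.sum_eq_single (Fin.last m)]
  · rw [Fin.succAbove_last, Fin.succAbove_last, Matrix.submatrix_submatrix]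
    have e1 : (Fin.succ ∘ Fin.castSucc : Fin m → Fin (m + 2)) = mid := rfl
    have e2 : (Fin.castSucc ∘ Fin.succ : Fin m → Fin (m + 2)) = mid :=
      funext fun i => (Fin.succ_castSucc i).symm
    rw [e1, e2]
    simp only [Matrix.submatrix_apply, Fin.succ_last, Fin.castSucc_zero, Fin.val_last, pow_succ]
    have : ((-1 : R) ^ m) * (-1) ^ m = 1 := by rw [← mul_pow]; simp
    linear_combination (-(N 0 (Fin.last (m + 1)) * N (Fin.last (m + 1)) 0 *
      (N.submatrix mid mid).det)) * this
  · intro i _ hi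
    have : N i.succ 0 = 0 := h1 _ fun h => hi (Fin.succ_injective _ (h.trans (Fin.succ_last m).symm))
    simp [Fin.succAbove_last, this]
  · simp
  · intro j _ hj
    simp [h0 j hj]
  · simp

lemma mul_mul_transpose_apply {n : ℕ} (P : Matrix (Fin n) (Fin m) R) (F : Matrix (Fin m) (Fin m) R)
    (i j : Fin n) : (P * F * P.transpose) i j = P i ⬝ᵥ F.mulVec (P j) := by
  rw [Matrix.mul_assoc]
  simp only [Matrix.mul_apply, dotProduct, Matrix.mulVec, Matrix.transpose_apply]

/-- The first row of `G` is `(0, …, 0, 1)` and the first column is `(0, …, 0, b)`. -/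
structure IsBordered (G : Matrix (Fin (m + 2)) (Fin (m + 2)) R) (b : R) : Prop where
  row : ∀ j, G 0 j = if j = Fin.last (m + 1) then 1 else 0
  col : ∀ i, G i 0 = if i = Fin.last (m + 1) then b else 0

section bordered
variable {G : Matrix (Fin (m + 2)) (Fin (m + 2)) R} {b : R}

lemma IsBordered.det_eq (h : IsBordered G b) : G.det = -(b * (G.submatrix mid mid).det) := by
  rw [det_eq_neg_mul_det_mid (fun j hj => by rw [h.row, if_neg hj])
    (fun j hj => by rw [h.col, if_neg hj]), h.row, h.col, if_pos rfl, if_pos rfl, one_mul]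

lemma IsBordered.det_submatrix_ne_zero (h : IsBordered G b) (hG : G.det ≠ 0) :
    (G.submatrix mid mid).det ≠ 0 := by
  intro h0
  rw [h.det_eq, h0, mul_zero, neg_zero] at hG
  exact hG rfl

/-- The border contributes a factor depending only on `b`. Cancelling it passes proportionality of
the pencil determinants to the middle blocks. -/
lemma IsBordered.pencilDet_eq (h : IsBordered G b) : pencilDet G =
    -((Polynomial.X - Polynomial.C b) * (Polynomial.X * Polynomial.C b - 1)) *
      pencilDet (G.submatrix mid mid) := by
  rw [pencilDet, det_eq_neg_mul_det_mid, neg_mul]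
  · congr 2
    simp [pencil, h.row, h.col]
  · intro j hj
    simp [pencil, h.row, h.col, hj]
  · intro j hj
    simp [pencil, h.row, h.col, hj]

lemma IsBordered.isAntiTriangular (h : IsBordered G b)
    (hG : IsAntiTriangular (G.submatrix mid mid)) : IsAntiTriangular G := by
  intro i j hij
  rcases eq_zero_or_mid_or_last i with rfl | ⟨i, rfl⟩ | rfl
  · rw [h.row, if_neg]
    rintro rfl
    simp at hij
  · rcases eq_zero_or_mid_or_last j with rfl | ⟨j, rfl⟩ | rfl
    · rw [h.col, if_neg]
      intro e
      rw [e] at hij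
      simp at hij
    · refine hG i j ?_
      simp at hij
      omega
    · simp at hij
      omega
  · simp at hij
    omega

/-- The block diagonal matrix with blocks `1`, `P`, `1`. -/
def borderOne (P : Matrix (Fin m) (Fin m) R) : Matrix (Fin (m + 2)) (Fin (m + 2)) R :=
  Matrix.of (Fin.cons (Pi.single 0 1) (Fin.snoc (fun i => Fin.cons 0 (Fin.snoc (P i) 0))
    (Pi.single (Fin.last (m + 1)) 1)))

lemma borderOne_zero (P : Matrix (Fin m) (Fin m) R) : borderOne P 0 = Pi.single 0 1 := rfl

lemma borderOne_last (P : Matrix (Fin m) (Fin m) R) :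
    borderOne P (Fin.last (m + 1)) = Pi.single (Fin.last (m + 1)) 1 := by
  rw [← Fin.succ_last]
  ext j
  simp only [borderOne, Matrix.of_apply, Fin.cons_succ, Fin.snoc_last]
  rfl

lemma borderOne_mid (P : Matrix (Fin m) (Fin m) R) (i : Fin m) :
    borderOne P (mid i) = Fin.cons 0 (Fin.snoc (P i) 0) := by
  ext j
  simp only [borderOne, Matrix.of_apply, Fin.cons_succ, Fin.snoc_castSucc]

lemma borderOne_apply_last (P : Matrix (Fin m) (Fin m) R) (j : Fin (m + 2)) :
    borderOne P j (Fin.last (m + 1)) = if j = Fin.last (m + 1) then 1 else 0 := by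
  rcases eq_zero_or_mid_or_last j with rfl | ⟨j, rfl⟩ | rfl
  · rw [borderOne_zero, Pi.single_eq_of_ne (Fin.last_pos.ne'), if_neg (Fin.last_pos.ne)]
  · rw [borderOne_mid, ← Fin.succ_last, Fin.cons_succ, Fin.snoc_last, if_neg]
    exact fun h => (Fin.castSucc_lt_last j).ne (Fin.succ_injective _ h)
  · rw [borderOne_last, Pi.single_eq_same, if_pos rfl]

/-- The first and last basis vectors are fixed, and no middle vector acquires a component along the
last one. The middle block can thus be changed by congruence while the first row and column stay the
same. -/
lemma IsBordered.borderOne_congr (h : IsBordered G b) (P : Matrix (Fin m) (Fin m) R) :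
    IsBordered (borderOne P * G * (borderOne P).transpose) b := by
  have hrow : G 0 = Pi.single (Fin.last (m + 1)) 1 := by
    ext j
    rw [h.row, Pi.single_apply]
  have hcol : G.col 0 = Pi.single (Fin.last (m + 1)) b := by
    ext j
    rw [Matrix.col_apply, h.col, Pi.single_apply]
  constructor
  · intro j
    rw [mul_mul_transpose_apply, borderOne_zero, single_one_dotProduct, Matrix.mulVec, hrow,
      single_one_dotProduct, borderOne_apply_last]
  · intro j
    rw [mul_mul_transpose_apply, borderOne_zero, Matrix.mulVec_single_one, hcol,
      dotProduct_single, borderOne_apply_last, ite_mul, one_mul, zero_mul]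

lemma borderOne_congr_submatrix (P : Matrix (Fin m) (Fin m) R)
    (G : Matrix (Fin (m + 2)) (Fin (m + 2)) R) :
    (borderOne P * G * (borderOne P).transpose).submatrix mid mid =
      P * G.submatrix mid mid * P.transpose := by
  have hd : ∀ (x : Fin (m + 2) → R) (i : Fin m),
      borderOne P (mid i) ⬝ᵥ x = ∑ a, P i a * x (mid a) := by
    intro x i
    rw [borderOne_mid, dotProduct, sum_eq_mid, ← Fin.succ_last]
    simp
  ext i j
  rw [Matrix.submatrix_apply, mul_mul_transpose_apply, mul_mul_transpose_apply, hd]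
  refine Finset.sum_congr rfl fun a _ => ?_
  rw [Matrix.mulVec, dotProduct_comm, hd, Matrix.mulVec, dotProduct_comm]
  rfl

lemma IsBordered.det_ne_zero [IsDomain R] (h : IsBordered G b) (hb : b ≠ 0)
    (hG : (G.submatrix mid mid).det ≠ 0) : G.det ≠ 0 := by
  rw [h.det_eq]
  exact neg_ne_zero.2 (mul_ne_zero hb hG)

end bordered

end commRing

section field
variable {k : Type*} [Field k] {m : ℕ}

/-- There is a basis with first vector `v` on which `φ` is zero except for the last vector. -/
lemma exists_flag_matrix {v φ : Fin (m + 2) → k} (hv : v ≠ 0) (hφ : φ ≠ 0) (hφv : φ ⬝ᵥ v = 0) :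
    ∃ P : Matrix (Fin (m + 2)) (Fin (m + 2)) k, P.det ≠ 0 ∧ P 0 = v ∧
      ∀ i, φ ⬝ᵥ P i = if i = Fin.last (m + 1) then 1 else 0 := by
  obtain ⟨i0, hi0⟩ := Function.ne_iff.1 hv
  obtain ⟨i1, hi1⟩ := Function.ne_iff.1 hφ
  simp only [Pi.zero_apply] at hi0 hi1
  let φl : (Fin (m + 2) → k) →ₗ[k] k := dotProductBilin k k φ
  have hφl : ∀ x, φl x = φ ⬝ᵥ x := fun x => rfl
  let W := LinearMap.ker φl
  let U := W ⊓ LinearMap.ker (LinearMap.proj i0 : (Fin (m + 2) → k) →ₗ[k] k)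
  have hW : ∀ x, x ∈ W ↔ φ ⬝ᵥ x = 0 := fun x => LinearMap.mem_ker
  have hU : ∀ x, x ∈ U ↔ φ ⬝ᵥ x = 0 ∧ x i0 = 0 := fun x => Submodule.mem_inf
  let e : Fin (m + 2) → k := Pi.single i1 (φ i1)⁻¹
  have he : φ ⬝ᵥ e = 1 := by simp [e, hi1]
  obtain ⟨d, ⟨bU⟩⟩ : ∃ d, Nonempty (Module.Basis (Fin d) k U) := ⟨_, ⟨Module.finBasis k U⟩⟩
  -- As `v i0 ≠ 0`, subtracting a multiple of `v` kills the coordinate `i0`, so U is a complement of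
  -- `v` in W.
  let bW : Module.Basis (Fin (d + 1)) k W := Module.Basis.mkFinConsOfLE v ((hW v).2 hφv) bU
    inf_le_left
    (fun c x hx h => by
      have := congrFun h i0
      simpa [((hU x).1 hx).2, hi0] using this)
    (fun z hz => ⟨-(z i0 / v i0), (hU _).2 ⟨by
      rw [dotProduct_add, dotProduct_smul, hφv, (hW z).1 hz]; simp, by simp [hi0]⟩⟩)
  let b : Module.Basis (Fin (d + 2)) k (Fin (m + 2) → k) := Module.Basis.mkFinCons e bW
    (fun c x hx h => by
      have := congrArg (φ ⬝ᵥ ·) h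
      simpa [he, (hW x).1 hx] using this)
    (fun z => ⟨-(φ ⬝ᵥ z), (hW _).2 (by rw [dotProduct_add, dotProduct_smul, he]; simp)⟩)
  have hd : m = d := by
    have := Module.finrank_eq_card_basis b
    simpa using this
  subst hd
  have hb0 : b 0 = e := by simp [b]
  have hbs : ∀ i, b (Fin.succ i) = bW i := fun i => by simp [b]
  have hbW : (bW 0 : Fin (m + 2) → k) = v := by simp [bW]
  -- The vector `e` outside W was put first. The rotation makes it last, and `v` becomes first.
  let b' := b.reindex (finRotate (m + 2)).symm
  have hb' : ∀ i, b' i = b (finRotate (m + 2) i) := fun i => by simp [b']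
  have hl : b' (Fin.last (m + 1)) = e := by rw [hb', finRotate_last, hb0]
  have hc : ∀ i : Fin (m + 1), b' i.castSucc = bW i := fun i => by
    rw [hb', ← hbs]
    congr 1
    simp
  refine ⟨Matrix.of b', ?_, ?_, fun i => ?_⟩
  · have : IsUnit (Matrix.of b') :=
      Matrix.linearIndependent_rows_iff_isUnit.1 b'.linearIndependent
    exact ((Matrix.isUnit_iff_isUnit_det _).1 this).ne_zero
  · exact (hc 0).trans hbW
  · change φ ⬝ᵥ b' i = _
    rcases Fin.eq_castSucc_or_eq_last i with ⟨j, rfl⟩ | rfl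
    · rw [hc, (hW _).1 (bW j).2, if_neg (Fin.castSucc_lt_last j).ne]
    · rw [hl, he, if_pos rfl]

/-- Reduction of a bilinear form along an isotropic eigenvector `v` of its asymmetry. -/
lemma exists_congr_bordered {F : Matrix (Fin (m + 2)) (Fin (m + 2)) k} (hF : F.det ≠ 0) {a : k}
    (ha : a ≠ 0) {v : Fin (m + 2) → k} (hv : v ≠ 0)
    (hFv : F.transpose.mulVec v = a • F.mulVec v) (hvv : v ⬝ᵥ F.mulVec v = 0) :
    ∃ P : Matrix (Fin (m + 2)) (Fin (m + 2)) k, P.det ≠ 0 ∧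
      (∀ j, (P * F * P.transpose) 0 j = if j = Fin.last (m + 1) then 1 else 0) ∧
      ∀ i, (P * F * P.transpose) i 0 = if i = Fin.last (m + 1) then a⁻¹ else 0 := by
  have hφ : F.transpose.mulVec v ≠ 0 := fun h =>
    (Matrix.det_transpose F ▸ hF) (Matrix.exists_mulVec_eq_zero_iff.1 ⟨v, hv, h⟩)
  have hφv : F.transpose.mulVec v ⬝ᵥ v = 0 := by
    rw [hFv, smul_dotProduct, dotProduct_comm, hvv, smul_zero]
  obtain ⟨P, hP, hP0, hPφ⟩ := exists_flag_matrix hv hφ hφv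
  refine ⟨P, hP, fun j => ?_, fun i => ?_⟩
  · rw [mul_mul_transpose_apply, hP0, Matrix.dotProduct_mulVec, ← Matrix.mulVec_transpose, hPφ]
  · rw [mul_mul_transpose_apply, hP0]
    have : F.mulVec v = a⁻¹ • F.transpose.mulVec v := by
      rw [hFv, smul_smul, inv_mul_cancel₀ ha, one_smul]
    rw [this, dotProduct_smul, dotProduct_comm, hPφ]
    simp

lemma eval_pencilDet (F : Matrix (Fin m) (Fin m) k) (a : k) :
    (pencilDet F).eval a = (a • F - F.transpose).det := by
  rw [pencilDet, ← Polynomial.coe_evalRingHom, RingHom.map_det]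
  congr 1
  ext i j
  simp [pencil]
  exact mul_comm _ _

lemma eval_pencilDet_eq_zero_iff {F : Matrix (Fin m) (Fin m) k} {a : k} :
    (pencilDet F).eval a = 0 ↔
      ∃ v : Fin m → k, v ≠ 0 ∧ F.transpose.mulVec v = a • F.mulVec v := by
  rw [eval_pencilDet, ← Matrix.exists_mulVec_eq_zero_iff]
  simp only [Matrix.sub_mulVec, Matrix.smul_mulVec, sub_eq_zero, eq_comm]

lemma ne_zero_of_eval_pencilDet_eq_zero {F : Matrix (Fin m) (Fin m) k} (hF : F.det ≠ 0) {a : k}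
    (h : (pencilDet F).eval a = 0) : a ≠ 0 := by
  rintro rfl
  rw [eval_pencilDet, zero_smul, zero_sub, Matrix.det_neg, Matrix.det_transpose] at h
  exact hF (by simpa using h)

lemma dotProduct_transpose_mulVec (F : Matrix (Fin m) (Fin m) k) (v w : Fin m → k) :
    v ⬝ᵥ F.transpose.mulVec w = w ⬝ᵥ F.mulVec v := by
  rw [Matrix.mulVec_transpose, dotProduct_comm, ← Matrix.dotProduct_mulVec]

/-- The form takes the same value at (v, v) as its transpose, so (a − 1) vᵗFv = 0. -/
lemma isotropic_of_ne_one {F : Matrix (Fin m) (Fin m) k} {a : k} (ha : a ≠ 1) {v : Fin m → k}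
    (hFv : F.transpose.mulVec v = a • F.mulVec v) : v ⬝ᵥ F.mulVec v = 0 := by
  have h := dotProduct_transpose_mulVec F v v
  rw [hFv, dotProduct_smul, smul_eq_mul] at h
  have : (a - 1) * (v ⬝ᵥ F.mulVec v) = 0 := by rw [sub_mul, h, one_mul, sub_self]
  exact (mul_eq_zero.1 this).resolve_left (sub_ne_zero.2 ha)

/-- If 1 is the only eigenvalue, an eigenvector need not be isotropic. The remedy is a second
eigenvector orthogonal to the first: if it is not isotropic either, a combination of the two is, by
extracting a square root. -/
lemma exists_isotropic_of_eval_pencilDet [IsAlgClosed k]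
    {F : Matrix (Fin (m + 2)) (Fin (m + 2)) k} (hF : F.det ≠ 0)
    (h1 : ∀ a, (pencilDet F).eval a = 0 → a = 1) :
    ∃ v : Fin (m + 2) → k, v ≠ 0 ∧ F.transpose.mulVec v = (1 : k) • F.mulVec v ∧
      v ⬝ᵥ F.mulVec v = 0 := by
  have hu : IsUnit F.det := isUnit_iff_ne_zero.2 hF
  let σ : Module.End k (Fin (m + 2) → k) := Matrix.toLin' (F⁻¹ * F.transpose)
  have hσ : ∀ x, F.mulVec (σ x) = F.transpose.mulVec x := by
    intro x
    simp [σ, Matrix.mulVec_mulVec, ← Matrix.mul_assoc, Matrix.mul_nonsing_inv _ hu]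
  have heig : ∀ (μ : k) (x : Fin (m + 2) → k), x ≠ 0 → σ x = μ • x →
      F.transpose.mulVec x = (1 : k) • F.mulVec x := by
    intro μ x hx hμ
    have h : F.transpose.mulVec x = μ • F.mulVec x := by
      rw [← hσ, hμ, Matrix.mulVec_smul]
    have := h1 μ (eval_pencilDet_eq_zero_iff.2 ⟨x, hx, h⟩)
    rw [← this]; exact h
  obtain ⟨μ, hμ⟩ := Module.End.exists_eigenvalue σ
  obtain ⟨v, hv⟩ := hμ.exists_hasEigenvector
  have hFv := heig μ v hv.2 hv.apply_eq_smul
  by_cases hvv : v ⬝ᵥ F.mulVec v = 0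
  · exact ⟨v, hv.2, hFv, hvv⟩
  let φl : (Fin (m + 2) → k) →ₗ[k] k := dotProductBilin k k (F.mulVec v)
  let W := LinearMap.ker φl
  have hW : ∀ x, x ∈ W ↔ F.mulVec v ⬝ᵥ x = 0 := fun x => LinearMap.mem_ker
  -- σ preserves the bilinear form and fixes `v`, so it preserves the orthogonal of `v`.
  have hinv : ∀ x ∈ W, σ x ∈ W := by
    intro x hx
    rw [hW] at hx ⊢
    rw [one_smul] at hFv
    rw [← hFv, dotProduct_comm, dotProduct_transpose_mulVec, hσ, dotProduct_transpose_mulVec,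
      dotProduct_comm, hx]
  have hnt : Nontrivial W := by
    rw [Submodule.nontrivial_iff_ne_bot]
    intro hbot
    have := LinearMap.finrank_le_finrank_of_injective (LinearMap.ker_eq_bot.1 hbot)
    simp at this
  obtain ⟨ν, hν⟩ := Module.End.exists_eigenvalue (σ.restrict hinv)
  obtain ⟨w, hw⟩ := hν.exists_hasEigenvector
  have hw0 : (w : Fin (m + 2) → k) ≠ 0 := fun h => hw.2 (Subtype.ext h)
  have hFw := heig ν w hw0 (congrArg Subtype.val hw.apply_eq_smul)
  by_cases hww : (w : Fin (m + 2) → k) ⬝ᵥ F.mulVec w = 0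
  · exact ⟨w, hw0, hFw, hww⟩
  have hwv : (w : Fin (m + 2) → k) ⬝ᵥ F.mulVec v = 0 := by
    rw [dotProduct_comm]; exact (hW _).1 w.2
  have hvw : v ⬝ᵥ F.mulVec w = 0 := by
    rw [← dotProduct_transpose_mulVec, hFv, one_smul, hwv]
  -- The cross terms vanish, so v + sw is isotropic when vᵗFv + s² wᵗFw = 0.
  obtain ⟨s, hs⟩ := IsAlgClosed.exists_eq_mul_self
    (-(v ⬝ᵥ F.mulVec v) / ((w : Fin (m + 2) → k) ⬝ᵥ F.mulVec w))
  refine ⟨v + s • (w : Fin (m + 2) → k), fun h => hvv ?_, ?_, ?_⟩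
  · have := congrArg (fun x => v ⬝ᵥ F.mulVec x) h
    simpa [Matrix.mulVec_add, Matrix.mulVec_smul, hvw] using this
  · rw [Matrix.mulVec_add, Matrix.mulVec_add, Matrix.mulVec_smul, Matrix.mulVec_smul, hFv, hFw]
    simp
  · simp only [Matrix.mulVec_add, Matrix.mulVec_smul, dotProduct_add, add_dotProduct,
      dotProduct_smul, smul_dotProduct, hvw, hwv, smul_eq_mul, mul_zero, add_zero, zero_add]
    rw [← mul_assoc, ← hs, div_mul_cancel₀ _ hww, add_neg_cancel]

lemma pencilDet_ne_zero {F : Matrix (Fin m) (Fin m) k} (hF : F.det ≠ 0) : pencilDet F ≠ 0 := by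
  intro h
  exact ne_zero_of_eval_pencilDet_eq_zero (a := 0) hF (by rw [h, Polynomial.eval_zero]) rfl

/-- Two invertible matrices with proportional pencil determinants are congruent to antitriangular
matrices with the same antidiagonal. -/
theorem exists_isAntiTriangular_congr [IsAlgClosed k] : ∀ (m : ℕ)
    (F₀ F₁ : Matrix (Fin m) (Fin m) k), F₀.det ≠ 0 → F₁.det ≠ 0 →
    (∃ c : k, c ≠ 0 ∧ pencilDet F₀ = Polynomial.C c * pencilDet F₁) →
    ∃ P₀ P₁ : Matrix (Fin m) (Fin m) k, P₀.det ≠ 0 ∧ P₁.det ≠ 0 ∧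
      IsAntiTriangular (P₀ * F₀ * P₀.transpose) ∧ IsAntiTriangular (P₁ * F₁ * P₁.transpose) ∧
      ∀ i, (P₀ * F₀ * P₀.transpose) i (Fin.rev i) = (P₁ * F₁ * P₁.transpose) i (Fin.rev i)
  | 0, F₀, F₁, _, _, _ => ⟨1, 1, by simp, by simp, fun i => i.elim0, fun i => i.elim0,
      fun i => i.elim0⟩
  | 1, F₀, F₁, h₀, h₁, _ => by
    -- In size one, congruence multiplies the entry by a square.
    obtain ⟨s, hs⟩ := IsAlgClosed.exists_eq_mul_self (F₀ 0 0 / F₁ 0 0)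
    rw [Matrix.det_fin_one] at h₀ h₁
    have hs0 : s ≠ 0 := by
      rintro rfl
      rw [mul_zero] at hs
      exact div_ne_zero h₀ h₁ hs
    refine ⟨1, Matrix.diagonal fun _ => s, by simp, by simpa using hs0,
      fun i j h => absurd h (by omega), fun i j h => absurd h (by omega), fun i => ?_⟩
    rw [Subsingleton.elim (Fin.rev i) i, Subsingleton.elim i 0]
    simp only [Matrix.one_mul, Matrix.transpose_one, Matrix.mul_one, Matrix.diagonal_transpose,
      Matrix.mul_diagonal, Matrix.diagonal_mul]
    rw [mul_right_comm, ← hs, div_mul_cancel₀ _ h₁]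
  | m + 2, F₀, F₁, h₀, h₁, ⟨c, hc, hp⟩ => by
    have hev : ∀ a, (pencilDet F₀).eval a = 0 ↔ (pencilDet F₁).eval a = 0 := by
      intro a
      rw [hp]
      simp [hc]
    obtain ⟨a, ha, ⟨v₀, hv₀, hF₀, hi₀⟩, ⟨v₁, hv₁, hF₁, hi₁⟩⟩ : ∃ a : k, a ≠ 0 ∧
        (∃ v, v ≠ 0 ∧ F₀.transpose.mulVec v = a • F₀.mulVec v ∧ v ⬝ᵥ F₀.mulVec v = 0) ∧
        (∃ v, v ≠ 0 ∧ F₁.transpose.mulVec v = a • F₁.mulVec v ∧ v ⬝ᵥ F₁.mulVec v = 0) := by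
      -- The two pencil determinants have the same roots. A root other than 1 gives isotropic
      -- eigenvectors at once; otherwise 1 is the only possible root for both matrices.
      by_cases h : ∃ a : k, (pencilDet F₀).eval a = 0 ∧ a ≠ 1
      · obtain ⟨a, h, ha⟩ := h
        obtain ⟨v₀, hv₀, hF₀⟩ := eval_pencilDet_eq_zero_iff.1 h
        obtain ⟨v₁, hv₁, hF₁⟩ := eval_pencilDet_eq_zero_iff.1 ((hev a).1 h)
        exact ⟨a, ne_zero_of_eval_pencilDet_eq_zero h₀ h,
          ⟨v₀, hv₀, hF₀, isotropic_of_ne_one ha hF₀⟩, ⟨v₁, hv₁, hF₁, isotropic_of_ne_one ha hF₁⟩⟩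
      · push Not at h
        exact ⟨1, one_ne_zero, exists_isotropic_of_eval_pencilDet h₀ h,
          exists_isotropic_of_eval_pencilDet h₁ fun a ha => h a ((hev a).2 ha)⟩
    obtain ⟨P₀, hP₀, hr₀, hc₀⟩ := exists_congr_bordered h₀ ha hv₀ hF₀ hi₀
    obtain ⟨P₁, hP₁, hr₁, hc₁⟩ := exists_congr_bordered h₁ ha hv₁ hF₁ hi₁
    have hpc₀ := pencilDet_congr P₀ F₀
    have hpc₁ := pencilDet_congr P₁ F₁
    have hd₀ : (P₀ * F₀ * P₀.transpose).det ≠ 0 := by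
      rw [Matrix.det_mul, Matrix.det_mul, Matrix.det_transpose]
      exact mul_ne_zero (mul_ne_zero hP₀ h₀) hP₀
    have hd₁ : (P₁ * F₁ * P₁.transpose).det ≠ 0 := by
      rw [Matrix.det_mul, Matrix.det_mul, Matrix.det_transpose]
      exact mul_ne_zero (mul_ne_zero hP₁ h₁) hP₁
    generalize hG₀ : P₀ * F₀ * P₀.transpose = G₀ at *
    generalize hG₁ : P₁ * F₁ * P₁.transpose = G₁ at *
    have hm₀ := (IsBordered.mk hr₀ hc₀).det_submatrix_ne_zero hd₀
    have hm₁ := (IsBordered.mk hr₁ hc₁).det_submatrix_ne_zero hd₁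
    obtain ⟨Q₀, Q₁, hQ₀, hQ₁, hA₀, hA₁, hA⟩ := exists_isAntiTriangular_congr m
      (G₀.submatrix mid mid) (G₁.submatrix mid mid) hm₀ hm₁ (by
        -- Congruence multiplies pencil determinants by squares of determinants. This is why the
        -- induction assumes proportionality and not equality.
        refine ⟨c * P₀.det ^ 2 / P₁.det ^ 2, div_ne_zero (mul_ne_zero hc (pow_ne_zero _ hP₀))
          (pow_ne_zero _ hP₁), ?_⟩
        rw [(IsBordered.mk hr₀ hc₀).pencilDet_eq, hp] at hpc₀
        rw [(IsBordered.mk hr₁ hc₁).pencilDet_eq] at hpc₁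
        have hne : -((Polynomial.X - Polynomial.C a⁻¹) * (Polynomial.X * Polynomial.C a⁻¹ - 1)) ≠
            (0 : k[X]) := by
          intro h0
          rw [h0, zero_mul] at hpc₁
          exact mul_ne_zero (Polynomial.C_ne_zero.2 (pow_ne_zero 2 hP₁)) (pencilDet_ne_zero h₁)
            hpc₁.symm
        refine mul_left_cancel₀ hne ?_
        rw [hpc₀, mul_left_comm (-_), hpc₁, div_eq_mul_inv, map_mul, map_mul]
        have : (Polynomial.C ((P₁.det ^ 2)⁻¹) * Polynomial.C (P₁.det ^ 2) : k[X]) = 1 := by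
          rw [← map_mul, inv_mul_cancel₀ (pow_ne_zero 2 hP₁), map_one]
        linear_combination (-(Polynomial.C c * Polynomial.C (P₀.det ^ 2) * pencilDet F₁)) * this)
    refine ⟨borderOne Q₀ * P₀, borderOne Q₁ * P₁, ?_⟩
    have e₀ : borderOne Q₀ * P₀ * F₀ * (borderOne Q₀ * P₀).transpose =
        borderOne Q₀ * G₀ * (borderOne Q₀).transpose := by
      rw [← hG₀, Matrix.transpose_mul]; simp only [Matrix.mul_assoc]
    have e₁ : borderOne Q₁ * P₁ * F₁ * (borderOne Q₁ * P₁).transpose =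
        borderOne Q₁ * G₁ * (borderOne Q₁).transpose := by
      rw [← hG₁, Matrix.transpose_mul]; simp only [Matrix.mul_assoc]
    have hB₀ := (IsBordered.mk hr₀ hc₀).borderOne_congr Q₀
    have hB₁ := (IsBordered.mk hr₁ hc₁).borderOne_congr Q₁
    have hs₀ := borderOne_congr_submatrix Q₀ G₀
    have hs₁ := borderOne_congr_submatrix Q₁ G₁
    rw [e₀, e₁]
    refine ⟨?_, ?_, hB₀.isAntiTriangular (hs₀ ▸ hA₀), hB₁.isAntiTriangular (hs₁ ▸ hA₁), fun i => ?_⟩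
    · rw [Matrix.det_mul]
      -- If `borderOne Q₀` were singular, the bordered matrix would be too, although its corners and
      -- its middle block are invertible.
      refine mul_ne_zero (fun h => hB₀.det_ne_zero (inv_ne_zero ha) (hs₀ ▸ ?_) ?_) hP₀
      · simp [Matrix.det_mul, hQ₀, hm₀]
      · simp [Matrix.det_mul, h]
    · rw [Matrix.det_mul]
      refine mul_ne_zero (fun h => hB₁.det_ne_zero (inv_ne_zero ha) (hs₁ ▸ ?_) ?_) hP₁
      · simp [Matrix.det_mul, hQ₁, hm₁]
      · simp [Matrix.det_mul, h]
    -- The corners are 1 and a⁻¹ in both matrices because the same eigenvalue `a` was used.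
    · rcases eq_zero_or_mid_or_last i with rfl | ⟨j, rfl⟩ | rfl
      · rw [hB₀.row, hB₁.row]
      · have := hA j
        rw [← hs₀, ← hs₁] at this
        rw [rev_mid]
        exact this
      · rw [Fin.rev_last, hB₀.col, hB₁.col]

end field

end BilinearQuantum

/-! ### The line between two antitriangular matrices. -/

namespace BilinearQuantum

section interpolation
variable {k : Type*} [Field k] {m : ℕ}

/-- Two invertible matrices whose asymmetries have the same characteristic polynomial are congruent
to antitriangular matrices with the same antidiagonal. -/
lemma exists_isAntiTriangular_of_charpoly_eq [IsAlgClosed k] (F₀ F₁ : GL (Fin m) k)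
    (h : (asymmetry F₀).charpoly = (asymmetry F₁).charpoly) :
    ∃ P₀ P₁ G₀ G₁ : GL (Fin m) k,
      G₀.val = P₀.val * F₀.val * P₀.val.transpose ∧ G₁.val = P₁.val * F₁.val * P₁.val.transpose ∧
      IsAntiTriangular G₀.val ∧ IsAntiTriangular G₁.val ∧
      ∀ i, G₀.val i (Fin.rev i) = G₁.val i (Fin.rev i) := by
  have h₀ := (isUnit_det F₀).ne_zero
  have h₁ := (isUnit_det F₁).ne_zero
  obtain ⟨P₀, P₁, hP₀, hP₁, hA₀, hA₁, hA⟩ := exists_isAntiTriangular_congr m F₀.val F₁.val h₀ h₁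
    ⟨F₀.val.det / F₁.val.det, div_ne_zero h₀ h₁, by
      rw [pencilDet_eq_charpoly, pencilDet_eq_charpoly, h, ← mul_assoc, ← map_mul,
        div_mul_cancel₀ _ h₁]⟩
  have key : ∀ {P F : Matrix (Fin m) (Fin m) k}, P.det ≠ 0 → F.det ≠ 0 →
      (P * F * P.transpose).det ≠ 0 := fun hP hF => by
    rw [Matrix.det_mul, Matrix.det_mul, Matrix.det_transpose]
    exact mul_ne_zero (mul_ne_zero hP hF) hP
  exact ⟨Matrix.GeneralLinearGroup.mkOfDetNeZero P₀ hP₀,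
    Matrix.GeneralLinearGroup.mkOfDetNeZero P₁ hP₁,
    Matrix.GeneralLinearGroup.mkOfDetNeZero _ (key hP₀ h₀),
    Matrix.GeneralLinearGroup.mkOfDetNeZero _ (key hP₁ h₁), rfl, rfl, hA₀, hA₁, hA⟩

/-- Two antitriangular matrices with the same antidiagonal are joined by a line of antitriangular
matrices with that antidiagonal. -/
lemma IsAntiTriangular.exists_line {G₀ G₁ : GL (Fin m) k} (h₀ : IsAntiTriangular G₀.val)
    (h₁ : IsAntiTriangular G₁.val) (h : ∀ i, G₀.val i (Fin.rev i) = G₁.val i (Fin.rev i)) :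
    ∃ F : GL (Fin m) k[X], IsAntiTriangular F.val ∧
      (∀ i, F.val i (Fin.rev i) = Polynomial.C (G₀.val i (Fin.rev i))) ∧
      BAlg.evalGL 0 F = G₀ ∧ BAlg.evalGL 1 F = G₁ := by
  let F : Matrix (Fin m) (Fin m) k[X] := Matrix.of fun i j =>
    Polynomial.C (G₀.val i j) + Polynomial.X * Polynomial.C (G₁.val i j - G₀.val i j)
  have hF : IsAntiTriangular F := fun i j hij => by simp [F, h₀ i j hij, h₁ i j hij]
  have hd : ∀ i, F i (Fin.rev i) = Polynomial.C (G₀.val i (Fin.rev i)) := fun i => by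
    simp [F, h i]
  -- Invertibility over k[t] holds because the antidiagonal consists of nonzero constants.
  have hu : IsUnit F.det := hF.isUnit_det_iff.2 fun i => by
    rw [hd]
    exact (h₀.isUnit_det_iff.1 (isUnit_det G₀) i).map Polynomial.C
  refine ⟨((Matrix.isUnit_iff_isUnit_det _).2 hu).unit, hF, hd, ?_, ?_⟩
  · ext i j
    simp [F]
  · ext i j
    simp [F]

/-- Congruence multiplies both the determinant and the pencil determinant by (det P)². -/
lemma trace_asymmetry_congr {R : Type*} [CommRing R] {F G P : GL (Fin m) R}
    (h : G.val = P.val * F.val * P.val.transpose) :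
    (asymmetry G).trace = (asymmetry F).trace := by
  refine trace_asymmetry_eq G F ?_
  rw [h, pencilDet_congr, Matrix.det_mul, Matrix.det_mul, Matrix.det_transpose]
  simp only [map_mul, map_pow]
  ring

/-- The constant matrix `constGL G` has the same antidiagonal as `F`, hence the same determinant and
pencil determinant. -/
lemma IsAntiTriangular.trace_asymmetry_eq_C {F : GL (Fin m) k[X]} {G : GL (Fin m) k}
    (hF : IsAntiTriangular F.val) (hG : IsAntiTriangular G.val)
    (h : ∀ i, F.val i (Fin.rev i) = Polynomial.C (G.val i (Fin.rev i))) :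
    (asymmetry F).trace = Polynomial.C (asymmetry G).trace := by
  have hG' : IsAntiTriangular (BAlg.constGL G).val := fun i j hij => by
    simp [hG i j hij]
  have h' : ∀ i, F.val i (Fin.rev i) = (BAlg.constGL G).val i (Fin.rev i) := fun i => by
    simp [h i]
  rw [trace_asymmetry_eq F (BAlg.constGL G)
    (by rw [hF.det_eq_det hG' h', hF.pencilDet_eq hG' h'])]
  rw [BAlg.trace_asymmetry, BAlg.trace_asymmetry, map_sum]
  refine Finset.sum_congr rfl fun a _ => ?_
  rw [map_sum]
  refine Finset.sum_congr rfl fun b _ => ?_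
  rw [map_mul]
  rfl

end interpolation

end BilinearQuantum

end

theorem theorem13 {k : Type u} [Field k] [IsAlgClosed k] (q : kˣ) (m : ℕ) (hm : 2 ≤ m)
    (F₀ F₁ : GL (Fin m) k)
    (h₀ : (BilinearQuantum.asymmetry F₀).trace = -(q : k) - (q : k)⁻¹)
    (h₁ : (BilinearQuantum.asymmetry F₁).trace = -(q : k) - (q : k)⁻¹)
    (hχ : (BilinearQuantum.asymmetry F₀).charpoly = (BilinearQuantum.asymmetry F₁).charpoly) :
    (BilinearQuantum.BAlg.coaction (BilinearQuantum.qMatrix q) F₀).IsGaloisObject ∧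
    (BilinearQuantum.BAlg.coaction (BilinearQuantum.qMatrix q) F₁).IsGaloisObject ∧
    LeftComoduleAlgebra.HomotopyEquivalent
      (BilinearQuantum.BAlg.coaction (BilinearQuantum.qMatrix q) F₀)
      (BilinearQuantum.BAlg.coaction (BilinearQuantum.qMatrix q) F₁) ∧
    ∃ F : GL (Fin m) k[X],
      BilinearQuantum.IsManageable F ∧
      (BilinearQuantum.asymmetry F).trace = Polynomial.C (-(q : k) - (q : k)⁻¹) ∧
      (∃ P : GL (Fin m) k, (BilinearQuantum.BAlg.evalGL 0 F).val =
        P.val * F₀.val * P.val.transpose) ∧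
      (∃ P : GL (Fin m) k, (BilinearQuantum.BAlg.evalGL 1 F).val =
        P.val * F₁.val * P.val.transpose) ∧
      LeftComoduleAlgebra.IsHomotopy
        (BilinearQuantum.BAlg.polyCoaction (BilinearQuantum.qMatrix q) F)
        (BilinearQuantum.BAlg.coaction (BilinearQuantum.qMatrix q) F₀)
        (BilinearQuantum.BAlg.coaction (BilinearQuantum.qMatrix q) F₁) := by
  obtain ⟨P₀, P₁, G₀, G₁, hG₀, hG₁, hA₀, hA₁, hA⟩ :=
    BilinearQuantum.exists_isAntiTriangular_of_charpoly_eq F₀ F₁ hχ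
  -- The antitriangular forms of F₀ and F₁ are replaced by the values F(0) and F(1) of the line.
  obtain ⟨F, hF, hFd, rfl, rfl⟩ := hA₀.exists_line hA₁ hA
  have hman := hF.isManageable hm
  have htr := hF.trace_asymmetry_eq_C hA₀ hFd
  rw [BilinearQuantum.trace_asymmetry_congr hG₀, h₀] at htr
  have hhom : LeftComoduleAlgebra.IsHomotopy
      (BilinearQuantum.BAlg.polyCoaction (BilinearQuantum.qMatrix q) F)
      (BilinearQuantum.BAlg.coaction (BilinearQuantum.qMatrix q) F₀)
      (BilinearQuantum.BAlg.coaction (BilinearQuantum.qMatrix q) F₁) :=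
    ⟨BilinearQuantum.BAlg.polyCoaction_isGaloisObject hman htr,
      (BilinearQuantum.BAlg.evalAt_polyCoaction_isIsomorphic _ F 0).trans
        (BilinearQuantum.BAlg.coaction_isIsomorphic_of_congr P₀ hG₀),
      (BilinearQuantum.BAlg.evalAt_polyCoaction_isIsomorphic _ F 1).trans
        (BilinearQuantum.BAlg.coaction_isIsomorphic_of_congr P₁ hG₁)⟩
  exact ⟨BilinearQuantum.BAlg.coaction_isGaloisObject P₀ hG₀ (hA₀.isManageable hm)
      ((BilinearQuantum.trace_asymmetry_congr hG₀).trans h₀),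
    BilinearQuantum.BAlg.coaction_isGaloisObject P₁ hG₁ (hA₁.isManageable hm)
      ((BilinearQuantum.trace_asymmetry_congr hG₁).trans h₁),
    ⟨_, _, _, _, hhom⟩, F, hman, htr, ⟨P₀, hG₀⟩, ⟨P₁, hG₁⟩, hhom⟩
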